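/- Let $n\ge 1$ be an integer and $s\in(0,1)$. Write $x=(x_1,x')\in\mathbb R^n$, $x_*=(-x_1,x')$, $\mathbb R^n_+=\{x_1>0\}$ and $B_r(x)$ for the open ball, $B_1=B_1(0)$; a function $u:\mathbb R^n\to\mathbb R$ is called antisymmetric if $u(x_*)=-u(x)$ for all $x\in\mathbb R^n$. Let $\mathscr L_s(\mathbb R^n)$ be the set of $u\in L^1_{\rm loc}(\mathbb R^n)$ with $\int_{\mathbb R^n}\frac{|u(x)|}{1+|x|^{n+2s}}\,dx<\infty$, put $$\|u\|_{\mathscr A_s(\mathbb R^n)}=\int_{\mathbb R^n_+}\frac{x_1|u(x)|}{1+|x|^{n+2s+2}}\,dx,$$ and let $$(-\Delta)^su(x)=c_{n,s}\lim_{\varepsilon\to0^+}\int_{\mathbb R^n\setminus B_\varepsilon(x)}\frac{u(x)-u(y)}{|x-y|^{n+2s}}\,dy,\qquad c_{n,s}=\frac{s\,4^s\,\Gamma\left(\frac{n+2s}2\right)}{\pi^{n/2}\,\Gamma(1-s)}.$$ For $\beta>0$ not an integer, $C^\beta(B_1)$ is the Hölder space $C^{k,\beta-k}(B_1)$, $k=\lfloor\beta\rfloor$: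 the functions that are $k$ times continuously differentiable in $B_1$ and whose $k$-th derivatives are Hölder continuous with exponent $\beta-k$ on compact subsets of $B_1$. Let $\gamma_{n,s}=\frac{\sin(\pi s)\,\Gamma(n/2)}{\pi^{n/2+1}}$ and $$\psi_s(y)=n(n+2)\,\gamma_{n,s}\int_0^{\min\{1/|y|,\,1\}}\frac{r^{2s+n+1}}{(1-r^2)^s}\,dr\qquad(y\in\mathbb R^n),$$ the upper limit being $1$ at $y=0$. Then $\psi_s$ is continuous and radially symmetric on $\mathbb R^n$, and there is a constant $C>1$, depending only on $n$ and $s$, such that $$\frac{C^{-1}}{1+|y|^{n+2s+2}}\le\psi_s(y)\le\frac{C}{1+|y|^{n+2s+2}}\qquad\text{for all }y\in\mathbb R^n,$$ and such that the following holds. Let $\alpha>0$ with $2s+\alpha$ not an integer, and let $u\in C^{2s+\alpha}(B_1)\cap\mathscr L_s(\mathbb R^n)$ be antisymmetric with $(-\Delta)^su=0$ in $B_1$. Then $y\mapsto y_1\psi_s(y)u(y)$ is integrable on $\mathbb R^n$, the partial derivative $\frac{\partial u}{\partial x_1}(0)$ exists, and $$\frac{\partial u}{\partial x_1}(0)=\int_{\mathbb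 R^n}y_1\,\psi_s(y)\,u(y)\,dy.$$ In particular, if $u\ge0$ in $\mathbb R^n_+$, then $\|u\|_{\mathscr A_s(\mathbb R^n)}<\infty$ and $$C^{-1}\,\|u\|_{\mathscr A_s(\mathbb R^n)}\le\frac{\partial u}{\partial x_1}(0)\le C\,\|u\|_{\mathscr A_s(\mathbb R^n)}.$$ -/

import Mathlib

open MeasureTheory Filter Topology

noncomputable section

namespace AntisymHarmonic

/-- `ℝⁿ` with its Euclidean norm. The coordinate `x₁` of `x` is `x 0`. -/
abbrev Rn (n : ℕ) : Type := EuclideanSpace ℝ (Fin n)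

/-- The first unit vector `e₁`. -/
def e1 (n : ℕ) [NeZero n] : Rn n := EuclideanSpace.single 0 1

/-- The reflection `x_* = (-x₁, x')` of `x = (x₁, x')` across the plane `{x₁ = 0}`. -/
def reflect {n : ℕ} [NeZero n] (x : Rn n) : Rn n :=
  WithLp.toLp 2 (fun i => if i = 0 then -x i else x i)

/-- `u` is antisymmetric: `u(x_*) = -u(x)` for all `x`. -/
def Antisymmetric {n : ℕ} [NeZero n] (u : Rn n → ℝ) : Prop :=
  ∀ x, u (reflect x) = -u x

/-- The open half-space `ℝⁿ₊ = {x₁ > 0}`. -/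
def halfSpace (n : ℕ) [NeZero n] : Set (Rn n) := {x | 0 < x 0}

/-- The Hölder space `C^β(Ω) = C^{k,β'}(Ω)` on an open set `Ω`, for `β > 0` not an integer, where
`k` is the integer part of `β` and `β' = β - k`: `u` is `k` times continuously differentiable in
`Ω`, and its `k`-th derivative is Hölder continuous with exponent `β'` on the compact subsets
of `Ω`. -/
def HolderSpace {n : ℕ} (β : ℝ) (Ω : Set (Rn n)) (u : Rn n → ℝ) : Prop :=
  ContDiffOn ℝ ⌊β⌋₊ u Ω ∧
    ∀ K ⊆ Ω, IsCompact K → ∃ M : ℝ, ∀ x ∈ K, ∀ y ∈ K,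
      ‖iteratedFDeriv ℝ ⌊β⌋₊ u x - iteratedFDeriv ℝ ⌊β⌋₊ u y‖ ≤ M * ‖x - y‖ ^ Int.fract β

/-- The space `ℒ_s(ℝⁿ)`: locally integrable functions with
`∫ |u(x)| / (1 + |x|^{n+2s}) dx < ∞`. -/
def LSpace {n : ℕ} (s : ℝ) (u : Rn n → ℝ) : Prop :=
  LocallyIntegrable u ∧ Integrable (fun x : Rn n => |u x| / (1 + ‖x‖ ^ ((n : ℝ) + 2 * s)))

/-- The integrand `x₁ |u(x)| / (1 + |x|^{n+2s+2})` of the norm of `𝒜_s(ℝⁿ)`. -/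
def ADensity {n : ℕ} [NeZero n] (s : ℝ) (u : Rn n → ℝ) (x : Rn n) : ℝ :=
  x 0 * |u x| / (1 + ‖x‖ ^ ((n : ℝ) + 2 * s + 2))

/-- `‖u‖_{𝒜_s(ℝⁿ)} = ∫_{ℝⁿ₊} x₁ |u(x)| / (1 + |x|^{n+2s+2}) dx`. -/
def ANorm {n : ℕ} [NeZero n] (s : ℝ) (u : Rn n → ℝ) : ℝ :=
  ∫ x in halfSpace n, ADensity s u x

/-- The normalisation constant `c_{n,s} = s π^{-n/2} 4^s Γ((n+2s)/2) / Γ(1-s)` of the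
fractional Laplacian. -/
def cConst (n : ℕ) (s : ℝ) : ℝ :=
  s * Real.pi ^ (-(n : ℝ) / 2) * 4 ^ s * Real.Gamma (((n : ℝ) + 2 * s) / 2) / Real.Gamma (1 - s)

/-- `(-Δ)^s u(x) = v`, where
`(-Δ)^s u(x) = c_{n,s} lim_{ε → 0⁺} ∫_{ℝⁿ ∖ B_ε(x)} (u(x) - u(y)) / |x - y|^{n+2s} dy`.
For `u` in `ℒ_s(ℝⁿ)` the truncated integrals converge absolutely for every `ε > 0`. -/
def HasFracLaplacianAt {n : ℕ} (s : ℝ) (u : Rn n → ℝ) (x : Rn n) (v : ℝ) : Prop :=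
  Tendsto
    (fun ε : ℝ => cConst n s *
      ∫ y in (Metric.ball x ε)ᶜ, (u x - u y) / ‖x - y‖ ^ ((n : ℝ) + 2 * s))
    (𝓝[>] 0) (𝓝 v)

/-- `(-Δ)^s u = 0` in `Ω`. -/
def SHarmonicIn {n : ℕ} (s : ℝ) (Ω : Set (Rn n)) (u : Rn n → ℝ) : Prop :=
  ∀ x ∈ Ω, HasFracLaplacianAt s u x 0

/-- The constant `γ_{n,s} = sin(π s) Γ(n/2) / π^{n/2+1}`. -/
def gammaConst (n : ℕ) (s : ℝ) : ℝ :=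
  Real.sin (Real.pi * s) * Real.Gamma ((n : ℝ) / 2) / Real.pi ^ ((n : ℝ) / 2 + 1)

/-- `ψ_s(y) = n (n+2) γ_{n,s} ∫_0^{min{1/|y|, 1}} r^{2s+n+1} / (1 - r²)^s dr`.
The upper limit is written `1 / max{|y|, 1}`, which equals `1` for `|y| ≤ 1`, also at `y = 0`. -/
def psi {n : ℕ} (s : ℝ) (y : Rn n) : ℝ :=
  (n : ℝ) * ((n : ℝ) + 2) * gammaConst n s *
    ∫ r in (0 : ℝ)..(1 / max ‖y‖ 1), r ^ (2 * s + (n : ℝ) + 1) / (1 - r ^ 2) ^ s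

end AntisymHarmonic

end

/-!
The derivative formula is a differentiated mean value formula for `s`-harmonic functions, with a
kernel adapted to `ψ_s`.

Let `H` be the radial function (`meanKernel`) with `∇H(y) = -ψ_s(y) y` that vanishes at infinity;
it decays like `|y|^{-n-2s}` and has integral `1` (`integral_meanKernel`). Its dilation derivative
`T = n H - |y|² ψ_s` (`dilationKernel`), for which `d/dρ [ρⁿ H(ρ w)] = ρ^{n-1} T(ρ w)`, is a
constant multiple of the fractional Laplacian of the compactly supported function
`(1 - |y|²)_+^{1+s}` (`exists_dilationKernel_eq`). Both sides being radial, it suffices for this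
to compare their integrals against all Gaussians `e^{-t|x|²}`: both are constant multiples of
`t^s ∫ |x|^{2s} (1 - |x|²)_+ e^{-t|x|²} dx` (`integral_dilationKernel_mul_exp`,
`integral_symTrunc_bump_mul_exp`), and the Gaussian averages determine a continuous, decaying
radial function (`eq_zero_of_forall_integral_mul_exp_eq_zero`).

Since `u` is `s`-harmonic in `B_1`, it is orthogonal to the fractional Laplacian of every test
function supported in a smaller ball (`IsTestFunction.integral_symTrunc_mul_eq_zero`). The
regularity of `u` enters here, as a uniform bound for the truncated singular integrals of `u` on
smaller balls (`exists_abs_fracTrunc_le`). Hence `∫ ρⁿ H(ρ (y - x)) u(y) dy` does not depend on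
`ρ > 1 / (1 - |x|)`; its limit as `ρ → ∞` is `u(x)`, so it equals `u(x)`
(`integral_rho_meanKernel_mul`).

Differentiating in `x₁` at the origin gives `∂₁u(0) = ∫ ρ^{n+2} y₁ ψ_s(ρ y) u(y) dy` for every
`ρ > 1`, and dominated convergence as `ρ → 1` gives the claim
(`hasLineDerivAt_integral_mul_psi`). Antisymmetry is needed only for the final estimates: then
`y₁ ψ_s u` is even under the reflection, the integral is twice the one over the half-space, and
the two-sided bounds for `ψ_s` apply.
-/

namespace AntisymHarmonic

/-! ### Weights and integrability -/

/-- The weight `1 + |x|^{n+2s}` of the space `ℒ_s(ℝⁿ)`. -/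
noncomputable def weight {n : ℕ} (s : ℝ) (x : Rn n) : ℝ := 1 + ‖x‖ ^ ((n : ℝ) + 2 * s)

lemma weight_pos {n : ℕ} (s : ℝ) (x : Rn n) : 0 < weight s x := by
  unfold weight; positivity

lemma one_le_weight {n : ℕ} (s : ℝ) (x : Rn n) : 1 ≤ weight s x := by
  unfold weight
  have : 0 ≤ ‖x‖ ^ ((n : ℝ) + 2 * s) := by positivity
  linarith

lemma rpow_le_weight {n : ℕ} (s : ℝ) (x : Rn n) : ‖x‖ ^ ((n : ℝ) + 2 * s) ≤ weight s x := by
  unfold weight; linarith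

lemma exponent_pos (n : ℕ) [NeZero n] {s : ℝ} (hs : 0 < s) : 0 < (n : ℝ) + 2 * s := by
  positivity

lemma continuous_weight {n : ℕ} [NeZero n] {s : ℝ} (hs : 0 < s) :
    Continuous (weight s : Rn n → ℝ) := by
  unfold weight
  exact continuous_const.add (continuous_norm.rpow_const fun _ => Or.inr (exponent_pos n hs).le)

/-- Translating and rescaling the variable lowers the weight by at most a constant factor, uniformly
for bounded `x` and `R`, so bounds of kernels by `1 / weight` are stable under these operations. -/
lemma weight_le_weight_affine {n : ℕ} [NeZero n] {s : ℝ} (hs : 0 < s) (M R₀ : ℝ) :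
    ∃ K : ℝ, 0 < K ∧ ∀ x y : Rn n, ‖x‖ ≤ M → ∀ R, 0 < R → R ≤ R₀ →
      weight s y ≤ K * weight s (R⁻¹ • (y - x)) := by
  set p := (n : ℝ) + 2 * s with hp
  have hp0 : 0 < p := exponent_pos n hs
  refine ⟨1 + (|M| + |R₀|) ^ p, by positivity, fun x y hx R hR hR0 => ?_⟩
  set w := R⁻¹ • (y - x) with hw
  have hy : y = x + R • w := by
    rw [hw, smul_smul, mul_inv_cancel₀ hR.ne', one_smul]; abel
  have h1 : ‖y‖ ≤ (|M| + |R₀|) * max 1 ‖w‖ := by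
    calc ‖y‖ ≤ ‖x‖ + ‖R • w‖ := by rw [hy]; exact norm_add_le _ _
      _ ≤ |M| * max 1 ‖w‖ + |R₀| * max 1 ‖w‖ := by
        rw [norm_smul, Real.norm_of_nonneg hR.le]
        gcongr
        · calc ‖x‖ ≤ |M| * 1 := by rw [mul_one]; exact hx.trans (le_abs_self M)
            _ ≤ _ := by gcongr; exact le_max_left _ _
        · exact hR0.trans (le_abs_self _)
        · exact le_max_right _ _
      _ = _ := by ring
  have h2 : (max 1 ‖w‖) ^ p ≤ 1 + ‖w‖ ^ p := by
    rcases le_total 1 ‖w‖ with h | h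
    · rw [max_eq_right h]; linarith
    · rw [max_eq_left h, Real.one_rpow]
      have : 0 ≤ ‖w‖ ^ p := by positivity
      linarith
  have h3 : ‖y‖ ^ p ≤ (|M| + |R₀|) ^ p * (1 + ‖w‖ ^ p) := by
    calc ‖y‖ ^ p ≤ ((|M| + |R₀|) * max 1 ‖w‖) ^ p := by gcongr
      _ = (|M| + |R₀|) ^ p * (max 1 ‖w‖) ^ p := Real.mul_rpow (by positivity) (by positivity)
      _ ≤ _ := by gcongr
  have h4 : 0 ≤ ‖w‖ ^ p := by positivity
  unfold weight
  rw [← hp]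
  nlinarith

lemma inv_rpow_dist_le {n : ℕ} [NeZero n] {s : ℝ} (hs : 0 < s) (M : ℝ) {ε : ℝ} (hε : 0 < ε) :
    ∃ K : ℝ, 0 < K ∧ ∀ x y : Rn n, ‖x‖ ≤ M → ε ≤ ‖x - y‖ →
      1 / ‖x - y‖ ^ ((n : ℝ) + 2 * s) ≤ K / weight s y := by
  obtain ⟨K, hK, h⟩ := weight_le_weight_affine (n := n) hs M 1
  set p := (n : ℝ) + 2 * s with hp
  have hp0 : 0 < p := exponent_pos n hs
  refine ⟨K * ((ε ^ p)⁻¹ + 1), by positivity, fun x y hx hxy => ?_⟩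
  have h1 := h x y hx 1 one_pos le_rfl
  rw [inv_one, one_smul] at h1
  have hpos : 0 < ‖x - y‖ := hε.trans_le hxy
  have h2 : weight s (y - x) ≤ ((ε ^ p)⁻¹ + 1) * ‖x - y‖ ^ p := by
    unfold weight
    rw [norm_sub_rev, ← hp, add_mul, one_mul]
    gcongr
    have : ε ^ p ≤ ‖x - y‖ ^ p := by gcongr
    rw [inv_mul_eq_div, le_div_iff₀ (by positivity)]
    linarith
  rw [div_le_div_iff₀ (by positivity) (weight_pos s y), one_mul]
  calc weight s y ≤ K * weight s (y - x) := h1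
    _ ≤ K * (((ε ^ p)⁻¹ + 1) * ‖x - y‖ ^ p) := by gcongr
    _ = _ := by ring

lemma LSpace.integrable {n : ℕ} {s : ℝ} {u : Rn n → ℝ} (hu : LSpace s u) :
    Integrable (fun y => |u y| / weight s y) := hu.2

lemma LSpace.aestronglyMeasurable {n : ℕ} {s : ℝ} {u : Rn n → ℝ} (hu : LSpace s u) :
    AEStronglyMeasurable u volume := hu.1.aestronglyMeasurable

lemma LSpace.integrable_kernel_mul {n : ℕ} {s : ℝ} {u k : Rn n → ℝ} (hu : LSpace s u)
    (hk : AEStronglyMeasurable k volume) {K : ℝ} (hK : ∀ y, |k y| ≤ K / weight s y) :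
    Integrable (fun y => k y * u y) := by
  refine Integrable.mono' (hu.integrable.const_mul K) (hk.mul hu.aestronglyMeasurable) ?_
  refine Eventually.of_forall fun y => ?_
  rw [Real.norm_eq_abs, abs_mul]
  calc |k y| * |u y| ≤ K / weight s y * |u y| := by gcongr; exact hK y
    _ = _ := by ring

lemma finrank_Rn (n : ℕ) : Module.finrank ℝ (Rn n) = n := by simp

/-- Integrability of `min(1, |z|^β) |z|^{-n-2s}` for `β > 2s`: the bound for second differences
against the kernel of the fractional Laplacian. -/
lemma integrable_min_rpow_div {n : ℕ} [NeZero n] {s β : ℝ} (hs : 0 < s) (hβ : 2 * s < β) :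
    Integrable (fun z : Rn n => min 1 (‖z‖ ^ β) / ‖z‖ ^ ((n : ℝ) + 2 * s)) := by
  rw [integrable_fun_norm_addHaar (E := Rn n) volume
    (f := fun r : ℝ => min 1 (r ^ β) / r ^ ((n : ℝ) + 2 * s)), finrank_Rn]
  have hn : 1 ≤ n := NeZero.one_le
  have hcast : ((n - 1 : ℕ) : ℝ) = (n : ℝ) - 1 := by push_cast [hn]; ring
  rw [← Set.Ioc_union_Ioi_eq_Ioi (zero_le_one (α := ℝ))]
  refine IntegrableOn.union ?_ ?_
  · have h : IntegrableOn (fun r : ℝ => r ^ (β - 2 * s - 1)) (Set.Ioc 0 1) := by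
      rw [integrableOn_Ioc_iff_integrableOn_Ioo]
      exact (intervalIntegral.integrableOn_Ioo_rpow_iff one_pos).2 (by linarith)
    refine h.congr_fun (fun r hr => ?_) measurableSet_Ioc
    have hr0 : 0 < r := hr.1
    have : min 1 (r ^ β) = r ^ β :=
      min_eq_right (Real.rpow_le_one hr0.le hr.2 (by linarith))
    simp only [smul_eq_mul]
    rw [this, ← Real.rpow_natCast, hcast, ← Real.rpow_sub hr0, ← Real.rpow_add hr0]
    congr 1; ring
  · have h : IntegrableOn (fun r : ℝ => r ^ (-1 - 2 * s)) (Set.Ioi 1) :=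
      integrableOn_Ioi_rpow_of_lt (by linarith) one_pos
    refine h.congr_fun (fun r hr => ?_) measurableSet_Ioi
    have hr1 : 1 < r := hr
    have hr0 : 0 < r := by linarith
    have : min 1 (r ^ β) = 1 := min_eq_left (Real.one_le_rpow hr1.le (by linarith))
    simp only [smul_eq_mul]
    rw [this, ← Real.rpow_natCast, hcast, one_div, ← Real.rpow_neg hr0.le, ← Real.rpow_add hr0]
    congr 1; ring

lemma integrable_inv_weight {n : ℕ} [NeZero n] {s : ℝ} (hs : 0 < s) :
    Integrable (fun x : Rn n => 1 / weight s x) := by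
  have hp0 := exponent_pos n hs
  set p := (n : ℝ) + 2 * s with hp
  have h : Integrable (fun x : Rn n => (2 : ℝ) ^ p * (1 + ‖x‖) ^ (-p)) :=
    (integrable_one_add_norm (by rw [finrank_Rn]; linarith)).const_mul _
  refine h.mono' ?_ (Eventually.of_forall fun x => ?_)
  · exact (continuous_const.div (continuous_weight hs)
      fun x => (weight_pos s x).ne').aestronglyMeasurable
  · rw [Real.norm_of_nonneg (by have := weight_pos s x; positivity), Real.rpow_neg (by positivity),
      ← div_eq_mul_inv, div_le_div_iff₀ (weight_pos s x) (by positivity), one_mul]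
    have h1 : 1 + ‖x‖ ≤ 2 * max 1 ‖x‖ := by
      linarith [le_max_left 1 ‖x‖, le_max_right 1 ‖x‖]
    calc (1 + ‖x‖) ^ p ≤ (2 * max 1 ‖x‖) ^ p := by gcongr
      _ = 2 ^ p * (max 1 ‖x‖) ^ p := Real.mul_rpow (by norm_num) (by positivity)
      _ ≤ 2 ^ p * weight s x := by
        gcongr
        rcases le_total 1 ‖x‖ with h | h
        · rw [max_eq_right h]; exact rpow_le_weight s x
        · rw [max_eq_left h, Real.one_rpow]; exact one_le_weight s x

/-! ### The profile of `ψ_s` -/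

/-- The integral `∫_m^∞ v^{-s} (1 + v)^{-a} dv`. -/
noncomputable def tailIntegral (s a m : ℝ) : ℝ := ∫ v in Set.Ioi m, v ^ (-s) * (1 + v) ^ (-a)

lemma integrableOn_tail {s a : ℝ} (hs1 : s < 1) (ha : 1 - s < a) :
    IntegrableOn (fun v : ℝ => v ^ (-s) * (1 + v) ^ (-a)) (Set.Ioi 0) := by
  have ha0 : 0 < a := by linarith
  have hm : ∀ t : Set ℝ, AEStronglyMeasurable (fun v : ℝ => v ^ (-s) * (1 + v) ^ (-a))
      (volume.restrict t) := fun t => by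
    refine Measurable.aestronglyMeasurable ?_
    fun_prop
  rw [← Set.Ioc_union_Ioi_eq_Ioi (zero_le_one (α := ℝ))]
  refine IntegrableOn.union ?_ ?_
  · have h : IntegrableOn (fun r : ℝ => r ^ (-s)) (Set.Ioc 0 1) := by
      rw [integrableOn_Ioc_iff_integrableOn_Ioo]
      exact (intervalIntegral.integrableOn_Ioo_rpow_iff one_pos).2 (by linarith)
    refine Integrable.mono' h (hm _) ?_
    filter_upwards [ae_restrict_mem measurableSet_Ioc] with v hv
    have hv0 : 0 < v := hv.1
    rw [Real.norm_of_nonneg (by positivity)]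
    have : (1 + v) ^ (-a) ≤ 1 := Real.rpow_le_one_of_one_le_of_nonpos (by linarith) (by linarith)
    have h2 : 0 ≤ v ^ (-s) := by positivity
    nlinarith
  · have h : IntegrableOn (fun r : ℝ => r ^ (-s - a)) (Set.Ioi 1) :=
      integrableOn_Ioi_rpow_of_lt (by linarith) one_pos
    refine Integrable.mono' h (hm _) ?_
    filter_upwards [ae_restrict_mem measurableSet_Ioi] with v hv
    have hv1 : 1 < v := hv
    have hv0 : 0 < v := by linarith
    rw [Real.norm_of_nonneg (by positivity), sub_eq_add_neg, Real.rpow_add hv0]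
    gcongr ?_ * ?_
    exact Real.rpow_le_rpow_of_nonpos hv0 (by linarith) (by linarith)

lemma tail_nonneg {s a v : ℝ} (hv : 0 ≤ v) : 0 ≤ v ^ (-s) * (1 + v) ^ (-a) := by positivity

lemma tailIntegral_le_zero {s a m : ℝ} (hs1 : s < 1) (ha : 1 - s < a) (hm : 0 ≤ m) :
    tailIntegral s a m ≤ tailIntegral s a 0 := by
  refine setIntegral_mono_set (integrableOn_tail hs1 ha) ?_
    (Set.Ioi_subset_Ioi hm).eventuallyLE
  filter_upwards [ae_restrict_mem measurableSet_Ioi] with v hv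
  exact tail_nonneg (le_of_lt hv)

lemma tailIntegral_le_of_pos {s a m : ℝ} (hs1 : s < 1) (ha : 1 - s < a)
    (hm : 0 < m) : tailIntegral s a m ≤ m ^ (-(a + s - 1)) / (a + s - 1) := by
  have h1 : ∫ v in Set.Ioi m, v ^ (-s - a) = m ^ (-(a + s - 1)) / (a + s - 1) := by
    rw [integral_Ioi_rpow_of_lt (by linarith) hm, neg_div, ← div_neg]
    congr 2 <;> ring
  rw [← h1]
  refine setIntegral_mono_on ((integrableOn_tail hs1 ha).mono_set (Set.Ioi_subset_Ioi hm.le))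
    (integrableOn_Ioi_rpow_of_lt (by linarith) hm) measurableSet_Ioi fun v hv => ?_
  have hv0 : 0 < v := hm.trans hv
  rw [sub_eq_add_neg, Real.rpow_add hv0]
  gcongr ?_ * ?_
  exact Real.rpow_le_rpow_of_nonpos hv0 (by linarith) (by linarith)

lemma integral_rpow_one_add_Ioi {m e : ℝ} (hm : -1 < m) (he : 0 < e) :
    IntegrableOn (fun v : ℝ => (1 + v) ^ (-e - 1)) (Set.Ioi m) ∧
    ∫ v in Set.Ioi m, (1 + v) ^ (-e - 1) = (1 + m) ^ (-e) / e := by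
  have hi := integrableOn_Ioi_rpow_of_lt (a := -e - 1) (by linarith) (c := 1 + m) (by linarith)
  have hv := integral_Ioi_rpow_of_lt (a := -e - 1) (by linarith) (c := 1 + m) (by linarith)
  have hd : ∀ x ∈ Set.Ioi m, HasDerivWithinAt (fun v : ℝ => 1 + v) 1 (Set.Ioi m) x :=
    fun x _ => ((hasDerivAt_id x).const_add 1).hasDerivWithinAt
  have hinj : Set.InjOn (fun v : ℝ => 1 + v) (Set.Ioi m) := fun x _ y _ h => by simpa using h
  have him : (fun v : ℝ => 1 + v) '' Set.Ioi m = Set.Ioi (1 + m) := by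
    rw [Set.image_const_add_Ioi]
  constructor
  · have := (integrableOn_image_iff_integrableOn_abs_deriv_smul measurableSet_Ioi hd hinj
      (fun v => v ^ (-e - 1))).1 (by rwa [him])
    simpa using this
  · have := integral_image_eq_integral_abs_deriv_smul measurableSet_Ioi hd hinj
      (fun v => v ^ (-e - 1))
    rw [him, hv] at this
    simp only [abs_one, one_smul] at this
    rw [← this, neg_div, ← div_neg]
    congr 2 <;> ring

lemma le_tailIntegral {s a m : ℝ} (hs0 : 0 ≤ s) (hs1 : s < 1) (ha : 1 - s < a) (hm : 0 ≤ m) :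
    (1 + m) ^ (-(a + s - 1)) / (a + s - 1) ≤ tailIntegral s a m := by
  obtain ⟨h1, h2⟩ := integral_rpow_one_add_Ioi (m := m) (e := a + s - 1) (by linarith)
    (by linarith)
  rw [← h2]
  refine setIntegral_mono_on h1
    ((integrableOn_tail hs1 ha).mono_set (Set.Ioi_subset_Ioi hm)) measurableSet_Ioi
    fun v hv => ?_
  have hv0 : 0 < v := lt_of_le_of_lt hm hv
  have : -(a + s - 1) - 1 = -s + -a := by ring
  rw [this, Real.rpow_add (by linarith)]
  gcongr ?_ * ?_
  exact Real.rpow_le_rpow_of_nonpos hv0 (by linarith) (by linarith)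

/-- The decay of the tail integral at infinity is `m^{-(a+s-1)}`; with `m = |y|² - 1` this is the
upper bound for `ψ_s` when `a = n/2 + 2`, and for `H` when `a = n/2 + 1`. -/
lemma tailIntegral_upper_bound {n : ℕ} {s a : ℝ} (hs1 : s < 1) (ha : 1 - s < a) :
    ∃ K : ℝ, 0 < K ∧ ∀ y : Rn n,
      tailIntegral s a (max (‖y‖ ^ 2 - 1) 0) ≤ K / (1 + ‖y‖ ^ (2 * (a + s - 1))) := by
  set e := a + s - 1 with he
  have he0 : 0 < e := by linarith
  have hI : 0 ≤ tailIntegral s a 0 := setIntegral_nonneg measurableSet_Ioi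
    fun v hv => tail_nonneg (le_of_lt hv)
  refine ⟨tailIntegral s a 0 * (1 + 2 ^ e) + 2 ^ (e + 1) / e, by positivity, fun y => ?_⟩
  have hq : ‖y‖ ^ (2 * e) = (‖y‖ ^ 2) ^ e := by
    rw [Real.rpow_mul (norm_nonneg y)]; norm_num
  have hden : 0 < 1 + ‖y‖ ^ (2 * e) := by positivity
  rw [hq] at *
  set q := ‖y‖ ^ 2
  have hq0 : 0 ≤ q := by positivity
  rw [le_div_iff₀ hden]
  rcases le_or_gt q 2 with h2 | h2
  · have h3 := tailIntegral_le_zero hs1 ha (le_max_right (q - 1) 0)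
    calc tailIntegral s a (max (q - 1) 0) * (1 + q ^ e) ≤ tailIntegral s a 0 * (1 + 2 ^ e) := by
          gcongr
      _ ≤ _ := by have : 0 < 2 ^ (e + 1) / e := by positivity
                  linarith
  · rw [max_eq_left (by linarith)]
    have h3 := tailIntegral_le_of_pos hs1 ha (m := q - 1) (by linarith)
    rw [← he] at h3
    have h4 : (q - 1) ^ (-e) ≤ (q / 2) ^ (-e) :=
      Real.rpow_le_rpow_of_nonpos (by linarith) (by linarith) (by linarith)
    have h5 : (q / 2) ^ (-e) = 2 ^ e * q ^ (-e) := by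
      rw [Real.div_rpow hq0 (by norm_num), Real.rpow_neg (by norm_num : (0:ℝ) ≤ 2), div_inv_eq_mul,
        mul_comm]
    have h6 : 1 + q ^ e ≤ 2 * q ^ e := by
      have : 1 ≤ q ^ e := Real.one_le_rpow (by linarith) he0.le
      linarith
    have h7 : q ^ (-e) * q ^ e = 1 := by
      rw [← Real.rpow_add (by linarith)]; simp
    have h8 : (2:ℝ) ^ (e + 1) = 2 ^ e * 2 := by rw [Real.rpow_add (by norm_num), Real.rpow_one]
    calc tailIntegral s a (q - 1) * (1 + q ^ e) ≤ (2 ^ e * q ^ (-e) / e) * (2 * q ^ e) := by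
          gcongr
          exact h3.trans (by rw [← h5]; gcongr)
      _ = 2 ^ (e + 1) / e := by
          rw [h8]; field_simp; linear_combination h7
      _ ≤ _ := by have : 0 ≤ tailIntegral s a 0 * (1 + 2 ^ e) := by positivity
                  linarith

lemma continuousOn_tailIntegral {s a : ℝ} (hs1 : s < 1) (ha : 1 - s < a) :
    ContinuousOn (tailIntegral s a) (Set.Ici 0) := by
  have hint := integrableOn_tail hs1 ha
  set g := (Set.Ioi (0:ℝ)).indicator (fun v : ℝ => v ^ (-s) * (1 + v) ^ (-a)) with hg
  have hgi : Integrable g := (integrable_indicator_iff measurableSet_Ioi).2 hint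
  have h1 : Continuous fun m => ∫ v in (0:ℝ)..m, g v :=
    intervalIntegral.continuous_primitive (fun a b => hgi.intervalIntegrable) 0
  have h2 : ∀ m ∈ Set.Ici (0:ℝ), tailIntegral s a m =
      (∫ v in Set.Ioi 0, g v) - ∫ v in (0:ℝ)..m, g v := by
    intro m hm
    have hm' : (0:ℝ) ≤ m := Set.mem_Ici.1 hm
    have h3 : tailIntegral s a m = ∫ v in Set.Ioi m, g v := by
      refine setIntegral_congr_fun measurableSet_Ioi fun v hv => ?_
      have hv' : v ∈ Set.Ioi (0:ℝ) := lt_of_le_of_lt hm' (Set.mem_Ioi.1 hv)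
      rw [hg, Set.indicator_of_mem hv']
    rw [h3, intervalIntegral.integral_of_le hm', ← Set.Ioc_union_Ioi_eq_Ioi hm',
      setIntegral_union (Set.Ioc_disjoint_Ioi le_rfl) measurableSet_Ioi hgi.integrableOn
        hgi.integrableOn]
    ring
  exact (continuous_const.sub h1).continuousOn.congr h2

/-- The substitution `r = (1 + v)^{-1/2}` in the integral that defines `ψ_s`. -/
lemma integral_rpow_div_eq_tailIntegral (s e : ℝ) {m : ℝ} (hm : 0 ≤ m) :
    ∫ r in (0 : ℝ)..((1 + m) ^ (-(1 / 2) : ℝ)), r ^ (2 * s + e + 1) / (1 - r ^ 2) ^ s =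
      1 / 2 * tailIntegral s (e / 2 + 2) m := by
  have him : (fun v : ℝ => (1 + v) ^ (-(1 / 2) : ℝ)) '' Set.Ioi m =
      Set.Ioo 0 ((1 + m) ^ (-(1 / 2) : ℝ)) := by
    ext r
    constructor
    · rintro ⟨v, hv, rfl⟩
      have hv' : m < v := hv
      exact ⟨by have : 0 < 1 + v := by linarith
                positivity,
        Real.rpow_lt_rpow_of_neg (by linarith) (by linarith) (by norm_num)⟩
    · rintro ⟨h0, h1⟩
      refine ⟨r ^ (-2 : ℝ) - 1, ?_, ?_⟩
      · have := Real.rpow_lt_rpow_of_neg h0 h1 (z := -2) (by norm_num)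
        rw [← Real.rpow_mul (by linarith)] at this
        have h2 : 1 + m < r ^ (-2 : ℝ) := by simpa using this
        exact lt_sub_iff_add_lt'.2 h2
      · simp only [add_sub_cancel]
        rw [← Real.rpow_mul h0.le]; norm_num
  have hd : ∀ v ∈ Set.Ioi m, HasDerivWithinAt (fun v : ℝ => (1 + v) ^ (-(1 / 2) : ℝ))
      (-(1 / 2) * (1 + v) ^ (-(3 / 2) : ℝ)) (Set.Ioi m) v := by
    intro v hv
    have hv' : m < v := hv
    have := ((hasDerivAt_id v).const_add 1).rpow_const (p := (-(1 / 2) : ℝ))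
      (Or.inl (by simp only [id]; linarith))
    refine this.hasDerivWithinAt.congr_deriv ?_
    norm_num
  have hinj : Set.InjOn (fun v : ℝ => (1 + v) ^ (-(1 / 2) : ℝ)) (Set.Ioi m) := by
    intro v hv w hw h
    have hv' : m < v := hv
    have hw' : m < w := hw
    have := (Real.rpow_left_inj (by linarith) (by linarith) (by norm_num)).1 h
    linarith
  have h0 : (0:ℝ) ≤ (1 + m) ^ (-(1 / 2) : ℝ) := by positivity
  rw [intervalIntegral.integral_of_le h0, integral_Ioc_eq_integral_Ioo, ← him,
    integral_image_eq_integral_abs_deriv_smul measurableSet_Ioi hd hinj, tailIntegral,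
    ← integral_const_mul]
  refine setIntegral_congr_fun measurableSet_Ioi fun v hv => ?_
  have hv0 : 0 < v := lt_of_le_of_lt hm hv
  have h1v : 0 < 1 + v := by linarith
  simp only [smul_eq_mul]
  have e1 : ((1 + v) ^ (-(1 / 2) : ℝ)) ^ 2 = (1 + v)⁻¹ := by
    rw [← Real.rpow_natCast, ← Real.rpow_mul h1v.le]
    norm_num
    rw [Real.rpow_neg_one]
  have e2 : 1 - (1 + v)⁻¹ = v * (1 + v)⁻¹ := by field_simp; ring
  have e3 : (1 + v)⁻¹ ^ s = (1 + v) ^ (-s) := by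
    rw [Real.inv_rpow h1v.le, Real.rpow_neg h1v.le]
  rw [e1, e2, Real.mul_rpow hv0.le (by positivity), e3, ← Real.rpow_mul h1v.le,
    abs_of_neg (by have : 0 < (1 + v) ^ (-(3 / 2) : ℝ) := by positivity
                   linarith), div_eq_mul_inv _ (v ^ s * _), mul_inv (v ^ s),
    ← Real.rpow_neg hv0.le, ← Real.rpow_neg h1v.le, neg_neg]
  have e4 : (1 + v) ^ (-(e / 2 + 2)) = (1 + v) ^ (-(3 / 2) : ℝ) *
      ((1 + v) ^ (-(1 / 2) * (2 * s + e + 1)) * (1 + v) ^ s) := by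
    rw [← Real.rpow_add h1v, ← Real.rpow_add h1v]
    congr 1; ring
  rw [e4]; ring

/-- The constant `n (n + 2) γ_{n,s}` in front of the integral defining `ψ_s`. -/
noncomputable def psiConst (n : ℕ) (s : ℝ) : ℝ := (n : ℝ) * ((n : ℝ) + 2) * gammaConst n s

lemma psiConst_pos (n : ℕ) [NeZero n] {s : ℝ} (hs0 : 0 < s) (hs1 : s < 1) :
    0 < psiConst n s := by
  have hn : (0:ℝ) < n := by exact_mod_cast NeZero.pos n
  have : 0 < Real.sin (Real.pi * s) :=
    Real.sin_pos_of_pos_of_lt_pi (by positivity) (by nlinarith [Real.pi_pos])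
  have h2 : 0 < Real.Gamma ((n : ℝ) / 2) := Real.Gamma_pos_of_pos (by positivity)
  unfold psiConst gammaConst
  positivity

lemma psi_eq_tailIntegral {n : ℕ} (s : ℝ) (y : Rn n) :
    psi s y = psiConst n s / 2 * tailIntegral s ((n : ℝ) / 2 + 2) (max (‖y‖ ^ 2 - 1) 0) := by
  have h : (1 + max (‖y‖ ^ 2 - 1) 0) ^ (-(1 / 2) : ℝ) = 1 / max ‖y‖ 1 := by
    have h1 : 1 + max (‖y‖ ^ 2 - 1) 0 = (max ‖y‖ 1) ^ 2 := by
      rcases le_total 1 ‖y‖ with h | h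
      · rw [max_eq_left h, max_eq_left (by nlinarith)]; ring
      · rw [max_eq_right h, max_eq_right (by nlinarith [norm_nonneg y])]; ring
    rw [h1, ← Real.rpow_natCast, ← Real.rpow_mul (by positivity)]
    norm_num
    rw [Real.rpow_neg_one]
  unfold psi
  rw [← h, integral_rpow_div_eq_tailIntegral s n (le_max_right _ _), psiConst]
  ring

lemma psi_eq_of_norm_eq {n : ℕ} (s : ℝ) {y z : Rn n} (h : ‖y‖ = ‖z‖) : psi s y = psi s z := by
  unfold psi; rw [h]

lemma exponent_gt (n : ℕ) {s : ℝ} (hs0 : 0 < s) : 1 - s < (n : ℝ) / 2 + 2 := by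
  have : (0:ℝ) ≤ n := Nat.cast_nonneg n
  linarith

lemma continuous_psi {n : ℕ} {s : ℝ} (hs0 : 0 < s) (hs1 : s < 1) :
    Continuous (psi s : Rn n → ℝ) := by
  have h : (psi s : Rn n → ℝ) = fun y => psiConst n s / 2 *
      tailIntegral s ((n : ℝ) / 2 + 2) (max (‖y‖ ^ 2 - 1) 0) :=
    funext (psi_eq_tailIntegral s)
  rw [h]
  refine continuous_const.mul ?_
  exact (continuousOn_tailIntegral hs1 (exponent_gt n hs0)).comp_continuous
    (by fun_prop) fun y => Set.mem_Ici.2 (le_max_right _ _)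

lemma psi_nonneg {n : ℕ} [NeZero n] {s : ℝ} (hs0 : 0 < s) (hs1 : s < 1) (y : Rn n) :
    0 ≤ psi s y := by
  rw [psi_eq_tailIntegral]
  have h1 := psiConst_pos n hs0 hs1
  have : 0 ≤ tailIntegral s ((n : ℝ) / 2 + 2) (max (‖y‖ ^ 2 - 1) 0) :=
    setIntegral_nonneg measurableSet_Ioi fun v hv =>
      tail_nonneg ((le_max_right _ _).trans (le_of_lt hv))
  positivity

lemma psi_upper_bound {n : ℕ} [NeZero n] {s : ℝ} (hs0 : 0 < s) (hs1 : s < 1) :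
    ∃ K : ℝ, 0 < K ∧ ∀ y : Rn n, psi s y ≤ K / (1 + ‖y‖ ^ ((n : ℝ) + 2 * s + 2)) := by
  obtain ⟨K, hK, h⟩ := tailIntegral_upper_bound (n := n) hs1 (exponent_gt n hs0)
  have hc := psiConst_pos n hs0 hs1
  refine ⟨psiConst n s / 2 * K, by positivity, fun y => ?_⟩
  have h1 := h y
  have e : 2 * ((n : ℝ) / 2 + 2 + s - 1) = (n : ℝ) + 2 * s + 2 := by ring
  rw [e] at h1
  rw [psi_eq_tailIntegral, mul_div_assoc]
  gcongr

lemma psi_lower_bound {n : ℕ} [NeZero n] {s : ℝ} (hs0 : 0 < s) (hs1 : s < 1) :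
    ∃ c : ℝ, 0 < c ∧ ∀ y : Rn n, c / (1 + ‖y‖ ^ ((n : ℝ) + 2 * s + 2)) ≤ psi s y := by
  have hc := psiConst_pos n hs0 hs1
  set e := (n : ℝ) / 2 + 2 + s - 1 with he
  have hn : (0:ℝ) ≤ n := Nat.cast_nonneg n
  have he0 : 0 < e := by rw [he]; linarith
  refine ⟨psiConst n s / 2 * (1 / e), by positivity, fun y => ?_⟩
  have h1 := le_tailIntegral hs0.le hs1 (exponent_gt n hs0) (le_max_right (‖y‖ ^ 2 - 1) 0)
  rw [← he] at h1
  have e2 : (n : ℝ) + 2 * s + 2 = 2 * e := by rw [he]; ring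
  have hq : ‖y‖ ^ (2 * e) = (‖y‖ ^ 2) ^ e := by
    rw [Real.rpow_mul (norm_nonneg y)]; norm_num
  rw [psi_eq_tailIntegral, mul_div_assoc, e2, hq]
  gcongr
  refine le_trans ?_ h1
  rw [div_div, mul_comm, ← div_div]
  gcongr
  set q := ‖y‖ ^ 2
  have hq0 : 0 ≤ q := by positivity
  rw [Real.rpow_neg (by positivity), one_div]
  gcongr
  rcases le_total q 1 with h | h
  · rw [max_eq_right (by linarith), add_zero, Real.one_rpow]
    have : 0 ≤ q ^ e := by positivity
    linarith
  · rw [max_eq_left (by linarith), add_sub_cancel]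
    linarith

/-! ### The mean value kernel -/

lemma integrable_uncurry_of_nonneg {α β : Type*} [MeasurableSpace α] [MeasurableSpace β]
    {μ : Measure α} {ν : Measure β} [SFinite ν] {f : α → β → ℝ}
    (hm : AEStronglyMeasurable (Function.uncurry f) (μ.prod ν))
    (h0 : ∀ᵐ x ∂μ, ∀ᵐ y ∂ν, 0 ≤ f x y) (h1 : ∀ᵐ x ∂μ, Integrable (f x) ν)
    (h2 : Integrable (fun x => ∫ y, f x y ∂ν) μ) :
    Integrable (Function.uncurry f) (μ.prod ν) := by
  rw [integrable_prod_iff hm]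
  refine ⟨h1, h2.congr ?_⟩
  filter_upwards [h0] with x hx
  refine integral_congr_ae ?_
  filter_upwards [hx] with y hy
  exact (Real.norm_of_nonneg hy).symm

lemma integrableOn_rpow_mul_exp {a r : ℝ} (ha : 0 < a) (hr : 0 < r) :
    IntegrableOn (fun v : ℝ => v ^ (a - 1) * Real.exp (-(r * v))) (Set.Ioi 0) := by
  by_contra h
  have h1 := Real.integral_rpow_mul_exp_neg_mul_Ioi ha hr
  rw [integral_undef h] at h1
  have : 0 < (1 / r) ^ a * Real.Gamma a := by
    have := Real.Gamma_pos_of_pos ha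
    positivity
  linarith

/-- The integral `∫_0^∞ v^{-s} / (1 + v) dv`, computed by writing `1 / (1 + v)` as a Laplace
transform and using Euler's reflection formula. -/
lemma tailIntegral_one_zero {s : ℝ} (hs0 : 0 < s) (hs1 : s < 1) :
    tailIntegral s 1 0 = Real.pi / Real.sin (Real.pi * s) := by
  have hinner : ∀ v : ℝ, 0 < v → IntegrableOn (fun w : ℝ => v ^ (-s) * Real.exp (-((1 + v) * w)))
      (Set.Ioi 0) ∧ ∫ w in Set.Ioi (0:ℝ), v ^ (-s) * Real.exp (-((1 + v) * w)) =
        v ^ (-s) * (1 + v) ^ (-1 : ℝ) := by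
    intro v hv
    have h1 := integrableOn_rpow_mul_exp (a := 1) (r := 1 + v) one_pos (by linarith)
    have h2 := Real.integral_rpow_mul_exp_neg_mul_Ioi (a := 1) (r := 1 + v) one_pos (by linarith)
    simp only [sub_self, Real.rpow_zero, one_mul, Real.rpow_one, Real.Gamma_one, mul_one] at h1 h2
    refine ⟨h1.const_mul _, ?_⟩
    rw [integral_const_mul, h2, Real.rpow_neg_one, one_div]
  have hprod : Integrable (Function.uncurry fun v w : ℝ => v ^ (-s) * Real.exp (-((1 + v) * w)))
      ((volume.restrict (Set.Ioi 0)).prod (volume.restrict (Set.Ioi 0))) := by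
    refine integrable_uncurry_of_nonneg ?_ ?_ ?_ ?_
    · refine Measurable.aestronglyMeasurable ?_
      unfold Function.uncurry
      fun_prop
    · filter_upwards [ae_restrict_mem measurableSet_Ioi] with v hv
      have hv0 : 0 < v := hv
      exact Eventually.of_forall fun w => by positivity
    · filter_upwards [ae_restrict_mem measurableSet_Ioi] with v hv using (hinner v hv).1
    · refine (integrableOn_tail (s := s) (a := 1) hs1 (by linarith)).congr ?_
      filter_upwards [ae_restrict_mem measurableSet_Ioi] with v hv using (hinner v hv).2.symm
  have hswap := integral_integral_swap hprod
  have hl : tailIntegral s 1 0 =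
      ∫ v in Set.Ioi (0:ℝ), ∫ w in Set.Ioi (0:ℝ), v ^ (-s) * Real.exp (-((1 + v) * w)) :=
    setIntegral_congr_fun measurableSet_Ioi fun v hv => (hinner v hv).2.symm
  rw [hl, hswap, ← Real.Gamma_mul_Gamma_one_sub, mul_comm]
  have hr : ∀ w ∈ Set.Ioi (0:ℝ), ∫ v in Set.Ioi (0:ℝ), v ^ (-s) * Real.exp (-((1 + v) * w)) =
      Real.Gamma (1 - s) * (w ^ (s - 1) * Real.exp (-(1 * w))) := by
    intro w hw
    have hw0 : 0 < w := hw
    have h2 := Real.integral_rpow_mul_exp_neg_mul_Ioi (a := 1 - s) (r := w) (by linarith) hw0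
    have h3 : ∀ v : ℝ, v ^ (-s) * Real.exp (-((1 + v) * w)) =
        Real.exp (-(1 * w)) * (v ^ (1 - s - 1) * Real.exp (-(w * v))) := by
      intro v
      have e1 : -((1 + v) * w) = -(1 * w) + -(w * v) := by ring
      have e2 : (1:ℝ) - s - 1 = -s := by ring
      rw [e1, e2, Real.exp_add]; ring
    simp_rw [h3]
    rw [integral_const_mul, h2, one_div, Real.inv_rpow hw0.le, ← Real.rpow_neg hw0.le, neg_sub]
    ring
  rw [setIntegral_congr_fun measurableSet_Ioi hr, integral_const_mul,
    Real.integral_rpow_mul_exp_neg_mul_Ioi hs0 one_pos]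
  simp

/-- The profile `∫_0^∞ v^{-s} (1 + v)^{-n/2-2} (1 + v - q)_+ dv` of the mean value kernel, as a
function of `q = |y|²`. -/
noncomputable def kernelProfile (n : ℕ) (s q : ℝ) : ℝ :=
  ∫ v in Set.Ioi 0, v ^ (-s) * (1 + v) ^ (-((n : ℝ) / 2 + 2)) * max 0 (1 + v - q)

/-- The mean value kernel `H`: the radial function, decaying at infinity, with
`∇H(y) = -ψ_s(y) y`. -/
noncomputable def meanKernel {n : ℕ} (s : ℝ) (y : Rn n) : ℝ :=
  psiConst n s / 4 * kernelProfile n s (‖y‖ ^ 2)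

/-- The function `T = n H - |y|² ψ_s`, which is `-d/dR` of `R^{-n} H(y / R)` at `R = 1`. -/
noncomputable def dilationKernel {n : ℕ} (s : ℝ) (y : Rn n) : ℝ :=
  n * meanKernel s y - ‖y‖ ^ 2 * psi s y

lemma one_sub_lt (n : ℕ) [NeZero n] {s : ℝ} (hs0 : 0 < s) : 1 - s < (n : ℝ) / 2 + 1 := by
  have : (0:ℝ) ≤ n := Nat.cast_nonneg n
  linarith

lemma tail_mul_one_add {s a v : ℝ} (hv : 0 < v) :
    v ^ (-s) * (1 + v) ^ (-(a + 1)) * (1 + v) = v ^ (-s) * (1 + v) ^ (-a) := by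
  have : (1 + v) ^ (-a) = (1 + v) ^ (-(a + 1)) * (1 + v) ^ (1:ℝ) := by
    rw [← Real.rpow_add (by linarith)]; congr 1; ring
  rw [this, Real.rpow_one]; ring

lemma kernelProfile_integrand_le {n : ℕ} {s q v : ℝ} (hv : 0 < v) (hq : 0 ≤ q) :
    v ^ (-s) * (1 + v) ^ (-((n : ℝ) / 2 + 2)) * max 0 (1 + v - q) ≤
      v ^ (-s) * (1 + v) ^ (-((n : ℝ) / 2 + 1)) := by
  rw [← tail_mul_one_add (a := (n : ℝ) / 2 + 1) hv]
  have e : (n : ℝ) / 2 + 1 + 1 = (n : ℝ) / 2 + 2 := by ring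
  rw [e]
  gcongr
  exact max_le (by linarith) (by linarith)

lemma integrableOn_kernelProfile {n : ℕ} [NeZero n] {s : ℝ} (hs0 : 0 < s) (hs1 : s < 1) (q : ℝ) :
    IntegrableOn (fun v : ℝ => v ^ (-s) * (1 + v) ^ (-((n : ℝ) / 2 + 2)) * max 0 (1 + v - q))
      (Set.Ioi 0) := by
  have h1 := integrableOn_tail (s := s) hs1 (one_sub_lt n hs0)
  have h2 := (integrableOn_tail (s := s) hs1 (exponent_gt n hs0)).const_mul |q|
  refine Integrable.mono' (h1.add h2) (Measurable.aestronglyMeasurable (by fun_prop)) ?_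
  filter_upwards [ae_restrict_mem measurableSet_Ioi] with v hv
  have hv0 : 0 < v := hv
  rw [Real.norm_of_nonneg (by positivity), Pi.add_apply,
    ← tail_mul_one_add (a := (n : ℝ) / 2 + 1) hv0]
  have e : (n : ℝ) / 2 + 1 + 1 = (n : ℝ) / 2 + 2 := by ring
  rw [e]
  have : 0 ≤ v ^ (-s) * (1 + v) ^ (-((n : ℝ) / 2 + 2)) := by positivity
  have h3 : max 0 (1 + v - q) ≤ (1 + v) + |q| := by
    refine max_le (by positivity) ?_
    linarith [neg_abs_le q]
  nlinarith

lemma tailIntegral_eq_indicator (s a q : ℝ) :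
    tailIntegral s a (max (q - 1) 0) =
      ∫ v in Set.Ioi 0, (Set.Ioi (q - 1)).indicator (fun v => v ^ (-s) * (1 + v) ^ (-a)) v := by
  rw [setIntegral_indicator measurableSet_Ioi, Set.inter_comm, Set.Ioi_inter_Ioi]
  rfl

/-- The derivative falls on `(1 + v - q)_+` and restricts the integral to `v > q - 1`. In terms of
`H` it says `∇H(y) = -ψ_s(y) y`. -/
lemma hasDerivAt_kernelProfile {n : ℕ} [NeZero n] {s : ℝ} (hs0 : 0 < s) (hs1 : s < 1) (q : ℝ) :
    HasDerivAt (kernelProfile n s) (-tailIntegral s ((n : ℝ) / 2 + 2) (max (q - 1) 0)) q := by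
  set ω : ℝ → ℝ := fun v => v ^ (-s) * (1 + v) ^ (-((n : ℝ) / 2 + 2)) with hω
  have hω0 : ∀ v, 0 < v → 0 ≤ ω v := fun v hv => tail_nonneg hv.le
  have hωi := integrableOn_tail (s := s) hs1 (exponent_gt n hs0)
  have key := hasDerivAt_integral_of_dominated_loc_of_lip (μ := volume.restrict (Set.Ioi 0))
    (F := fun (q v : ℝ) => ω v * max 0 (1 + v - q)) (x₀ := q) (s := Set.univ) (bound := ω)
    (F' := fun v => -(Set.Ioi (q - 1)).indicator ω v) univ_mem
    (Eventually.of_forall fun q => Measurable.aestronglyMeasurable (by fun_prop))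
    (integrableOn_kernelProfile hs0 hs1 q)
    (Measurable.aestronglyMeasurable
      ((Measurable.indicator (by fun_prop) measurableSet_Ioi).neg)) ?_ hωi ?_
  · rw [tailIntegral_eq_indicator, ← integral_neg]
    exact key.2
  · filter_upwards [ae_restrict_mem measurableSet_Ioi] with v hv
    refine LipschitzOnWith.of_dist_le_mul fun x _ y _ => ?_
    rw [Real.coe_nnabs, Real.dist_eq, Real.dist_eq, ← mul_sub, abs_mul]
    refine mul_le_mul_of_nonneg_left ?_ (abs_nonneg _)
    have := abs_max_sub_max_le_abs (1 + v - x) (1 + v - y) 0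
    rw [max_comm _ (0:ℝ), max_comm _ (0:ℝ)] at this
    refine this.trans_eq ?_
    rw [← abs_neg]; congr 1; ring
  · have hne : ∀ᵐ v ∂(volume.restrict (Set.Ioi (0:ℝ))), v ≠ q - 1 :=
      ae_restrict_of_ae (by simp [ae_iff, measure_singleton])
    filter_upwards [hne] with v hv
    rcases lt_or_gt_of_ne hv with h | h
    · have h1 : (Set.Ioi (q - 1)).indicator ω v = 0 :=
        Set.indicator_of_notMem (by simpa using h.le) _
      rw [h1, neg_zero]
      have : (fun x => ω v * max 0 (1 + v - x)) =ᶠ[𝓝 q] fun _ => 0 := by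
        filter_upwards [lt_mem_nhds (show 1 + v < q by linarith)] with x hx
        rw [max_eq_left (by linarith), mul_zero]
      exact (hasDerivAt_const q (0:ℝ)).congr_of_eventuallyEq this
    · have h1 : (Set.Ioi (q - 1)).indicator ω v = ω v :=
        Set.indicator_of_mem (by simpa using h) _
      rw [h1]
      have : (fun x => ω v * max 0 (1 + v - x)) =ᶠ[𝓝 q] fun x => ω v * (1 + v - x) := by
        filter_upwards [gt_mem_nhds (show q < 1 + v by linarith)] with x hx
        rw [max_eq_right (by linarith)]
      have h2 := ((hasDerivAt_id q).const_sub (1 + v)).const_mul (ω v)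
      rw [mul_neg_one] at h2
      exact h2.congr_of_eventuallyEq this

lemma hasDerivAt_meanProfile {n : ℕ} [NeZero n] {s : ℝ} (hs0 : 0 < s) (hs1 : s < 1) (y : Rn n) :
    HasDerivAt (fun q => psiConst n s / 4 * kernelProfile n s q) (-(psi s y / 2)) (‖y‖ ^ 2) := by
  refine ((hasDerivAt_kernelProfile hs0 hs1 (‖y‖ ^ 2)).const_mul _).congr_deriv ?_
  rw [psi_eq_tailIntegral]; ring

lemma continuous_kernelProfile {n : ℕ} [NeZero n] {s : ℝ} (hs0 : 0 < s) (hs1 : s < 1) :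
    Continuous (kernelProfile n s) :=
  continuous_iff_continuousAt.2 fun q => (hasDerivAt_kernelProfile hs0 hs1 q).continuousAt

lemma continuous_meanKernel {n : ℕ} [NeZero n] {s : ℝ} (hs0 : 0 < s) (hs1 : s < 1) :
    Continuous (meanKernel s : Rn n → ℝ) :=
  continuous_const.mul ((continuous_kernelProfile hs0 hs1).comp (by fun_prop))

lemma continuous_dilationKernel {n : ℕ} [NeZero n] {s : ℝ} (hs0 : 0 < s) (hs1 : s < 1) :
    Continuous (dilationKernel s : Rn n → ℝ) :=
  (continuous_const.mul (continuous_meanKernel hs0 hs1)).sub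
    ((continuous_norm.pow 2).mul (continuous_psi hs0 hs1))

lemma meanKernel_nonneg {n : ℕ} [NeZero n] {s : ℝ} (hs0 : 0 < s) (hs1 : s < 1) (y : Rn n) :
    0 ≤ meanKernel s y := by
  have := psiConst_pos n hs0 hs1
  refine mul_nonneg (by positivity) (setIntegral_nonneg measurableSet_Ioi fun v hv => ?_)
  have hv0 : 0 < v := hv
  positivity

lemma meanKernel_le {n : ℕ} [NeZero n] {s : ℝ} (hs0 : 0 < s) (hs1 : s < 1) :
    ∃ K : ℝ, 0 < K ∧ ∀ y : Rn n, meanKernel s y ≤ K / weight s y := by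
  obtain ⟨K, hK, h⟩ := tailIntegral_upper_bound (n := n) hs1 (one_sub_lt n hs0)
  have hc := psiConst_pos n hs0 hs1
  refine ⟨psiConst n s / 4 * K, by positivity, fun y => ?_⟩
  have h1 := h y
  have e : 2 * ((n : ℝ) / 2 + 1 + s - 1) = (n : ℝ) + 2 * s := by ring
  rw [e] at h1
  unfold meanKernel
  rw [mul_div_assoc]
  gcongr
  refine le_trans ?_ h1
  rw [tailIntegral_eq_indicator]
  refine setIntegral_mono_on (integrableOn_kernelProfile hs0 hs1 _) ?_ measurableSet_Ioi ?_
  · exact (integrableOn_tail (s := s) hs1 (one_sub_lt n hs0)).indicator measurableSet_Ioi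
  · intro v hv
    have hv0 : 0 < v := hv
    by_cases hq : ‖y‖ ^ 2 - 1 < v
    · rw [Set.indicator_of_mem (Set.mem_Ioi.2 hq)]
      exact kernelProfile_integrand_le hv0 (by positivity)
    · rw [Set.indicator_of_notMem (by simpa using hq), max_eq_left (by linarith), mul_zero]

lemma one_add_sq_mul_psi_le {n : ℕ} [NeZero n] {s : ℝ} (hs0 : 0 < s) (hs1 : s < 1) :
    ∃ K : ℝ, 0 < K ∧ ∀ y : Rn n, (1 + ‖y‖ ^ 2) * psi s y ≤ K / weight s y := by
  obtain ⟨K, hK, h⟩ := psi_upper_bound (n := n) hs0 hs1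
  have hp := exponent_pos n hs0
  refine ⟨4 * K, by positivity, fun y => ?_⟩
  have h1 := h y
  set p := (n : ℝ) + 2 * s with hpdef
  have hden : 0 < 1 + ‖y‖ ^ (p + 2) := by positivity
  have hmul : ‖y‖ ^ (p + 2) = ‖y‖ ^ p * ‖y‖ ^ 2 := by
    rw [Real.rpow_add' (norm_nonneg y) (by positivity)]; norm_num
  have h2 : (1 + ‖y‖ ^ 2) * weight s y ≤ 4 * (1 + ‖y‖ ^ (p + 2)) := by
    unfold weight
    rw [← hpdef, hmul]
    rcases le_total ‖y‖ 1 with hy | hy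
    · have a1 : ‖y‖ ^ p ≤ 1 := Real.rpow_le_one (norm_nonneg y) hy hp.le
      have a2 : ‖y‖ ^ 2 ≤ 1 := pow_le_one₀ (norm_nonneg y) hy
      have a3 : 0 ≤ ‖y‖ ^ p := by positivity
      have a4 : 0 ≤ ‖y‖ ^ 2 := by positivity
      nlinarith
    · have a1 : 1 ≤ ‖y‖ ^ p := Real.one_le_rpow hy hp.le
      have a2 : 1 ≤ ‖y‖ ^ 2 := one_le_pow₀ hy
      nlinarith
  rw [le_div_iff₀ (weight_pos s y)]
  rw [le_div_iff₀ hden] at h1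
  have h3 := psi_nonneg hs0 hs1 y
  calc (1 + ‖y‖ ^ 2) * psi s y * weight s y = psi s y * ((1 + ‖y‖ ^ 2) * weight s y) := by ring
    _ ≤ psi s y * (4 * (1 + ‖y‖ ^ (p + 2))) := by gcongr
    _ = 4 * (psi s y * (1 + ‖y‖ ^ (p + 2))) := by ring
    _ ≤ 4 * K := by gcongr

lemma abs_dilationKernel_le {n : ℕ} [NeZero n] {s : ℝ} (hs0 : 0 < s) (hs1 : s < 1) :
    ∃ K : ℝ, 0 < K ∧ ∀ y : Rn n, |dilationKernel s y| ≤ K / weight s y := by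
  obtain ⟨K₁, hK₁, h₁⟩ := meanKernel_le (n := n) hs0 hs1
  obtain ⟨K₂, hK₂, h₂⟩ := one_add_sq_mul_psi_le (n := n) hs0 hs1
  refine ⟨n * K₁ + K₂, by positivity, fun y => ?_⟩
  have a1 := h₁ y
  have a2 := h₂ y
  have b1 := meanKernel_nonneg hs0 hs1 y
  have b2 := psi_nonneg hs0 hs1 y
  have b3 : 0 ≤ ‖y‖ ^ 2 * psi s y := by positivity
  have b4 : ‖y‖ ^ 2 * psi s y ≤ K₂ / weight s y := by linarith
  have b5 : (n : ℝ) * meanKernel s y ≤ n * (K₁ / weight s y) := by gcongr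
  have b6 : 0 ≤ (n : ℝ) * meanKernel s y := by positivity
  have e : (n * K₁ + K₂) / weight s y = n * (K₁ / weight s y) + K₂ / weight s y := by ring
  rw [e, dilationKernel, abs_le]
  constructor <;> linarith

lemma integrable_of_le_weight {n : ℕ} [NeZero n] {s : ℝ} (hs0 : 0 < s) {k : Rn n → ℝ}
    (hk : AEStronglyMeasurable k volume) {K : ℝ} (h : ∀ y, |k y| ≤ K / weight s y) :
    Integrable k := by
  refine ((integrable_inv_weight hs0).const_mul K).mono' hk (Eventually.of_forall fun y => ?_)
  rw [mul_one_div]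
  exact h y

lemma integrable_meanKernel {n : ℕ} [NeZero n] {s : ℝ} (hs0 : 0 < s) (hs1 : s < 1) :
    Integrable (meanKernel s : Rn n → ℝ) := by
  obtain ⟨K, hK, h⟩ := meanKernel_le (n := n) hs0 hs1
  refine integrable_of_le_weight hs0 (continuous_meanKernel hs0 hs1).aestronglyMeasurable
    (K := K) fun y => ?_
  rw [abs_of_nonneg (meanKernel_nonneg hs0 hs1 y)]
  exact h y

lemma integrable_dilationKernel {n : ℕ} [NeZero n] {s : ℝ} (hs0 : 0 < s) (hs1 : s < 1) :
    Integrable (dilationKernel s : Rn n → ℝ) := by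
  obtain ⟨K, hK, h⟩ := abs_dilationKernel_le (n := n) hs0 hs1
  exact integrable_of_le_weight hs0 (continuous_dilationKernel hs0 hs1).aestronglyMeasurable h

lemma integral_eq_rpow_mul_integral_sqrt_smul {n : ℕ} {b : ℝ} (hb : 0 < b) (F : Rn n → ℝ) :
    ∫ y, F y = b ^ ((n : ℝ) / 2) * ∫ x, F (√b • x) := by
  have h1 : (√b) ^ n = b ^ ((n : ℝ) / 2) := by
    rw [Real.sqrt_eq_rpow, ← Real.rpow_natCast, ← Real.rpow_mul hb.le]
    congr 1; ring
  rw [Measure.integral_comp_smul, finrank_Rn, h1, smul_eq_mul, abs_of_pos (by positivity),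
    ← mul_assoc, mul_inv_cancel₀ (by positivity), one_mul]

lemma norm_sqrt_smul_sq {n : ℕ} {b : ℝ} (hb : 0 ≤ b) (x : Rn n) : ‖√b • x‖ ^ 2 = b * ‖x‖ ^ 2 := by
  rw [norm_smul, mul_pow, Real.norm_of_nonneg (Real.sqrt_nonneg b), Real.sq_sqrt hb]

lemma max_zero_mul {b c : ℝ} (hb : 0 ≤ b) : max 0 (b * c) = b * max 0 c := by
  rw [mul_max_of_nonneg _ _ hb, mul_zero]

/-- Fubini's theorem for the representation of `H` as a superposition of the functions
`(1 + v - |y|²)_+`. -/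
lemma integral_meanKernel_mul {n : ℕ} [NeZero n] {s : ℝ} (hs0 : 0 < s) (hs1 : s < 1)
    {g : Rn n → ℝ} (hg : Continuous g) (hg0 : ∀ y, 0 ≤ g y)
    (hi : Integrable fun y => meanKernel s y * g y) :
    ∫ y, meanKernel s y * g y = psiConst n s / 4 * ∫ v in Set.Ioi (0:ℝ),
      v ^ (-s) * (1 + v) ^ (-((n : ℝ) / 2 + 2)) * ∫ y, max 0 (1 + v - ‖y‖ ^ 2) * g y := by
  have hc := psiConst_pos n hs0 hs1
  have hprod : Integrable (Function.uncurry fun (y : Rn n) (v : ℝ) =>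
      v ^ (-s) * (1 + v) ^ (-((n : ℝ) / 2 + 2)) * max 0 (1 + v - ‖y‖ ^ 2) * g y)
      (volume.prod (volume.restrict (Set.Ioi 0))) := by
    refine integrable_uncurry_of_nonneg ?_ ?_ ?_ ?_
    · refine Measurable.aestronglyMeasurable ?_
      unfold Function.uncurry
      have := hg.measurable
      fun_prop
    · refine Eventually.of_forall fun y => ?_
      filter_upwards [ae_restrict_mem measurableSet_Ioi] with v hv
      have hv0 : 0 < v := hv
      have := hg0 y
      positivity
    · exact Eventually.of_forall fun y =>
        (integrableOn_kernelProfile hs0 hs1 (‖y‖ ^ 2)).mul_const (g y)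
    · refine (hi.const_mul (psiConst n s / 4)⁻¹).congr (Eventually.of_forall fun y => ?_)
      simp only [meanKernel]
      rw [integral_mul_const, kernelProfile]
      field_simp
  have hl : ∀ y : Rn n, meanKernel s y * g y = psiConst n s / 4 * ∫ v in Set.Ioi (0:ℝ),
      v ^ (-s) * (1 + v) ^ (-((n : ℝ) / 2 + 2)) * max 0 (1 + v - ‖y‖ ^ 2) * g y := by
    intro y
    rw [integral_mul_const, meanKernel, kernelProfile]; ring
  simp_rw [hl]
  rw [integral_const_mul, integral_integral_swap hprod]
  congr 1
  refine setIntegral_congr_fun measurableSet_Ioi fun v hv => ?_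
  rw [← integral_const_mul]
  congr 1; ext y; ring

/-- The mass of `(1 - |x|²)_+`, in polar coordinates. -/
lemma integral_max_one_sub_sq (n : ℕ) [NeZero n] :
    ∫ x : Rn n, max 0 (1 - ‖x‖ ^ 2) =
      2 / ((n : ℝ) + 2) * (Real.pi ^ ((n : ℝ) / 2) / Real.Gamma ((n : ℝ) / 2 + 1)) := by
  have hn : 1 ≤ n := NeZero.one_le
  rw [integral_fun_norm_addHaar volume (fun r : ℝ => max 0 (1 - r ^ 2)), finrank_Rn]
  have hball : (volume : Measure (Rn n)).real (Metric.ball 0 1) =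
      Real.pi ^ ((n : ℝ) / 2) / Real.Gamma ((n : ℝ) / 2 + 1) := by
    have : Nonempty (Fin n) := ⟨0⟩
    rw [measureReal_def, EuclideanSpace.volume_ball, Fintype.card_fin, ENNReal.ofReal_one, one_pow,
      one_mul, ENNReal.toReal_ofReal
        (by have := Real.Gamma_pos_of_pos (s := (n : ℝ) / 2 + 1) (by positivity)
            positivity), Real.sqrt_eq_rpow,
      ← Real.rpow_natCast, ← Real.rpow_mul Real.pi_pos.le]
    congr 2; ring
  have hint : ∫ r in Set.Ioi (0:ℝ), r ^ (n - 1) • max 0 (1 - r ^ 2) =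
      1 / (n : ℝ) - 1 / ((n : ℝ) + 2) := by
    have h1 : ∫ r in Set.Ioi (0:ℝ), r ^ (n - 1) • max 0 (1 - r ^ 2) =
        ∫ r in Set.Ioc (0:ℝ) 1, (r ^ (n - 1) - r ^ (n + 1)) := by
      rw [← Set.Ioc_union_Ioi_eq_Ioi (zero_le_one (α := ℝ))]
      have hz : ∀ r ∈ Set.Ioi (1:ℝ), r ^ (n - 1) • max 0 (1 - r ^ 2) = 0 := by
        intro r hr
        have hr1 : 1 < r := hr
        rw [max_eq_left (by nlinarith), smul_zero]
      have hp : ∀ r ∈ Set.Ioc (0:ℝ) 1, r ^ (n - 1) • max 0 (1 - r ^ 2) =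
          r ^ (n - 1) - r ^ (n + 1) := by
        intro r hr
        rw [max_eq_right (by nlinarith [hr.1, hr.2]), smul_eq_mul]
        have : n + 1 = n - 1 + 2 := by omega
        rw [this, pow_add]; ring
      rw [setIntegral_union (Set.Ioc_disjoint_Ioi le_rfl) measurableSet_Ioi,
        setIntegral_congr_fun measurableSet_Ioi hz, setIntegral_congr_fun measurableSet_Ioc hp]
      · simp
      · refine (Continuous.integrableOn_Icc ?_).mono_set Set.Ioc_subset_Icc_self
        fun_prop
      · exact integrableOn_zero.congr_fun (fun r hr => (hz r hr).symm) measurableSet_Ioi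
    rw [h1, ← intervalIntegral.integral_of_le zero_le_one, intervalIntegral.integral_sub
      (by simp) (by simp), integral_pow, integral_pow]
    have e : ((n - 1 : ℕ) : ℝ) + 1 = n := by
      rw [Nat.cast_sub hn]; simp
    rw [e]
    have : n - 1 + 1 ≠ 0 := by omega
    simp only [one_pow, zero_pow this, sub_zero]
    push_cast
    rw [zero_pow (by omega), sub_zero, add_assoc]; norm_num
  rw [hball, hint]
  have : (n : ℝ) ≠ 0 := by exact_mod_cast (NeZero.ne n)
  simp only [nsmul_eq_mul, smul_eq_mul]
  field_simp
  ring

/-- Rescaling `y = √(1 + v) x` separates the variables in the superposition formula for `H`, and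
the constant `γ_{n,s}` is the one that normalises the result. -/
lemma integral_meanKernel {n : ℕ} [NeZero n] {s : ℝ} (hs0 : 0 < s) (hs1 : s < 1) :
    ∫ y : Rn n, meanKernel s y = 1 := by
  have h := integral_meanKernel_mul (n := n) hs0 hs1 (g := fun _ => 1) continuous_const
    (fun _ => zero_le_one) (by simpa using integrable_meanKernel hs0 hs1)
  simp only [mul_one] at h
  have hin : ∀ v ∈ Set.Ioi (0:ℝ), v ^ (-s) * (1 + v) ^ (-((n : ℝ) / 2 + 2)) *
      (∫ y : Rn n, max 0 (1 + v - ‖y‖ ^ 2)) =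
      (∫ x : Rn n, max 0 (1 - ‖x‖ ^ 2)) * (v ^ (-s) * (1 + v) ^ (-1 : ℝ)) := by
    intro v hv
    have hv0 : 0 < v := hv
    have hb : 0 < 1 + v := by linarith
    rw [integral_eq_rpow_mul_integral_sqrt_smul hb]
    have h1 : ∀ x : Rn n, max 0 (1 + v - ‖√(1 + v) • x‖ ^ 2) =
        (1 + v) * max 0 (1 - ‖x‖ ^ 2) := fun x => by
      rw [norm_sqrt_smul_sq hb.le, ← max_zero_mul hb.le]
      congr 1; ring
    simp_rw [h1]
    rw [integral_const_mul]
    have e : (1 + v) ^ (-1 : ℝ) = (1 + v) ^ (-((n : ℝ) / 2 + 2)) *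
        ((1 + v) ^ ((n : ℝ) / 2) * (1 + v)) := by
      nth_rw 4 [← Real.rpow_one (1 + v)]
      rw [← Real.rpow_add hb, ← Real.rpow_add hb]
      congr 1; ring
    rw [e]; ring
  rw [h, setIntegral_congr_fun measurableSet_Ioi hin, integral_const_mul]
  have ht := tailIntegral_one_zero hs0 hs1
  rw [tailIntegral] at ht
  rw [ht, integral_max_one_sub_sq, psiConst, gammaConst]
  have hn : (0:ℝ) < n := by exact_mod_cast NeZero.pos n
  have hsin : 0 < Real.sin (Real.pi * s) :=
    Real.sin_pos_of_pos_of_lt_pi (by positivity) (by nlinarith [Real.pi_pos])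
  have hG : 0 < Real.Gamma ((n : ℝ) / 2) := Real.Gamma_pos_of_pos (by positivity)
  rw [Real.Gamma_add_one (by positivity), Real.rpow_add Real.pi_pos, Real.rpow_one]
  have hpi : 0 < Real.pi ^ ((n : ℝ) / 2) := by positivity
  field_simp
  norm_num

/-- The Laplace-type transform `∫ |x|^{2s} (1 - |x|²)_+ e^{-t|x|²} dx`. -/
noncomputable def ballLaplace (n : ℕ) (s t : ℝ) : ℝ :=
  ∫ x : Rn n, ‖x‖ ^ (2 * s) * max 0 (1 - ‖x‖ ^ 2) * Real.exp (-(t * ‖x‖ ^ 2))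

lemma integrable_of_continuous_of_eq_zero {n : ℕ} {F : Rn n → ℝ} (hF : Continuous F) {r : ℝ}
    (h : ∀ x, r ≤ ‖x‖ → F x = 0) : Integrable F := by
  refine hF.integrable_of_hasCompactSupport
    (HasCompactSupport.of_support_subset_isCompact (isCompact_closedBall (0 : Rn n) r)
      fun x hx => ?_)
  rw [mem_closedBall_zero_iff]
  by_contra hlt
  exact hx (h x (le_of_lt (not_le.1 hlt)))

lemma max_one_sub_sq_eq_zero {n : ℕ} {x : Rn n} (hx : 1 ≤ ‖x‖) : max 0 (1 - ‖x‖ ^ 2) = 0 :=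
  max_eq_left (by nlinarith)

lemma integrable_ballLaplace {n : ℕ} {s : ℝ} (hs0 : 0 < s) (t : ℝ) :
    Integrable fun x : Rn n =>
      ‖x‖ ^ (2 * s) * max 0 (1 - ‖x‖ ^ 2) * Real.exp (-(t * ‖x‖ ^ 2)) := by
  refine integrable_of_continuous_of_eq_zero (r := 1) ?_ fun x hx => by
    rw [max_one_sub_sq_eq_zero hx]; ring
  have : Continuous fun x : Rn n => ‖x‖ ^ (2 * s) :=
    continuous_norm.rpow_const fun _ => Or.inr (by positivity)
  fun_prop

lemma sq_mul_exp_le {q t : ℝ} (ht : 0 < t) : q * Real.exp (-(t * q)) ≤ 1 / t := by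
  rw [le_div_iff₀ ht, Real.exp_neg, ← div_eq_mul_inv, div_mul_eq_mul_div,
    div_le_one (Real.exp_pos _)]
  linarith [Real.add_one_le_exp (t * q)]

lemma integrable_meanKernel_mul_sq_exp {n : ℕ} [NeZero n] {s t : ℝ} (hs0 : 0 < s) (hs1 : s < 1)
    (ht : 0 < t) :
    Integrable fun y : Rn n => meanKernel s y * (‖y‖ ^ 2 * Real.exp (-(t * ‖y‖ ^ 2))) := by
  refine (integrable_meanKernel hs0 hs1).mul_bdd (c := 1 / t)
    (Continuous.aestronglyMeasurable (by fun_prop)) (Eventually.of_forall fun y => ?_)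
  rw [Real.norm_of_nonneg (by positivity)]
  exact sq_mul_exp_le ht

/-- The same rescaling `y = √(1 + v) x` as for the mass of `H` turns the integral in `v` into a
Gamma integral. -/
lemma integral_meanKernel_mul_sq_exp {n : ℕ} [NeZero n] {s t : ℝ} (hs0 : 0 < s) (hs1 : s < 1)
    (ht : 0 < t) :
    ∫ y : Rn n, meanKernel s y * (‖y‖ ^ 2 * Real.exp (-(t * ‖y‖ ^ 2))) =
      psiConst n s / 4 * (Real.Gamma (1 - s) * t ^ (s - 1) * ballLaplace n s t) := by
  rw [integral_meanKernel_mul hs0 hs1 (by fun_prop) (fun y => by positivity)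
    (integrable_meanKernel_mul_sq_exp hs0 hs1 ht)]
  congr 1
  set A : Rn n → ℝ := fun x => ‖x‖ ^ 2 * max 0 (1 - ‖x‖ ^ 2) with hA
  have hscale : ∀ v ∈ Set.Ioi (0:ℝ), v ^ (-s) * (1 + v) ^ (-((n : ℝ) / 2 + 2)) *
      (∫ y : Rn n, max 0 (1 + v - ‖y‖ ^ 2) * (‖y‖ ^ 2 * Real.exp (-(t * ‖y‖ ^ 2)))) =
      ∫ x : Rn n, A x * Real.exp (-(t * ‖x‖ ^ 2)) *
        (v ^ (-s) * Real.exp (-((t * ‖x‖ ^ 2) * v))) := by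
    intro v hv
    have hv0 : 0 < v := hv
    have hb : 0 < 1 + v := by linarith
    rw [integral_eq_rpow_mul_integral_sqrt_smul hb]
    have h1 : ∀ x : Rn n, max 0 (1 + v - ‖√(1 + v) • x‖ ^ 2) *
        (‖√(1 + v) • x‖ ^ 2 * Real.exp (-(t * ‖√(1 + v) • x‖ ^ 2))) =
        (1 + v) * (1 + v) *
          (A x * Real.exp (-(t * ‖x‖ ^ 2)) * Real.exp (-((t * ‖x‖ ^ 2) * v))) := fun x => by
      rw [norm_sqrt_smul_sq hb.le]
      have e1 : 1 + v - (1 + v) * ‖x‖ ^ 2 = (1 + v) * (1 - ‖x‖ ^ 2) := by ring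
      have e2 : -(t * ((1 + v) * ‖x‖ ^ 2)) = -(t * ‖x‖ ^ 2) + -((t * ‖x‖ ^ 2) * v) := by ring
      rw [e1, e2, max_zero_mul hb.le, Real.exp_add]
      simp only [hA]; ring
    simp_rw [h1]
    rw [integral_const_mul]
    have e : (1 + v) ^ (-((n : ℝ) / 2 + 2)) *
        ((1 + v) ^ ((n : ℝ) / 2) * ((1 + v) * (1 + v))) = 1 := by
      nth_rw 3 4 [← Real.rpow_one (1 + v)]
      rw [← Real.rpow_add hb, ← Real.rpow_add hb, ← Real.rpow_add hb]
      ring_nf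
      exact Real.rpow_zero _
    calc _ = v ^ (-s) * ((1 + v) ^ (-((n : ℝ) / 2 + 2)) *
          ((1 + v) ^ ((n : ℝ) / 2) * ((1 + v) * (1 + v)))) *
          ∫ x : Rn n, A x * Real.exp (-(t * ‖x‖ ^ 2)) * Real.exp (-((t * ‖x‖ ^ 2) * v)) := by ring
      _ = _ := by
        rw [e, mul_one, ← integral_const_mul]
        congr 1; ext x; ring
  rw [setIntegral_congr_fun measurableSet_Ioi hscale]
  have hinner : ∀ x : Rn n,
      IntegrableOn (fun v : ℝ => A x * Real.exp (-(t * ‖x‖ ^ 2)) *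
        (v ^ (-s) * Real.exp (-((t * ‖x‖ ^ 2) * v)))) (Set.Ioi 0) ∧
      ∫ v in Set.Ioi (0:ℝ), A x * Real.exp (-(t * ‖x‖ ^ 2)) *
        (v ^ (-s) * Real.exp (-((t * ‖x‖ ^ 2) * v))) = Real.Gamma (1 - s) * t ^ (s - 1) *
        (‖x‖ ^ (2 * s) * max 0 (1 - ‖x‖ ^ 2) * Real.exp (-(t * ‖x‖ ^ 2))) := by
    intro x
    rcases eq_or_ne x 0 with rfl | hx
    · have h2s : (2:ℝ) * s ≠ 0 := by positivity
      simp [hA, Real.zero_rpow h2s]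
    · have hx0 : 0 < ‖x‖ := norm_pos_iff.2 hx
      have hr : 0 < t * ‖x‖ ^ 2 := by positivity
      have h1 := integrableOn_rpow_mul_exp (a := 1 - s) (by linarith) hr
      have h2 := Real.integral_rpow_mul_exp_neg_mul_Ioi (a := 1 - s) (by linarith) hr
      have e2 : (1:ℝ) - s - 1 = -s := by ring
      rw [e2] at h1 h2
      refine ⟨h1.const_mul _, ?_⟩
      rw [integral_const_mul, h2, one_div, Real.inv_rpow hr.le, ← Real.rpow_neg hr.le, neg_sub,
        Real.mul_rpow ht.le (by positivity)]
      have e3 : (‖x‖ ^ 2) ^ (s - 1) * ‖x‖ ^ 2 = ‖x‖ ^ (2 * s) := by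
        rw [← Real.rpow_natCast, ← Real.rpow_mul hx0.le, ← Real.rpow_add hx0]
        congr 1; push_cast; ring
      rw [← e3]; simp only [hA]; ring
  have hprod : Integrable (Function.uncurry fun (x : Rn n) (v : ℝ) =>
      A x * Real.exp (-(t * ‖x‖ ^ 2)) * (v ^ (-s) * Real.exp (-((t * ‖x‖ ^ 2) * v))))
      (volume.prod (volume.restrict (Set.Ioi 0))) := by
    refine integrable_uncurry_of_nonneg ?_ ?_ ?_ ?_
    · refine Measurable.aestronglyMeasurable ?_
      unfold Function.uncurry
      simp only [hA]
      fun_prop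
    · refine Eventually.of_forall fun x => ?_
      filter_upwards [ae_restrict_mem measurableSet_Ioi] with v hv
      have hv0 : 0 < v := hv
      simp only [hA]
      positivity
    · exact Eventually.of_forall fun x => (hinner x).1
    · simp_rw [fun x => (hinner x).2]
      exact (integrable_ballLaplace hs0 t).const_mul _
  rw [← integral_integral_swap hprod]
  simp_rw [fun x => (hinner x).2]
  rw [integral_const_mul, ballLaplace]

lemma kernelProfile_mem_Icc {n : ℕ} [NeZero n] {s q : ℝ} (hs0 : 0 < s) (hs1 : s < 1)
    (hq : 0 ≤ q) :
    0 ≤ kernelProfile n s q ∧ kernelProfile n s q ≤ tailIntegral s ((n : ℝ) / 2 + 1) 0 := by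
  constructor
  · refine setIntegral_nonneg measurableSet_Ioi fun v hv => ?_
    have hv0 : 0 < v := hv
    positivity
  · exact setIntegral_mono_on (integrableOn_kernelProfile hs0 hs1 q)
      (integrableOn_tail hs1 (one_sub_lt n hs0)) measurableSet_Ioi
      fun v hv => kernelProfile_integrand_le hv hq

/-- The divergence theorem for the field `y H(y) e^{-t|y|²}`, in polar coordinates; note that
`T = div (y H)`. -/
lemma integral_dilationKernel_mul_exp_eq {n : ℕ} [NeZero n] {s t : ℝ} (hs0 : 0 < s) (hs1 : s < 1)
    (ht : 0 < t) :
    ∫ y : Rn n, dilationKernel s y * Real.exp (-(t * ‖y‖ ^ 2)) =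
      2 * t * ∫ y : Rn n, meanKernel s y * (‖y‖ ^ 2 * Real.exp (-(t * ‖y‖ ^ 2))) := by
  have hn : 1 ≤ n := NeZero.one_le
  set h : ℝ → ℝ := fun q => psiConst n s / 4 * kernelProfile n s q with hh
  set g : ℝ → ℝ := fun q => psiConst n s / 2 *
    tailIntegral s ((n : ℝ) / 2 + 2) (max (q - 1) 0) with hg
  have hderiv : ∀ q, HasDerivAt h (-(g q / 2)) q := fun q =>
    ((hasDerivAt_kernelProfile hs0 hs1 q).const_mul _).congr_deriv (by simp only [hg]; ring)
  have hi1 : Integrable fun y : Rn n => dilationKernel s y * Real.exp (-(t * ‖y‖ ^ 2)) := by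
    refine (integrable_dilationKernel hs0 hs1).mul_bdd (c := 1)
      (Continuous.aestronglyMeasurable (by fun_prop)) (Eventually.of_forall fun y => ?_)
    rw [Real.norm_of_nonneg (by positivity)]
    exact Real.exp_le_one_iff.2 (by have : 0 ≤ t * ‖y‖ ^ 2 := by positivity
                                    linarith)
  have hi2 := (integrable_meanKernel_mul_sq_exp (n := n) hs0 hs1 ht).const_mul (2 * t)
  rw [← integral_const_mul, ← sub_eq_zero, ← integral_sub hi1 hi2]
  set F : ℝ → ℝ := fun r => (n * h (r ^ 2) - r ^ 2 * g (r ^ 2)) * Real.exp (-(t * r ^ 2)) -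
    2 * t * (h (r ^ 2) * (r ^ 2 * Real.exp (-(t * r ^ 2)))) with hF
  have hFeq : ∀ y : Rn n, dilationKernel s y * Real.exp (-(t * ‖y‖ ^ 2)) -
      2 * t * (meanKernel s y * (‖y‖ ^ 2 * Real.exp (-(t * ‖y‖ ^ 2)))) = F ‖y‖ := by
    intro y
    simp only [hF, hh, hg, dilationKernel, meanKernel, psi_eq_tailIntegral]
  have hFi : Integrable fun y : Rn n => F ‖y‖ :=
    (hi1.sub hi2).congr (Eventually.of_forall fun y => hFeq y)
  simp_rw [hFeq]
  rw [integral_fun_norm_addHaar volume F]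
  rw [integrable_fun_norm_addHaar (E := Rn n) volume (f := F)] at hFi
  rw [finrank_Rn] at hFi ⊢
  -- In polar coordinates the integrand is the derivative of `rⁿ H(r) e^{-t r²}`, which vanishes at
  -- both ends of `(0, ∞)`.
  have hprim : ∀ r : ℝ, HasDerivAt (fun r => r ^ n * h (r ^ 2) * Real.exp (-(t * r ^ 2)))
      (r ^ (n - 1) • F r) r := by
    intro r
    have d1 := (hasDerivAt_pow n r).mul ((hderiv (r ^ 2)).comp r (hasDerivAt_pow 2 r))
    have d2 := ((hasDerivAt_pow 2 r).const_mul t).neg.exp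
    refine (d1.mul d2).congr_deriv ?_
    have e : r ^ n = r ^ (n - 1) * r := by
      rw [← pow_succ]; congr 1; omega
    simp only [hF, smul_eq_mul, Function.comp, Pi.mul_apply, Pi.neg_apply, e]
    push_cast
    ring
  have hlim : Tendsto (fun r : ℝ => r ^ n * h (r ^ 2) * Real.exp (-(t * r ^ 2))) atTop (𝓝 0) := by
    have hc := psiConst_pos n hs0 hs1
    set K := psiConst n s / 4 * tailIntegral s ((n : ℝ) / 2 + 1) 0
    have h0 := (tendsto_rpow_mul_exp_neg_mul_atTop_nhds_zero n t ht).const_mul K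
    rw [mul_zero] at h0
    refine squeeze_zero' ?_ ?_ h0
    · filter_upwards [eventually_ge_atTop 1] with r hr
      have h1 := (kernelProfile_mem_Icc (n := n) hs0 hs1 (sq_nonneg r)).1
      simp only [hh]
      positivity
    · filter_upwards [eventually_ge_atTop 1] with r hr
      have h1 := (kernelProfile_mem_Icc (n := n) hs0 hs1 (sq_nonneg r)).1
      have h2 := (kernelProfile_mem_Icc (n := n) hs0 hs1 (sq_nonneg r)).2
      have h3 : h (r ^ 2) ≤ K := by simp only [hh, K]; gcongr
      have h4 : 0 ≤ h (r ^ 2) := by simp only [hh]; positivity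
      have h5 : Real.exp (-(t * r ^ 2)) ≤ Real.exp (-t * r) := by
        rw [Real.exp_le_exp]
        have : t * r ≤ t * r ^ 2 := by gcongr; nlinarith
        linarith
      rw [Real.rpow_natCast]
      calc r ^ n * h (r ^ 2) * Real.exp (-(t * r ^ 2)) ≤ r ^ n * K * Real.exp (-t * r) := by
            gcongr
            exact mul_nonneg (by positivity) (h4.trans h3)
        _ = _ := by ring
  have := integral_Ioi_of_hasDerivAt_of_tendsto' (a := 0) (fun r _ => hprim r) hFi hlim
  rw [this]
  simp [NeZero.ne n]

/-- The Gaussian averages of `T`, in the same form as those of the fractional Laplacian of the test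
function in `integral_symTrunc_bump_mul_exp`. -/
lemma integral_dilationKernel_mul_exp {n : ℕ} [NeZero n] {s : ℝ} (hs0 : 0 < s) (hs1 : s < 1) :
    ∃ c : ℝ, 0 < c ∧ ∀ t : ℝ, 0 < t →
      ∫ y : Rn n, dilationKernel s y * Real.exp (-(t * ‖y‖ ^ 2)) =
        c * (t ^ s * ballLaplace n s t) := by
  have hc := psiConst_pos n hs0 hs1
  have hG := Real.Gamma_pos_of_pos (s := 1 - s) (by linarith)
  refine ⟨psiConst n s / 2 * Real.Gamma (1 - s), by positivity, fun t ht => ?_⟩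
  rw [integral_dilationKernel_mul_exp_eq hs0 hs1 ht, integral_meanKernel_mul_sq_exp hs0 hs1 ht]
  have : t ^ s = t * t ^ (s - 1) := by
    nth_rw 2 [← Real.rpow_one t]
    rw [← Real.rpow_add ht]; congr 1; ring
  rw [this]; ring

/-! ### Second differences and the test function -/

/-- The symmetric second difference `2φ(x) - φ(x+z) - φ(x-z)`. -/
def secondDiff {n : ℕ} (φ : Rn n → ℝ) (x z : Rn n) : ℝ := 2 * φ x - φ (x + z) - φ (x - z)

/-- The test function `(1 - |y|²)_+^{1+s}`. -/
noncomputable def bump {n : ℕ} (s : ℝ) (y : Rn n) : ℝ := (max 0 (1 - ‖y‖ ^ 2)) ^ (1 + s)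

/-- Continuous functions supported in the closed unit ball whose second differences are
`O(|z|^{1+s})`, uniformly, with the constant `B`. -/
structure IsTestFunction {n : ℕ} (s B : ℝ) (φ : Rn n → ℝ) : Prop where
  continuous : Continuous φ
  eq_zero : ∀ y, 1 ≤ ‖y‖ → φ y = 0
  abs_secondDiff_le : ∀ x z, |secondDiff φ x z| ≤ B * min 1 (‖z‖ ^ (1 + s))

/-- The function `a₊^{1+s}` is of class `C^{1,s}`; its kink at `0` is smoothed by the exponent. -/
lemma hasDerivAt_max_rpow {s : ℝ} (hs0 : 0 < s) (a : ℝ) :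
    HasDerivAt (fun a : ℝ => (max 0 a) ^ (1 + s)) ((1 + s) * (max 0 a) ^ s) a := by
  have hright : HasDerivAt (fun a : ℝ => a ^ (1 + s)) ((1 + s) * a ^ s) a := by
    have := Real.hasDerivAt_rpow_const (x := a) (p := 1 + s) (Or.inr (by linarith))
    rwa [add_sub_cancel_left] at this
  have h1s : 1 + s ≠ 0 := by positivity
  rcases lt_trichotomy a 0 with h | h | h
  · rw [max_eq_left h.le, Real.zero_rpow hs0.ne', mul_zero]
    refine (hasDerivAt_const a (0:ℝ)).congr_of_eventuallyEq ?_
    filter_upwards [gt_mem_nhds h] with x hx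
    rw [max_eq_left (le_of_lt hx), Real.zero_rpow h1s]
  · subst h
    rw [max_self, ← hasDerivWithinAt_univ, ← Set.Iic_union_Ici (a := (0:ℝ))]
    refine HasDerivWithinAt.union ?_ ?_
    · rw [Real.zero_rpow hs0.ne', mul_zero]
      refine (hasDerivWithinAt_const 0 _ (0:ℝ)).congr (fun x hx => ?_) ?_
      · rw [max_eq_left hx, Real.zero_rpow h1s]
      · rw [max_self, Real.zero_rpow h1s]
    · refine hright.hasDerivWithinAt.congr (fun x hx => ?_) ?_
      · rw [max_eq_right hx]
      · rw [max_self]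
  · rw [max_eq_right h.le]
    refine hright.congr_of_eventuallyEq ?_
    filter_upwards [lt_mem_nhds h] with x hx
    rw [max_eq_right (le_of_lt hx)]

lemma abs_max_rpow_sub_le {s : ℝ} (hs0 : 0 < s) (hs1 : s < 1) (a b : ℝ) :
    |(max 0 a) ^ s - (max 0 b) ^ s| ≤ |a - b| ^ s := by
  wlog h : b ≤ a generalizing a b
  · rw [abs_sub_comm, abs_sub_comm a b]
    exact this b a (le_of_not_ge h)
  have h1 : max 0 b ≤ max 0 a := max_le_max le_rfl h
  have h2 : max 0 a - max 0 b ≤ |a - b| := by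
    have := abs_max_sub_max_le_abs a b 0
    rw [max_comm a, max_comm b] at this
    exact (le_abs_self _).trans this
  have h0 : 0 ≤ max 0 b := le_max_left _ _
  rw [abs_of_nonneg (sub_nonneg.2 (Real.rpow_le_rpow h0 h1 hs0.le))]
  have h3 := Real.rpow_add_le_add_rpow h0 (sub_nonneg.2 h1) hs0.le hs1.le
  rw [add_sub_cancel] at h3
  have h4 : (max 0 a - max 0 b) ^ s ≤ |a - b| ^ s :=
    Real.rpow_le_rpow (sub_nonneg.2 h1) h2 hs0.le
  linarith

lemma abs_max_rpow_sub_le_of_le_one {s a b : ℝ} (hs0 : 0 < s) (ha : a ≤ 1) (hb : b ≤ 1) :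
    |(max 0 b) ^ (1 + s) - (max 0 a) ^ (1 + s)| ≤ (1 + s) * |b - a| := by
  refine Convex.norm_image_sub_le_of_norm_hasDerivWithin_le (s := Set.Iic (1:ℝ))
    (f := fun a : ℝ => (max 0 a) ^ (1 + s)) (f' := fun a => (1 + s) * (max 0 a) ^ s)
    (fun x _ => (hasDerivAt_max_rpow hs0 x).hasDerivWithinAt) (fun x hx => ?_) (convex_Iic 1) ha hb
  rw [Real.norm_of_nonneg (by positivity)]
  have : (max 0 x) ^ s ≤ 1 :=
    Real.rpow_le_one (le_max_left _ _) (max_le zero_le_one hx) hs0.le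
  nlinarith

lemma abs_max_rpow_secondDiff_le {s : ℝ} (hs0 : 0 < s) (hs1 : s < 1) (a b : ℝ) :
    |(max 0 (a + b)) ^ (1 + s) + (max 0 (a - b)) ^ (1 + s) - 2 * (max 0 a) ^ (1 + s)| ≤
      (1 + s) * (2 * |b|) ^ s * |b| := by
  wlog hb : 0 ≤ b generalizing b
  · have := this (-b) (by linarith)
    rw [abs_neg, ← sub_eq_add_neg, sub_neg_eq_add] at this
    rwa [add_comm ((max 0 (a + b)) ^ (1 + s))]
  set k : ℝ → ℝ := fun τ => (max 0 (a + τ)) ^ (1 + s) + (max 0 (a - τ)) ^ (1 + s) with hk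
  have hd : ∀ τ, HasDerivAt k
      ((1 + s) * (max 0 (a + τ)) ^ s - (1 + s) * (max 0 (a - τ)) ^ s) τ := by
    intro τ
    have h1 := (hasDerivAt_max_rpow hs0 (a + τ)).comp_const_add a τ
    have h2 := (hasDerivAt_max_rpow hs0 (a - τ)).comp_const_sub a τ
    exact (h1.add h2).congr_deriv (by ring)
  have := Convex.norm_image_sub_le_of_norm_hasDerivWithin_le (s := Set.Icc 0 b) (f := k)
    (C := (1 + s) * (2 * |b|) ^ s) (fun x _ => (hd x).hasDerivWithinAt) (fun x hx => ?_)
    (convex_Icc 0 b) (Set.left_mem_Icc.2 hb) (Set.right_mem_Icc.2 hb)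
  · simp only [hk, add_zero, sub_zero, Real.norm_eq_abs] at this
    rwa [← two_mul] at this
  · rw [← mul_sub, norm_mul, Real.norm_of_nonneg (by positivity : 0 ≤ 1 + s), Real.norm_eq_abs]
    gcongr
    refine (abs_max_rpow_sub_le hs0 hs1 _ _).trans ?_
    gcongr
    rw [abs_of_nonneg hb, abs_le]
    constructor <;> linarith [hx.1, hx.2]

lemma continuous_bump {n : ℕ} {s : ℝ} (hs0 : 0 < s) : Continuous (bump s : Rn n → ℝ) := by
  refine Continuous.rpow_const (by fun_prop) fun _ => Or.inr (by linarith)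

lemma bump_nonneg {n : ℕ} (s : ℝ) (y : Rn n) : 0 ≤ bump s y := by unfold bump; positivity

lemma bump_le_one {n : ℕ} {s : ℝ} (hs0 : 0 < s) (y : Rn n) : bump s y ≤ 1 :=
  Real.rpow_le_one (le_max_left _ _)
    (max_le zero_le_one (by have := sq_nonneg ‖y‖; linarith)) (by linarith)

lemma bump_eq_zero {n : ℕ} {s : ℝ} (hs0 : 0 < s) {y : Rn n} (hy : 1 ≤ ‖y‖) : bump s y = 0 := by
  rw [bump, max_one_sub_sq_eq_zero hy, Real.zero_rpow (by positivity)]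

/-- Around `a = 1 - |x|² - |z|²`, the values at `x ± z` are `(a ∓ b)_+^{1+s}` with `b = 2 x·z`, so
the second difference splits into a one-dimensional second difference with increment `b = O(|z|)`
and an error `O(|z|²)` from `1 - |x|²` to `a`. -/
lemma isTestFunction_bump {n : ℕ} {s : ℝ} (hs0 : 0 < s) (hs1 : s < 1) :
    IsTestFunction s 100 (bump s : Rn n → ℝ) := by
  refine ⟨continuous_bump hs0, fun y hy => bump_eq_zero hs0 hy, fun x z => ?_⟩
  have hmin : 0 ≤ min 1 (‖z‖ ^ (1 + s)) := le_min zero_le_one (by positivity)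
  rcases le_or_gt 1 ‖z‖ with hz | hz
  · have : min 1 (‖z‖ ^ (1 + s)) = 1 := min_eq_left (Real.one_le_rpow hz (by linarith))
    rw [this, secondDiff, abs_le]
    have h1 := bump_nonneg s x
    have h2 := bump_nonneg s (x + z)
    have h3 := bump_nonneg s (x - z)
    have h4 := bump_le_one hs0 x
    have h5 := bump_le_one hs0 (x + z)
    have h6 := bump_le_one hs0 (x - z)
    constructor <;> linarith
  rcases le_or_gt 2 ‖x‖ with hx | hx
  · have h1 : 1 ≤ ‖x + z‖ := by
      have := norm_sub_le (x + z) z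
      rw [add_sub_cancel_right] at this
      linarith
    have h2 : 1 ≤ ‖x - z‖ := by
      have := norm_add_le (x - z) z
      rw [sub_add_cancel] at this
      linarith
    rw [secondDiff, bump_eq_zero hs0 h1, bump_eq_zero hs0 h2, bump_eq_zero hs0 (by linarith)]
    rw [mul_zero, sub_self, sub_self, abs_zero]
    positivity
  have hz1 : ‖z‖ ^ (1 + s) ≤ 1 := Real.rpow_le_one (norm_nonneg z) hz.le (by linarith)
  rw [min_eq_right hz1]
  set b : ℝ := 2 * inner ℝ x z with hb
  set a : ℝ := 1 - ‖x‖ ^ 2 - ‖z‖ ^ 2 with ha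
  have hbz : |b| ≤ 4 * ‖z‖ := by
    rw [hb, abs_mul, abs_two]
    have := abs_real_inner_le_norm x z
    have h2 : ‖x‖ * ‖z‖ ≤ 2 * ‖z‖ := by gcongr
    linarith
  have e1 : bump s (x + z) = (max 0 (a - b)) ^ (1 + s) := by
    rw [bump, norm_add_sq_real]; congr 2; rw [ha, hb]; ring
  have e2 : bump s (x - z) = (max 0 (a + b)) ^ (1 + s) := by
    rw [bump, norm_sub_sq_real]; congr 2; rw [ha, hb]; ring
  have hA := abs_max_rpow_secondDiff_le hs0 hs1 a b
  have hB := abs_max_rpow_sub_le_of_le_one (a := a) (b := 1 - ‖x‖ ^ 2) hs0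
    (by rw [ha]; nlinarith [sq_nonneg ‖x‖, sq_nonneg ‖z‖]) (by nlinarith [sq_nonneg ‖x‖])
  have e3 : 1 - ‖x‖ ^ 2 - a = ‖z‖ ^ 2 := by rw [ha]; ring
  rw [e3, abs_of_nonneg (sq_nonneg ‖z‖)] at hB
  have hzz : ‖z‖ ^ 2 ≤ ‖z‖ ^ (1 + s) := by
    rw [← Real.rpow_natCast]
    rcases eq_or_lt_of_le (norm_nonneg z) with h | h
    · have h1s : 1 + s ≠ 0 := by positivity
      rw [← h, Real.zero_rpow h1s, Real.zero_rpow (by norm_num)]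
    · exact Real.rpow_le_rpow_of_exponent_ge h hz.le (by push_cast; linarith)
  have hbb : (1 + s) * (2 * |b|) ^ s * |b| ≤ 64 * ‖z‖ ^ (1 + s) := by
    have h1 : (2 * |b|) ^ s ≤ 8 * ‖z‖ ^ s := by
      calc (2 * |b|) ^ s ≤ (8 * ‖z‖) ^ s :=
            Real.rpow_le_rpow (by positivity) (by linarith) hs0.le
        _ = 8 ^ s * ‖z‖ ^ s := Real.mul_rpow (by norm_num) (norm_nonneg z)
        _ ≤ 8 * ‖z‖ ^ s := by
          gcongr
          calc (8:ℝ) ^ s ≤ 8 ^ (1:ℝ) := Real.rpow_le_rpow_of_exponent_le (by norm_num) hs1.le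
            _ = 8 := Real.rpow_one 8
    have h2 : ‖z‖ ^ (1 + s) = ‖z‖ ^ s * ‖z‖ := by
      rw [add_comm, Real.rpow_add' (norm_nonneg z) (by positivity), Real.rpow_one]
    calc (1 + s) * (2 * |b|) ^ s * |b| ≤ 2 * (8 * ‖z‖ ^ s) * (4 * ‖z‖) := by
          gcongr; linarith
      _ = _ := by rw [h2]; ring
  have e4 : secondDiff (bump s) x z = 2 * ((max 0 (1 - ‖x‖ ^ 2)) ^ (1 + s) - (max 0 a) ^ (1 + s)) -
      ((max 0 (a + b)) ^ (1 + s) + (max 0 (a - b)) ^ (1 + s) - 2 * (max 0 a) ^ (1 + s)) := by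
    rw [secondDiff, e1, e2, bump]; ring
  rw [e4]
  refine (abs_sub _ _).trans ?_
  rw [abs_mul, abs_two]
  have h5 : (1 + s) * ‖z‖ ^ 2 ≤ 2 * ‖z‖ ^ (1 + s) := by gcongr; linarith
  have h6 : 0 ≤ ‖z‖ ^ (1 + s) := by positivity
  linarith

/-! ### The symmetrised operator -/

/-- The integral of `(2φ(x) - φ(x+z) - φ(x-z)) |z|^{-n-2s}` over `|z| ≥ ε`. For `ε = 0` this is
the fractional Laplacian of `φ` at `x`, up to a constant factor. -/
noncomputable def symTrunc {n : ℕ} (s ε : ℝ) (φ : Rn n → ℝ) (x : Rn n) : ℝ :=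
  ∫ z in (Metric.ball 0 ε)ᶜ, secondDiff φ x z / ‖z‖ ^ ((n : ℝ) + 2 * s)

lemma symTrunc_zero {n : ℕ} (s : ℝ) (φ : Rn n → ℝ) (x : Rn n) :
    symTrunc s 0 φ x = ∫ z, secondDiff φ x z / ‖z‖ ^ ((n : ℝ) + 2 * s) := by
  simp [symTrunc]

lemma IsTestFunction.abs_div_le {n : ℕ} {s B : ℝ} {φ : Rn n → ℝ}
    (hφ : IsTestFunction s B φ) (x z : Rn n) :
    |secondDiff φ x z / ‖z‖ ^ ((n : ℝ) + 2 * s)| ≤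
      B * (min 1 (‖z‖ ^ (1 + s)) / ‖z‖ ^ ((n : ℝ) + 2 * s)) := by
  rw [abs_div, abs_of_nonneg (by positivity : 0 ≤ ‖z‖ ^ ((n : ℝ) + 2 * s)), ← mul_div_assoc]
  gcongr
  exact hφ.abs_secondDiff_le x z

lemma IsTestFunction.measurable_integrand {n : ℕ} {s B : ℝ} {φ : Rn n → ℝ}
    (hφ : IsTestFunction s B φ) (x : Rn n) :
    Measurable fun z : Rn n => secondDiff φ x z / ‖z‖ ^ ((n : ℝ) + 2 * s) := by
  have := hφ.continuous
  unfold secondDiff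
  have h : Measurable fun z : Rn n => 2 * φ x - φ (x + z) - φ (x - z) :=
    Continuous.measurable (by fun_prop)
  fun_prop

lemma integrable_bound {n : ℕ} [NeZero n] {s B : ℝ} (hs0 : 0 < s) (hs1 : s < 1) :
    Integrable fun z : Rn n => B * (min 1 (‖z‖ ^ (1 + s)) / ‖z‖ ^ ((n : ℝ) + 2 * s)) :=
  (integrable_min_rpow_div hs0 (by linarith)).const_mul B

lemma IsTestFunction.integrable {n : ℕ} [NeZero n] {s B : ℝ} {φ : Rn n → ℝ}
    (hφ : IsTestFunction s B φ) (hs0 : 0 < s) (hs1 : s < 1)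
    (x : Rn n) : Integrable fun z : Rn n => secondDiff φ x z / ‖z‖ ^ ((n : ℝ) + 2 * s) :=
  (integrable_bound hs0 hs1).mono' (hφ.measurable_integrand x).aestronglyMeasurable
    (Eventually.of_forall fun z => hφ.abs_div_le x z)

lemma IsTestFunction.abs_symTrunc_le_integral {n : ℕ} [NeZero n] {s B : ℝ} {φ : Rn n → ℝ}
    (hφ : IsTestFunction s B φ) (hs0 : 0 < s) (hs1 : s < 1) (ε : ℝ) (x : Rn n) :
    |symTrunc s ε φ x| ≤ ∫ z, |secondDiff φ x z / ‖z‖ ^ ((n : ℝ) + 2 * s)| := by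
  refine (abs_integral_le_integral_abs).trans ?_
  exact setIntegral_le_integral (hφ.integrable hs0 hs1 x).abs
    (Eventually.of_forall fun z => abs_nonneg _)

lemma inv_rpow_le_two_div_weight {n : ℕ} [NeZero n] {s : ℝ} {x : Rn n} (hs0 : 0 < s)
    (hx : 1 ≤ ‖x‖) :
    1 / ‖x‖ ^ ((n : ℝ) + 2 * s) ≤ 2 / weight s x := by
  have h : 1 ≤ ‖x‖ ^ ((n : ℝ) + 2 * s) := Real.one_le_rpow hx (exponent_pos n hs0).le
  rw [div_le_div_iff₀ (by linarith) (weight_pos s x), weight]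
  linarith

/-- For `|x| > 2` only increments `z` with `|z| ≥ |x| / 2` contribute, which gives the decay
`|x|^{-n-2s}`. -/
lemma IsTestFunction.abs_symTrunc_le {n : ℕ} [NeZero n] {s B : ℝ} {φ : Rn n → ℝ}
    (hφ : IsTestFunction s B φ) (hs0 : 0 < s) (hs1 : s < 1) :
    ∃ K : ℝ, 0 < K ∧ ∀ ε (x : Rn n), |symTrunc s ε φ x| ≤ K / weight s x := by
  set p := (n : ℝ) + 2 * s with hp
  have hp0 : 0 < p := exponent_pos n hs0
  have hφi : Integrable φ := integrable_of_continuous_of_eq_zero hφ.continuous hφ.eq_zero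
  set K₁ := ∫ z : Rn n, B * (min 1 (‖z‖ ^ (1 + s)) / ‖z‖ ^ p) with hK₁
  set K₂ := ∫ z : Rn n, |φ z| with hK₂
  have hK₂0 : 0 ≤ K₂ := integral_nonneg fun _ => abs_nonneg _
  refine ⟨|K₁| * (1 + 2 ^ p) + 4 * 2 ^ p * K₂ + 1, by positivity, fun ε x => ?_⟩
  refine (hφ.abs_symTrunc_le_integral hs0 hs1 ε x).trans ?_
  have hw := weight_pos s x
  rcases le_or_gt ‖x‖ 2 with hx | hx
  · have h1 : ∫ z, |secondDiff φ x z / ‖z‖ ^ p| ≤ K₁ :=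
      integral_mono (hφ.integrable hs0 hs1 x).abs (integrable_bound hs0 hs1)
        fun z => hφ.abs_div_le x z
    have h2 : weight s x ≤ 1 + 2 ^ p := by unfold weight; gcongr
    rw [le_div_iff₀ hw]
    calc (∫ z, |secondDiff φ x z / ‖z‖ ^ p|) * weight s x ≤ |K₁| * (1 + 2 ^ p) := by
          gcongr
          exact h1.trans (le_abs_self _)
      _ ≤ _ := by have : 0 ≤ 4 * 2 ^ p * K₂ := by positivity
                  linarith
  · have hx0 : 0 < ‖x‖ := by linarith
    have hpt : ∀ z, |secondDiff φ x z / ‖z‖ ^ p| ≤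
        2 ^ p / ‖x‖ ^ p * (|φ (x + z)| + |φ (x - z)|) := by
      intro z
      have hxz : φ x = 0 := hφ.eq_zero x (by linarith)
      rcases le_or_gt (‖x‖ / 2) ‖z‖ with hz | hz
      · have hz0 : 0 < ‖z‖ := by linarith
        have h1 : 1 / ‖z‖ ^ p ≤ 2 ^ p / ‖x‖ ^ p := by
          rw [div_le_div_iff₀ (by positivity) (by positivity), one_mul,
            ← Real.mul_rpow (by norm_num) hz0.le]
          gcongr
          linarith
        have h2 : |secondDiff φ x z| ≤ |φ (x + z)| + |φ (x - z)| := by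
          rw [secondDiff, hxz, mul_zero, zero_sub]
          calc |-φ (x + z) - φ (x - z)| ≤ |-φ (x + z)| + |φ (x - z)| := abs_sub _ _
            _ = _ := by rw [abs_neg]
        rw [abs_div, abs_of_pos (by positivity : 0 < ‖z‖ ^ p), div_eq_mul_one_div, mul_comm]
        gcongr
      · have h1 : 1 ≤ ‖x + z‖ := by
          have := norm_sub_le (x + z) z
          rw [add_sub_cancel_right] at this
          linarith
        have h2 : 1 ≤ ‖x - z‖ := by
          have := norm_add_le (x - z) z
          rw [sub_add_cancel] at this
          linarith
        rw [secondDiff, hxz, hφ.eq_zero _ h1, hφ.eq_zero _ h2]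
        simp
    have hi1 : Integrable fun z => |φ (x + z)| := (hφi.comp_add_left x).abs
    have hi2 : Integrable fun z => |φ (x - z)| := (hφi.comp_sub_left x).abs
    have h1 : ∫ z, |secondDiff φ x z / ‖z‖ ^ p| ≤ 2 ^ p / ‖x‖ ^ p * (K₂ + K₂) := by
      calc ∫ z, |secondDiff φ x z / ‖z‖ ^ p|
          ≤ ∫ z, 2 ^ p / ‖x‖ ^ p * (|φ (x + z)| + |φ (x - z)|) :=
            integral_mono (hφ.integrable hs0 hs1 x).abs ((hi1.add hi2).const_mul _) hpt
        _ = _ := by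
          rw [integral_const_mul, integral_add hi1 hi2,
            integral_add_left_eq_self (fun z => |φ z|) x,
            integral_sub_left_eq_self (fun z => |φ z|) volume x]
    refine h1.trans ?_
    have h2 := inv_rpow_le_two_div_weight (s := s) hs0 (x := x) (by linarith)
    rw [← hp] at h2
    calc 2 ^ p / ‖x‖ ^ p * (K₂ + K₂) = 2 ^ p * (2 * K₂) * (1 / ‖x‖ ^ p) := by ring
      _ ≤ 2 ^ p * (2 * K₂) * (2 / weight s x) := by gcongr
      _ = (4 * 2 ^ p * K₂) / weight s x := by ring
      _ ≤ _ := by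
        gcongr
        have : 0 ≤ |K₁| * (1 + 2 ^ p) := by positivity
        linarith

lemma IsTestFunction.tendsto_symTrunc {n : ℕ} [NeZero n] {s B : ℝ} {φ : Rn n → ℝ}
    (hφ : IsTestFunction s B φ) (hs0 : 0 < s) (hs1 : s < 1)
    (x : Rn n) : Tendsto (fun ε => symTrunc s ε φ x) (𝓝[>] 0) (𝓝 (symTrunc s 0 φ x)) := by
  rw [symTrunc_zero]
  have h : ∀ ε, symTrunc s ε φ x = ∫ z, (Metric.ball (0 : Rn n) ε)ᶜ.indicator
      (fun z => secondDiff φ x z / ‖z‖ ^ ((n : ℝ) + 2 * s)) z := fun ε => by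
    rw [integral_indicator Metric.isOpen_ball.measurableSet.compl, symTrunc]
  simp_rw [h]
  refine tendsto_integral_filter_of_dominated_convergence _ ?_ ?_
    (hφ.integrable hs0 hs1 x).abs ?_
  · exact Eventually.of_forall fun ε => ((hφ.measurable_integrand x).indicator
      Metric.isOpen_ball.measurableSet.compl).aestronglyMeasurable
  · refine Eventually.of_forall fun ε => Eventually.of_forall fun z => ?_
    exact norm_indicator_le_norm_self _ _
  · have hne : ∀ᵐ z : Rn n, z ≠ 0 := by simp [ae_iff, measure_singleton]
    filter_upwards [hne] with z hz
    refine tendsto_const_nhds.congr' ?_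
    filter_upwards [nhdsWithin_le_nhds (gt_mem_nhds (norm_pos_iff.2 hz))] with ε hε
    rw [Set.indicator_of_mem]
    simpa using hε.le

lemma IsTestFunction.continuous_symTrunc {n : ℕ} [NeZero n] {s B : ℝ} {φ : Rn n → ℝ}
    (hφ : IsTestFunction s B φ) (hs0 : 0 < s) (hs1 : s < 1)
    (ε : ℝ) : Continuous (symTrunc s ε φ) := by
  refine continuous_of_dominated
    (fun x => (hφ.measurable_integrand x).aestronglyMeasurable)
    (fun x => Eventually.of_forall fun z => hφ.abs_div_le x z)
    (integrable_bound hs0 hs1).integrableOn (Eventually.of_forall fun z => ?_)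
  have := hφ.continuous
  unfold secondDiff
  fun_prop

/-! ### Gaussian averages of the fractional Laplacian of the test function -/

/-- The convolution of two Gaussians, by completing the square. -/
lemma integral_exp_mul_exp_sub {n : ℕ} {t l : ℝ} (ht : 0 < t) (hl : 0 < l) (y : Rn n) :
    ∫ z : Rn n, Real.exp (-(t * ‖y - z‖ ^ 2)) * Real.exp (-(l * ‖z‖ ^ 2)) =
      (Real.pi / (l + t)) ^ ((n : ℝ) / 2) * Real.exp (-(l * t / (l + t) * ‖y‖ ^ 2)) := by
  have hlt : 0 < l + t := by linarith
  have h1 : ∀ z : Rn n, Real.exp (-(t * ‖y - z‖ ^ 2)) * Real.exp (-(l * ‖z‖ ^ 2)) =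
      Real.exp (-(l * t / (l + t) * ‖y‖ ^ 2)) *
        Real.exp (-(l + t) * ‖z - (t / (l + t)) • y‖ ^ 2) := by
    intro z
    rw [← Real.exp_add, ← Real.exp_add, norm_sub_sq_real, norm_sub_sq_real, norm_smul, mul_pow,
      inner_smul_right, real_inner_comm z y, Real.norm_eq_abs, sq_abs]
    congr 1
    field_simp
    ring
  simp_rw [h1]
  rw [integral_const_mul, integral_sub_right_eq_self (fun z => Real.exp (-(l + t) * ‖z‖ ^ 2)),
    GaussianFourier.integral_rexp_neg_mul_sq_norm hlt, finrank_Rn, mul_comm]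

lemma integrable_exp_neg_mul_sq {n : ℕ} {t : ℝ} (ht : 0 < t) :
    Integrable fun x : Rn n => Real.exp (-(t * ‖x‖ ^ 2)) := by
  by_contra h
  have h1 := GaussianFourier.integral_rexp_neg_mul_sq_norm (V := Rn n) ht
  simp only [neg_mul] at h1
  rw [integral_undef h] at h1
  have : 0 < (Real.pi / t) ^ ((Module.finrank ℝ (Rn n) : ℝ) / 2) := by positivity
  linarith

lemma integrable_bump {n : ℕ} {s : ℝ} (hs0 : 0 < s) : Integrable (bump s : Rn n → ℝ) :=
  integrable_of_continuous_of_eq_zero (continuous_bump hs0) fun _ hx => bump_eq_zero hs0 hx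

lemma bump_neg {n : ℕ} (s : ℝ) (y : Rn n) : bump s (-y) = bump s y := by simp [bump]

lemma integrable_mul_exp {n : ℕ} {t : ℝ} (ht : 0 < t) {F : Rn n → ℝ} (hF : Continuous F) {K : ℝ}
    (hK : ∀ x, |F x| ≤ K) : Integrable fun x => F x * Real.exp (-(t * ‖x‖ ^ 2)) :=
  (integrable_exp_neg_mul_sq ht).bdd_mul (c := K) hF.aestronglyMeasurable
    (Eventually.of_forall hK)

lemma abs_bump_le {n : ℕ} {s : ℝ} (hs0 : 0 < s) (y : Rn n) : |bump s y| ≤ 1 := by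
  rw [abs_of_nonneg (bump_nonneg s y)]; exact bump_le_one hs0 y

/-- The Gaussian average of the second difference of the test function with increment `z`. -/
noncomputable def gaussSecondDiff {n : ℕ} (s t : ℝ) (z : Rn n) : ℝ :=
  ∫ x, secondDiff (bump s) x z * Real.exp (-(t * ‖x‖ ^ 2))

section
variable {n : ℕ} {s t : ℝ}

lemma gaussSecondDiff_eq (hs0 : 0 < s) (ht : 0 < t) (z : Rn n) :
    gaussSecondDiff s t z = 2 * (∫ x : Rn n, bump s x * Real.exp (-(t * ‖x‖ ^ 2))) -
      2 * ∫ y : Rn n, bump s y * Real.exp (-(t * ‖y - z‖ ^ 2)) := by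
  have hc := continuous_bump (n := n) hs0
  have h0 := integrable_mul_exp ht hc (abs_bump_le hs0)
  have h1 := integrable_mul_exp ht (F := fun x => bump s (x + z)) (by fun_prop)
    fun x => abs_bump_le hs0 (x + z)
  have h2 := integrable_mul_exp ht (F := fun x => bump s (x - z)) (by fun_prop)
    fun x => abs_bump_le hs0 (x - z)
  have e1 : ∫ x, bump s (x + z) * Real.exp (-(t * ‖x‖ ^ 2)) =
      ∫ y, bump s y * Real.exp (-(t * ‖y - z‖ ^ 2)) := by
    rw [← integral_add_right_eq_self (fun y => bump s y * Real.exp (-(t * ‖y - z‖ ^ 2))) z]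
    simp
  have e2 : ∫ x, bump s (x - z) * Real.exp (-(t * ‖x‖ ^ 2)) =
      ∫ x, bump s (x + z) * Real.exp (-(t * ‖x‖ ^ 2)) := by
    rw [← integral_neg_eq_self (fun x => bump s (x + z) * Real.exp (-(t * ‖x‖ ^ 2)))]
    congr 1; ext x
    rw [norm_neg, ← bump_neg s (-x + z), neg_add, neg_neg, sub_eq_add_neg]
  have e3 : ∀ x, secondDiff (bump s) x z * Real.exp (-(t * ‖x‖ ^ 2)) =
      2 * (bump s x * Real.exp (-(t * ‖x‖ ^ 2))) - bump s (x + z) * Real.exp (-(t * ‖x‖ ^ 2)) -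
        bump s (x - z) * Real.exp (-(t * ‖x‖ ^ 2)) := fun x => by rw [secondDiff]; ring
  have h01 : Integrable fun x : Rn n => 2 * (bump s x * Real.exp (-(t * ‖x‖ ^ 2))) -
      bump s (x + z) * Real.exp (-(t * ‖x‖ ^ 2)) := (h0.const_mul 2).sub h1
  rw [gaussSecondDiff]
  simp_rw [e3]
  rw [integral_sub h01 h2, integral_sub (h0.const_mul 2) h1, e2, e1,
    integral_const_mul]
  ring

/-- Integrating the translation variable `z` first gives a Gaussian in the space variable, and
rescaling by `√((l + t) / l)` brings it back to `e^{-t|x|²}`. -/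
lemma integral_gaussSecondDiff_mul_exp (hs0 : 0 < s) (ht : 0 < t) {l : ℝ} (hl : 0 < l) :
    ∫ z : Rn n, gaussSecondDiff s t z * Real.exp (-(l * ‖z‖ ^ 2)) =
      2 * (Real.pi / l) ^ ((n : ℝ) / 2) *
        ∫ x : Rn n, (bump s x - bump s (√((l + t) / l) • x)) * Real.exp (-(t * ‖x‖ ^ 2)) := by
  have hc := continuous_bump (n := n) hs0
  set A := ∫ x : Rn n, bump s x * Real.exp (-(t * ‖x‖ ^ 2)) with hA
  have hg := integrable_exp_neg_mul_sq (n := n) hl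
  have hprod : Integrable (Function.uncurry fun z y : Rn n =>
      bump s y * Real.exp (-(t * ‖y - z‖ ^ 2)) * Real.exp (-(l * ‖z‖ ^ 2)))
      (volume.prod volume) := by
    refine (hg.mul_prod (integrable_bump (n := n) hs0)).mono' ?_ ?_
    · refine Continuous.aestronglyMeasurable ?_
      unfold Function.uncurry
      fun_prop
    · refine Eventually.of_forall fun ⟨z, y⟩ => ?_
      simp only [Function.uncurry]
      have h1 : Real.exp (-(t * ‖y - z‖ ^ 2)) ≤ 1 :=
        Real.exp_le_one_iff.2 (by have : 0 ≤ t * ‖y - z‖ ^ 2 := by positivity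
                                  linarith)
      have h2 := bump_nonneg s y
      rw [Real.norm_of_nonneg (by positivity), mul_comm (Real.exp _)]
      gcongr
      nlinarith
  have hz : ∀ z : Rn n, gaussSecondDiff s t z * Real.exp (-(l * ‖z‖ ^ 2)) =
      2 * A * Real.exp (-(l * ‖z‖ ^ 2)) - 2 * ∫ y, bump s y * Real.exp (-(t * ‖y - z‖ ^ 2)) *
        Real.exp (-(l * ‖z‖ ^ 2)) := by
    intro z
    rw [gaussSecondDiff_eq hs0 ht, integral_mul_const]; ring
  have hb : 0 < (l + t) / l := by positivity
  have hlt : 0 < l + t := by linarith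
  have hin : ∀ y : Rn n, ∫ z : Rn n, bump s y * Real.exp (-(t * ‖y - z‖ ^ 2)) *
      Real.exp (-(l * ‖z‖ ^ 2)) = (Real.pi / (l + t)) ^ ((n : ℝ) / 2) *
        (bump s y * Real.exp (-(l * t / (l + t) * ‖y‖ ^ 2))) := by
    intro y
    simp_rw [mul_assoc]
    rw [integral_const_mul, integral_exp_mul_exp_sub ht hl]; ring
  have hscale : ∀ x : Rn n, -(l * t / (l + t) * ‖√((l + t) / l) • x‖ ^ 2) = -(t * ‖x‖ ^ 2) := by
    intro x
    rw [norm_sqrt_smul_sq hb.le]; field_simp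
  have hpow : (Real.pi / (l + t)) ^ ((n : ℝ) / 2) * ((l + t) / l) ^ ((n : ℝ) / 2) =
      (Real.pi / l) ^ ((n : ℝ) / 2) := by
    rw [← Real.mul_rpow (by positivity) (by positivity)]
    congr 1; field_simp
  have hi1 := integrable_mul_exp ht hc (abs_bump_le hs0)
  have hi2 := integrable_mul_exp ht (F := fun x => bump s (√((l + t) / l) • x)) (by fun_prop)
    fun x => abs_bump_le hs0 _
  have hleft : Integrable fun z : Rn n => ∫ y : Rn n, bump s y * Real.exp (-(t * ‖y - z‖ ^ 2)) *
      Real.exp (-(l * ‖z‖ ^ 2)) := hprod.integral_prod_left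
  simp_rw [hz]
  rw [integral_sub (hg.const_mul _) (hleft.const_mul 2), integral_const_mul,
    integral_const_mul, integral_integral_swap hprod]
  simp_rw [hin]
  rw [integral_const_mul, integral_eq_rpow_mul_integral_sqrt_smul hb
    (fun y => bump s y * Real.exp (-(l * t / (l + t) * ‖y‖ ^ 2)))]
  simp_rw [hscale, sub_mul]
  rw [integral_sub hi1 hi2, ← hA]
  have hgi := GaussianFourier.integral_rexp_neg_mul_sq_norm (V := Rn n) hl
  simp only [neg_mul, finrank_Rn] at hgi
  rw [hgi, ← hpow]
  ring

lemma continuous_gaussSecondDiff (hs0 : 0 < s) (ht : 0 < t) :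
    Continuous (gaussSecondDiff s t : Rn n → ℝ) := by
  have hc := continuous_bump (n := n) hs0
  refine continuous_of_dominated (bound := fun x => 4 * Real.exp (-(t * ‖x‖ ^ 2))) (fun z => ?_)
    (fun z => Eventually.of_forall fun x => ?_) ((integrable_exp_neg_mul_sq ht).const_mul 4)
    (Eventually.of_forall fun x => ?_)
  · refine Continuous.aestronglyMeasurable ?_
    unfold secondDiff
    fun_prop
  · rw [norm_mul, Real.norm_of_nonneg (Real.exp_pos _).le, Real.norm_eq_abs]
    gcongr
    have h1 := abs_le.1 (abs_bump_le hs0 x)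
    have h2 := abs_le.1 (abs_bump_le hs0 (x + z))
    have h3 := abs_le.1 (abs_bump_le hs0 (x - z))
    rw [secondDiff, abs_le]
    constructor <;> linarith
  · unfold secondDiff
    fun_prop

/-- Fubini's theorem, exchanging the Gaussian average with the singular integral. -/
lemma integral_symTrunc_bump_mul_exp_eq [NeZero n] (hs0 : 0 < s) (hs1 : s < 1) (ht : 0 < t) :
    ∫ x : Rn n, symTrunc s 0 (bump s) x * Real.exp (-(t * ‖x‖ ^ 2)) =
      ∫ z : Rn n, gaussSecondDiff s t z / ‖z‖ ^ ((n : ℝ) + 2 * s) ∧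
    Integrable fun z : Rn n => gaussSecondDiff s t z / ‖z‖ ^ ((n : ℝ) + 2 * s) := by
  have hf := isTestFunction_bump (n := n) hs0 hs1
  have hprod : Integrable (Function.uncurry fun x z : Rn n =>
      secondDiff (bump s) x z / ‖z‖ ^ ((n : ℝ) + 2 * s) * Real.exp (-(t * ‖x‖ ^ 2)))
      (volume.prod volume) := by
    refine ((integrable_exp_neg_mul_sq (n := n) ht).mul_prod
      (integrable_bound (n := n) (B := 100) hs0 hs1)).mono' ?_ ?_
    · refine Measurable.aestronglyMeasurable ?_
      unfold Function.uncurry secondDiff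
      have := (continuous_bump (n := n) hs0).measurable
      fun_prop
    · refine Eventually.of_forall fun ⟨x, z⟩ => ?_
      simp only [Function.uncurry]
      rw [norm_mul, Real.norm_of_nonneg (Real.exp_pos _).le, mul_comm]
      gcongr
      exact hf.abs_div_le x z
  have h1 : ∀ z : Rn n, gaussSecondDiff s t z / ‖z‖ ^ ((n : ℝ) + 2 * s) =
      ∫ x : Rn n, secondDiff (bump s) x z / ‖z‖ ^ ((n : ℝ) + 2 * s) *
        Real.exp (-(t * ‖x‖ ^ 2)) := by
    intro z
    rw [gaussSecondDiff, ← integral_div]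
    congr 1; ext x; ring
  constructor
  · simp_rw [h1]
    rw [← integral_integral_swap hprod]
    congr 1; ext x
    rw [symTrunc_zero, integral_mul_const]
  · simp_rw [h1]
    exact hprod.integral_prod_right

/-- The kernel `|z|^{-n-2s}` is a superposition of Gaussians, so its integral against a function
is determined by the Gaussian averages of that function. -/
lemma integral_div_rpow_eq [NeZero n] (hs0 : 0 < s) {Q : Rn n → ℝ} (hQ : Continuous Q)
    (hi : Integrable fun z : Rn n => Q z / ‖z‖ ^ ((n : ℝ) + 2 * s)) :
    Real.Gamma (((n : ℝ) + 2 * s) / 2) * ∫ z : Rn n, Q z / ‖z‖ ^ ((n : ℝ) + 2 * s) =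
      ∫ l in Set.Ioi (0:ℝ), l ^ (((n : ℝ) + 2 * s) / 2 - 1) *
        ∫ z : Rn n, Q z * Real.exp (-(l * ‖z‖ ^ 2)) := by
  have hp0 := exponent_pos n hs0
  set p := (n : ℝ) + 2 * s with hp
  have hG := Real.Gamma_pos_of_pos (s := p / 2) (by positivity)
  have hinner : ∀ z : Rn n, z ≠ 0 →
      IntegrableOn (fun l : ℝ => l ^ (p / 2 - 1) * (Q z * Real.exp (-(l * ‖z‖ ^ 2)))) (Set.Ioi 0) ∧
      ∀ c : ℝ, ∫ l in Set.Ioi (0:ℝ), c * (l ^ (p / 2 - 1) * Real.exp (-(‖z‖ ^ 2 * l))) =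
        Real.Gamma (p / 2) * (c / ‖z‖ ^ p) := by
    intro z hz
    have hz0 : 0 < ‖z‖ := norm_pos_iff.2 hz
    have hr : 0 < ‖z‖ ^ 2 := by positivity
    have h1 := integrableOn_rpow_mul_exp (a := p / 2) (by positivity) hr
    have h2 := Real.integral_rpow_mul_exp_neg_mul_Ioi (a := p / 2) (by positivity) hr
    refine ⟨(h1.const_mul (Q z)).congr (Eventually.of_forall fun l => ?_), fun c => ?_⟩
    · simp only
      rw [mul_comm l (‖z‖ ^ 2)]; ring
    · have e : (‖z‖ ^ 2) ^ (p / 2) = ‖z‖ ^ p := by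
        rw [← Real.rpow_natCast, ← Real.rpow_mul hz0.le]
        congr 1; push_cast; ring
      rw [integral_const_mul, h2, one_div, Real.inv_rpow hr.le, e]
      ring
  have hne : ∀ᵐ z : Rn n, z ≠ 0 := by simp [ae_iff, measure_singleton]
  have hprod : Integrable (Function.uncurry fun (z : Rn n) (l : ℝ) =>
      l ^ (p / 2 - 1) * (Q z * Real.exp (-(l * ‖z‖ ^ 2))))
      (volume.prod (volume.restrict (Set.Ioi 0))) := by
    rw [integrable_prod_iff]
    · refine ⟨?_, ?_⟩
      · filter_upwards [hne] with z hz using (hinner z hz).1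
      · refine (hi.norm.const_mul (Real.Gamma (p / 2))).congr ?_
        filter_upwards [hne] with z hz
        have h1 : ∀ l ∈ Set.Ioi (0:ℝ), ‖l ^ (p / 2 - 1) * (Q z * Real.exp (-(l * ‖z‖ ^ 2)))‖ =
            ‖Q z‖ * (l ^ (p / 2 - 1) * Real.exp (-(‖z‖ ^ 2 * l))) := by
          intro l hl
          have hl0 : 0 < l := hl
          rw [norm_mul, norm_mul, Real.norm_of_nonneg (Real.exp_pos _).le,
            Real.norm_of_nonneg (by positivity : 0 ≤ l ^ (p / 2 - 1)), mul_comm l]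
          ring
        simp only [Function.uncurry]
        rw [setIntegral_congr_fun measurableSet_Ioi h1, (hinner z hz).2, norm_div,
          Real.norm_of_nonneg (by positivity : 0 ≤ ‖z‖ ^ p)]
    · refine Measurable.aestronglyMeasurable ?_
      unfold Function.uncurry
      have := hQ.measurable
      fun_prop
  simp_rw [← integral_const_mul]
  rw [← integral_integral_swap hprod]
  refine integral_congr_ae ?_
  filter_upwards [hne] with z hz
  rw [← (hinner z hz).2 (Q z)]
  congr 1; ext l
  rw [mul_comm l (‖z‖ ^ 2)]; ring

/-- The integral `∫_0^∞ m^{s-1} (1 - (1 - 1/m)_+^{1+s}) dm`. -/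
noncomputable def scaleConst (s : ℝ) : ℝ :=
  ∫ m in Set.Ioi (0:ℝ), m ^ (s - 1) * (1 - (max 0 (1 - 1 / m)) ^ (1 + s))

end

lemma scale_integrand_mem {s m : ℝ} (hs0 : 0 < s) (hm : 0 < m) :
    0 ≤ 1 - (max 0 (1 - 1 / m)) ^ (1 + s) ∧ 1 - (max 0 (1 - 1 / m)) ^ (1 + s) ≤ 1 := by
  have h0 : 0 ≤ (max 0 (1 - 1 / m)) ^ (1 + s) := by positivity
  have h1 : (max 0 (1 - 1 / m)) ^ (1 + s) ≤ 1 :=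
    Real.rpow_le_one (le_max_left _ _)
      (max_le zero_le_one (by have : 0 < 1 / m := by positivity
                              linarith)) (by linarith)
  constructor <;> linarith

lemma integrableOn_scaleConst {s : ℝ} (hs0 : 0 < s) (hs1 : s < 1) :
    IntegrableOn (fun m : ℝ => m ^ (s - 1) * (1 - (max 0 (1 - 1 / m)) ^ (1 + s))) (Set.Ioi 0) := by
  have hm : ∀ t : Set ℝ, AEStronglyMeasurable
      (fun m : ℝ => m ^ (s - 1) * (1 - (max 0 (1 - 1 / m)) ^ (1 + s))) (volume.restrict t) :=
    fun t => Measurable.aestronglyMeasurable (by fun_prop)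
  rw [← Set.Ioc_union_Ioi_eq_Ioi (zero_le_one (α := ℝ))]
  refine IntegrableOn.union ?_ ?_
  · have h : IntegrableOn (fun r : ℝ => r ^ (s - 1)) (Set.Ioc 0 1) := by
      rw [integrableOn_Ioc_iff_integrableOn_Ioo]
      exact (intervalIntegral.integrableOn_Ioo_rpow_iff one_pos).2 (by linarith)
    refine Integrable.mono' h (hm _) ?_
    filter_upwards [ae_restrict_mem measurableSet_Ioc] with v hv
    have hv0 : 0 < v := hv.1
    obtain ⟨h1, h2⟩ := scale_integrand_mem hs0 hv0
    rw [Real.norm_of_nonneg (by positivity)]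
    have h3 : 0 ≤ v ^ (s - 1) := by positivity
    nlinarith
  · have h : IntegrableOn (fun r : ℝ => (1 + s) * r ^ (s - 2)) (Set.Ioi 1) :=
      (integrableOn_Ioi_rpow_of_lt (by linarith) one_pos).const_mul _
    refine Integrable.mono' h (hm _) ?_
    filter_upwards [ae_restrict_mem measurableSet_Ioi] with v hv
    have hv1 : 1 < v := hv
    have hv0 : 0 < v := by linarith
    obtain ⟨h1, h2⟩ := scale_integrand_mem hs0 hv0
    rw [Real.norm_of_nonneg (by positivity)]
    have hv' : 1 / v ≤ 1 := by rw [div_le_one hv0]; exact hv1.le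
    have h3 := one_add_mul_self_le_rpow_one_add (s := -(1 / v)) (by linarith)
      (p := 1 + s) (by linarith)
    rw [max_eq_right (by linarith), sub_eq_add_neg 1 (1 / v)]
    have h4 : v ^ (s - 2) = v ^ (s - 1) * (1 / v) := by
      rw [one_div, ← Real.rpow_neg_one v, ← Real.rpow_add hv0]; congr 1; ring
    rw [h4]
    have h5 : 0 < v ^ (s - 1) := by positivity
    calc v ^ (s - 1) * (1 - (1 + -(1 / v)) ^ (1 + s)) ≤ v ^ (s - 1) * ((1 + s) * (1 / v)) := by
          gcongr; linarith
      _ = _ := by ring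

lemma scaleConst_pos {s : ℝ} (hs0 : 0 < s) (hs1 : s < 1) : 0 < scaleConst s := by
  have h1 : ∫ m in Set.Ioc (0:ℝ) 1, m ^ (s - 1) * (1 - (max 0 (1 - 1 / m)) ^ (1 + s)) = 1 / s := by
    have : ∀ m ∈ Set.Ioc (0:ℝ) 1, m ^ (s - 1) * (1 - (max 0 (1 - 1 / m)) ^ (1 + s)) =
        m ^ (s - 1) := by
      intro m hm
      have : 1 ≤ 1 / m := by rw [le_div_iff₀ hm.1]; linarith [hm.2]
      rw [max_eq_left (by linarith), Real.zero_rpow (by positivity), sub_zero, mul_one]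
    rw [setIntegral_congr_fun measurableSet_Ioc this, ← intervalIntegral.integral_of_le zero_le_one,
      integral_rpow (Or.inl (by linarith)), sub_add_cancel, Real.one_rpow,
      Real.zero_rpow hs0.ne', sub_zero]
  have h2 : 1 / s ≤ scaleConst s := by
    rw [← h1]
    refine setIntegral_mono_set (integrableOn_scaleConst hs0 hs1) ?_
      (Set.Ioc_subset_Ioi_self).eventuallyLE
    filter_upwards [ae_restrict_mem measurableSet_Ioi] with v hv
    have hv0 : 0 < v := hv
    have := (scale_integrand_mem hs0 hv0).1
    simp only [Pi.zero_apply]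
    positivity
  exact lt_of_lt_of_le (by positivity) h2

/-- The substitution `l = a m` with `a = t q / (1 - q)` reduces the integral to `scaleConst`, since
`1 - (l + t) / l * q = (1 - q) (1 - 1 / m)`. -/
lemma integral_rpow_mul_max_sub {s t q : ℝ} (hs0 : 0 < s) (hs1 : s < 1) (ht : 0 < t)
    (hq0 : 0 ≤ q) :
    IntegrableOn (fun l : ℝ => l ^ (s - 1) *
      ((max 0 (1 - q)) ^ (1 + s) - (max 0 (1 - (l + t) / l * q)) ^ (1 + s))) (Set.Ioi 0) ∧
    ∫ l in Set.Ioi (0:ℝ), l ^ (s - 1) *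
      ((max 0 (1 - q)) ^ (1 + s) - (max 0 (1 - (l + t) / l * q)) ^ (1 + s)) =
        scaleConst s * t ^ s * (q ^ s * max 0 (1 - q)) := by
  have h1s : 1 + s ≠ 0 := by positivity
  set G : ℝ → ℝ := fun l => l ^ (s - 1) *
      ((max 0 (1 - q)) ^ (1 + s) - (max 0 (1 - (l + t) / l * q)) ^ (1 + s)) with hG
  have hzero : (∀ l ∈ Set.Ioi (0:ℝ), G l = 0) → q ^ s * max 0 (1 - q) = 0 →
      IntegrableOn G (Set.Ioi 0) ∧ ∫ l in Set.Ioi (0:ℝ), G l =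
        scaleConst s * t ^ s * (q ^ s * max 0 (1 - q)) := by
    intro h h'
    refine ⟨integrableOn_zero.congr_fun (fun l hl => (h l hl).symm) measurableSet_Ioi, ?_⟩
    rw [setIntegral_congr_fun measurableSet_Ioi h, h']; simp
  rcases le_or_gt 1 q with hq1 | hq1
  · have hm : max 0 (1 - q) = 0 := max_eq_left (by linarith)
    refine hzero (fun l hl => ?_) (by rw [hm, mul_zero])
    have hl0 : 0 < l := hl
    have h1 : 1 ≤ (l + t) / l := by rw [le_div_iff₀ hl0]; linarith
    have h2 : max 0 (1 - (l + t) / l * q) = 0 := max_eq_left (by nlinarith)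
    simp only [hG]
    rw [hm, h2, sub_self, mul_zero]
  rcases eq_or_lt_of_le hq0 with hq | hq
  · refine hzero (fun l hl => ?_) (by rw [← hq, Real.zero_rpow hs0.ne', zero_mul])
    simp only [hG, ← hq, mul_zero, sub_self]
  have h1q : 0 < 1 - q := by linarith
  set a := t * q / (1 - q) with ha
  have ha0 : 0 < a := by positivity
  have hcomp : ∀ m ∈ Set.Ioi (0:ℝ), G (a * m) = a ^ (s - 1) * (1 - q) ^ (1 + s) *
      (m ^ (s - 1) * (1 - (max 0 (1 - 1 / m)) ^ (1 + s))) := by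
    intro m hm
    have hm0 : 0 < m := hm
    have e1 : 1 - (a * m + t) / (a * m) * q = (1 - q) * (1 - 1 / m) := by
      rw [ha]; field_simp; ring
    simp only [hG]
    rw [e1, max_zero_mul h1q.le, Real.mul_rpow h1q.le (le_max_left _ _), max_eq_right h1q.le,
      Real.mul_rpow ha0.le hm0.le]
    ring
  have hi := (integrableOn_scaleConst hs0 hs1).const_mul (a ^ (s - 1) * (1 - q) ^ (1 + s))
  have hi2 : IntegrableOn (fun m => G (a * m)) (Set.Ioi 0) :=
    IntegrableOn.congr_fun (s := Set.Ioi 0) hi (fun m hm => (hcomp m hm).symm) measurableSet_Ioi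
  rw [integrableOn_Ioi_comp_mul_left_iff G 0 ha0, mul_zero] at hi2
  refine ⟨hi2, ?_⟩
  have h3 := integral_comp_mul_left_Ioi G 0 ha0
  rw [mul_zero, setIntegral_congr_fun measurableSet_Ioi hcomp, integral_const_mul, smul_eq_mul,
    eq_inv_mul_iff_mul_eq₀ ha0.ne'] at h3
  rw [← h3, max_eq_right h1q.le, scaleConst]
  have e2 : a * (a ^ (s - 1) * (1 - q) ^ (1 + s)) = t ^ s * (q ^ s * (1 - q)) := by
    have h4 : a * a ^ (s - 1) = a ^ s := by
      nth_rw 1 [← Real.rpow_one a]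
      rw [← Real.rpow_add ha0]; congr 1; ring
    have h5 : (1 - q) ^ (1 + s) = (1 - q) * (1 - q) ^ s := by
      rw [Real.rpow_add h1q, Real.rpow_one]
    have h6 : a ^ s * (1 - q) ^ s = t ^ s * q ^ s := by
      rw [← Real.mul_rpow ha0.le h1q.le, ← Real.mul_rpow ht.le hq0]
      congr 1; rw [ha]; field_simp
    rw [h5]
    calc a * (a ^ (s - 1) * ((1 - q) * (1 - q) ^ s))
        = (a * a ^ (s - 1)) * (1 - q) ^ s * (1 - q) := by ring
      _ = _ := by rw [h4, h6]; ring
  linear_combination (∫ m in Set.Ioi (0:ℝ), m ^ (s - 1) *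
    (1 - (max 0 (1 - 1 / m)) ^ (1 + s))) * e2

/-- The Gaussian averages of the fractional Laplacian of the test function. Writing `|z|^{-n-2s}` as
a superposition of Gaussians `e^{-l|z|²}` leaves, after the integration in `z`, the explicit
integral in `l` of `integral_rpow_mul_max_sub`. -/
lemma integral_symTrunc_bump_mul_exp {n : ℕ} [NeZero n] {s : ℝ} (hs0 : 0 < s) (hs1 : s < 1) :
    ∃ c : ℝ, 0 < c ∧ ∀ t : ℝ, 0 < t →
      ∫ x : Rn n, symTrunc s 0 (bump s) x * Real.exp (-(t * ‖x‖ ^ 2)) =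
        c * (t ^ s * ballLaplace n s t) := by
  have hp0 := exponent_pos n hs0
  have hG := Real.Gamma_pos_of_pos (s := ((n : ℝ) + 2 * s) / 2) (by positivity)
  have hκ := scaleConst_pos hs0 hs1
  refine ⟨(Real.Gamma (((n : ℝ) + 2 * s) / 2))⁻¹ * (2 * Real.pi ^ ((n : ℝ) / 2) * scaleConst s),
    by positivity, fun t ht => ?_⟩
  obtain ⟨h1, h2⟩ := integral_symTrunc_bump_mul_exp_eq (n := n) hs0 hs1 ht
  have h3 := integral_div_rpow_eq hs0 (continuous_gaussSecondDiff hs0 ht) h2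
  rw [h1, mul_assoc, eq_inv_mul_iff_mul_eq₀ hG.ne', h3]
  have hbumpq : ∀ (x : Rn n) (l : ℝ), 0 < l → bump s (√((l + t) / l) • x) =
      (max 0 (1 - (l + t) / l * ‖x‖ ^ 2)) ^ (1 + s) := fun x l hl => by
    rw [bump, norm_sqrt_smul_sq (by positivity)]
  have hin : ∀ l ∈ Set.Ioi (0:ℝ), l ^ (((n : ℝ) + 2 * s) / 2 - 1) *
      (∫ z : Rn n, gaussSecondDiff s t z * Real.exp (-(l * ‖z‖ ^ 2))) =
      2 * Real.pi ^ ((n : ℝ) / 2) * ∫ x : Rn n, l ^ (s - 1) *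
        ((max 0 (1 - ‖x‖ ^ 2)) ^ (1 + s) - (max 0 (1 - (l + t) / l * ‖x‖ ^ 2)) ^ (1 + s)) *
          Real.exp (-(t * ‖x‖ ^ 2)) := by
    intro l hl
    have hl0 : 0 < l := hl
    rw [integral_gaussSecondDiff_mul_exp hs0 ht hl0, Real.div_rpow Real.pi_pos.le hl0.le]
    simp_rw [hbumpq _ l hl0, mul_assoc (l ^ (s - 1))]
    rw [integral_const_mul]
    have e : l ^ (((n : ℝ) + 2 * s) / 2 - 1) / l ^ ((n : ℝ) / 2) = l ^ (s - 1) := by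
      rw [← Real.rpow_sub hl0]; congr 1; ring
    rw [← e]
    simp only [bump]
    ring
  rw [setIntegral_congr_fun measurableSet_Ioi hin, integral_const_mul]
  have hprod : Integrable (Function.uncurry fun (x : Rn n) (l : ℝ) => l ^ (s - 1) *
      ((max 0 (1 - ‖x‖ ^ 2)) ^ (1 + s) - (max 0 (1 - (l + t) / l * ‖x‖ ^ 2)) ^ (1 + s)) *
        Real.exp (-(t * ‖x‖ ^ 2))) (volume.prod (volume.restrict (Set.Ioi 0))) := by
    refine integrable_uncurry_of_nonneg ?_ ?_ ?_ ?_
    · refine Measurable.aestronglyMeasurable ?_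
      unfold Function.uncurry
      fun_prop
    · refine Eventually.of_forall fun x => ?_
      filter_upwards [ae_restrict_mem measurableSet_Ioi] with l hl
      have hl0 : 0 < l := hl
      have h4 : 1 ≤ (l + t) / l := by rw [le_div_iff₀ hl0]; linarith
      have h5 : max 0 (1 - (l + t) / l * ‖x‖ ^ 2) ≤ max 0 (1 - ‖x‖ ^ 2) :=
        max_le_max le_rfl (by nlinarith [sq_nonneg ‖x‖])
      have h6 : (max 0 (1 - (l + t) / l * ‖x‖ ^ 2)) ^ (1 + s) ≤
          (max 0 (1 - ‖x‖ ^ 2)) ^ (1 + s) :=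
        Real.rpow_le_rpow (le_max_left _ _) h5 (by linarith)
      have h7 := sub_nonneg.2 h6
      positivity
    · exact Eventually.of_forall fun x =>
        (integral_rpow_mul_max_sub hs0 hs1 ht (sq_nonneg ‖x‖)).1.mul_const _
    · simp_rw [integral_mul_const,
        fun x : Rn n => (integral_rpow_mul_max_sub hs0 hs1 ht (sq_nonneg ‖x‖)).2]
      refine ((integrable_ballLaplace hs0 t).const_mul (scaleConst s * t ^ s)).congr
        (Eventually.of_forall fun x => ?_)
      simp only
      rw [← Real.rpow_natCast ‖x‖ 2, ← Real.rpow_mul (norm_nonneg x)]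
      push_cast; ring
  have hx : ∀ x : Rn n, ∫ l in Set.Ioi (0:ℝ), l ^ (s - 1) *
      ((max 0 (1 - ‖x‖ ^ 2)) ^ (1 + s) - (max 0 (1 - (l + t) / l * ‖x‖ ^ 2)) ^ (1 + s)) *
        Real.exp (-(t * ‖x‖ ^ 2)) = scaleConst s * t ^ s *
          (‖x‖ ^ (2 * s) * max 0 (1 - ‖x‖ ^ 2) * Real.exp (-(t * ‖x‖ ^ 2))) := fun x => by
    have e : (‖x‖ ^ 2) ^ s = ‖x‖ ^ (2 * s) := by
      rw [← Real.rpow_natCast ‖x‖ 2, ← Real.rpow_mul (norm_nonneg x)]; push_cast; rfl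
    rw [integral_mul_const, (integral_rpow_mul_max_sub hs0 hs1 ht (sq_nonneg ‖x‖)).2, e]
    ring
  rw [← integral_integral_swap hprod]
  simp_rw [hx]
  rw [integral_const_mul, ballLaplace]
  ring

/-! ### The identity between the two kernels -/

/-- The isometry is the reflection across the hyperplane orthogonal to `x - y`. -/
lemma exists_isometry_map_eq {n : ℕ} {x y : Rn n} (h : ‖x‖ = ‖y‖) :
    ∃ e : Rn n ≃ₗᵢ[ℝ] Rn n, e x = y :=
  ⟨_, Submodule.reflection_sub h⟩

lemma symTrunc_bump_eq_of_norm_eq {n : ℕ} (s : ℝ) {x y : Rn n} (h : ‖x‖ = ‖y‖) :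
    symTrunc s 0 (bump s) x = symTrunc s 0 (bump s) y := by
  obtain ⟨e, rfl⟩ := exists_isometry_map_eq h
  have hb : ∀ x, bump s (e x) = bump s x := fun x => by simp [bump]
  rw [symTrunc_zero, symTrunc_zero, ← e.measurePreserving.integral_comp'
    (f := e.toMeasurableEquiv)
    (fun z => secondDiff (bump s) (e x) z / ‖z‖ ^ ((n : ℝ) + 2 * s))]
  congr 1; ext z
  change _ = secondDiff (bump s) (e x) (e z) / ‖e z‖ ^ ((n : ℝ) + 2 * s)
  rw [e.norm_map, secondDiff, secondDiff, ← map_add, ← map_sub, hb, hb, hb]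

lemma integral_mul_polynomial_exp_eq_zero {n : ℕ} {g : Rn n → ℝ} (hgi : Integrable g)
    (h : ∀ t : ℝ, 0 < t → ∫ x, g x * Real.exp (-(t * ‖x‖ ^ 2)) = 0) (P : Polynomial ℝ) :
    ∫ x, g x * Real.exp (-‖x‖ ^ 2) * P.eval (Real.exp (-‖x‖ ^ 2)) = 0 := by
  have hterm : ∀ (k : ℕ) (x : Rn n), g x * Real.exp (-‖x‖ ^ 2) *
      (P.coeff k * Real.exp (-‖x‖ ^ 2) ^ k) =
      P.coeff k * (g x * Real.exp (-(((k : ℝ) + 1) * ‖x‖ ^ 2))) := by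
    intro k x
    have : Real.exp (-(((k : ℝ) + 1) * ‖x‖ ^ 2)) =
        Real.exp (-‖x‖ ^ 2) ^ k * Real.exp (-‖x‖ ^ 2) := by
      rw [← Real.exp_nat_mul, ← Real.exp_add]; congr 1; ring
    rw [this]; ring
  have hint : ∀ k : ℕ, Integrable fun x : Rn n =>
      g x * Real.exp (-(((k : ℝ) + 1) * ‖x‖ ^ 2)) := fun k => by
    refine hgi.mul_bdd (c := 1) (Continuous.aestronglyMeasurable (by fun_prop))
      (Eventually.of_forall fun x => ?_)
    rw [Real.norm_of_nonneg (by positivity)]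
    exact Real.exp_le_one_iff.2 (by have : 0 ≤ ((k : ℝ) + 1) * ‖x‖ ^ 2 := by positivity
                                    linarith)
  simp_rw [Polynomial.eval_eq_sum_range, Finset.mul_sum, hterm]
  rw [integral_finsetSum _ fun k _ => (hint k).const_mul _]
  refine Finset.sum_eq_zero fun k _ => ?_
  rw [integral_const_mul, h _ (by positivity), mul_zero]

/-- A continuous radial function with sufficient decay vanishes if all its Gaussian averages do:
as a function of `e^{-|x|²}`, it is a uniform limit of polynomials, so it is orthogonal to
itself. -/
lemma eq_zero_of_forall_integral_mul_exp_eq_zero {n : ℕ} [NeZero n] {s : ℝ} (hs0 : 0 < s)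
    {g : Rn n → ℝ} (hg : Continuous g) (hrad : ∀ x y, ‖x‖ = ‖y‖ → g x = g y) {K : ℝ}
    (hK : ∀ x, |g x| ≤ K / weight s x)
    (h : ∀ t : ℝ, 0 < t → ∫ x, g x * Real.exp (-(t * ‖x‖ ^ 2)) = 0) (x : Rn n) : g x = 0 := by
  have hp0 := exponent_pos n hs0
  have hgi : Integrable g := integrable_of_le_weight hs0 hg.aestronglyMeasurable hK
  have he1 : ∀ r : ℝ, 0 ≤ r → ‖r • e1 n‖ = r := fun r hr => by
    rw [norm_smul, Real.norm_of_nonneg hr]; simp [e1]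
  -- The function `g` in the variable `v = e^{-|x|²} ∈ (0, 1]`, extended by its limit `0`
  -- at `v = 0`.
  set φ : ℝ → ℝ := fun v => if v ≤ 0 then 0 else g (√(-Real.log v) • e1 n) with hφ
  have hφx : ∀ x : Rn n, φ (Real.exp (-‖x‖ ^ 2)) = g x := by
    intro x
    simp only [hφ]
    rw [if_neg (not_le.2 (Real.exp_pos _)), Real.log_exp, neg_neg, Real.sqrt_sq (norm_nonneg x)]
    exact hrad _ _ (he1 _ (norm_nonneg x))
  have hφc : ContinuousOn φ (Set.Icc 0 1) := by
    intro v hv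
    rcases eq_or_lt_of_le hv.1 with h0 | h0
    · have hφ0 : φ v = 0 := by simp [hφ, ← h0]
      rw [ContinuousWithinAt, hφ0]
      have hlim : Tendsto (fun v : ℝ => K / (1 + (√(-Real.log v)) ^ ((n : ℝ) + 2 * s)))
          (𝓝[>] 0) (𝓝 0) := by
        refine Tendsto.div_atTop tendsto_const_nhds ?_
        refine tendsto_atTop_add_const_left _ _ ?_
        refine (tendsto_rpow_atTop hp0).comp ?_
        exact Real.tendsto_sqrt_atTop.comp (tendsto_neg_atBot_atTop.comp
          Real.tendsto_log_nhdsGT_zero)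
      rw [← h0]
      have hpos : Tendsto φ (𝓝[>] 0) (𝓝 0) := by
        refine squeeze_zero_norm' ?_ hlim
        filter_upwards [self_mem_nhdsWithin] with w hw
        simp only [hφ]
        rw [if_neg (not_le.2 hw)]
        have := hK (√(-Real.log w) • e1 n)
        rwa [weight, he1 _ (Real.sqrt_nonneg _)] at this
      have hins : Tendsto φ (𝓝[≥] 0) (𝓝 0) := by
        have h0' : φ 0 = 0 := by simp [hφ]
        have : ContinuousWithinAt φ (Set.Ioi 0) 0 := by rw [ContinuousWithinAt, h0']; exact hpos
        have := continuousWithinAt_Ioi_iff_Ici.1 this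
        rwa [ContinuousWithinAt, h0'] at this
      exact hins.mono_left (nhdsWithin_mono _ fun w hw => hw.1)
    · refine ContinuousAt.continuousWithinAt ?_
      have : φ =ᶠ[𝓝 v] fun v => g (√(-Real.log v) • e1 n) := by
        filter_upwards [lt_mem_nhds h0] with w hw
        simp only [hφ]
        rw [if_neg (not_le.2 hw)]
      refine ContinuousAt.congr ?_ this.symm
      have h1 : ContinuousAt (fun v : ℝ => √(-Real.log v)) v :=
        (Real.continuousAt_log h0.ne').neg.sqrt
      exact ContinuousAt.comp (g := g) hg.continuousAt (h1.smul continuousAt_const)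
  have hexp : ∀ x : Rn n, Real.exp (-‖x‖ ^ 2) ∈ Set.Icc (0:ℝ) 1 := fun x =>
    ⟨(Real.exp_pos _).le, Real.exp_le_one_iff.2 (by have := sq_nonneg ‖x‖; linarith)⟩
  have hbd : ∀ x, |g x| ≤ |K| := fun x => (hK x).trans (by
    refine (div_le_div_of_nonneg_right (le_abs_self K) (weight_pos s x).le).trans ?_
    exact div_le_self (abs_nonneg K) (one_le_weight s x))
  have hge : Integrable fun x => g x * Real.exp (-‖x‖ ^ 2) :=
    hgi.mul_bdd (c := 1) (Continuous.aestronglyMeasurable (by fun_prop))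
      (Eventually.of_forall fun x => by
        rw [Real.norm_of_nonneg (hexp x).1]; exact (hexp x).2)
  have hgg : Integrable fun x => g x * Real.exp (-‖x‖ ^ 2) * g x :=
    hge.mul_bdd (c := |K|) hg.aestronglyMeasurable (Eventually.of_forall hbd)
  have hzero : ∫ x, g x * Real.exp (-‖x‖ ^ 2) * g x = 0 := by
    set M := ∫ x, |g x * Real.exp (-‖x‖ ^ 2)| with hM
    have hM0 : 0 ≤ M := integral_nonneg fun _ => abs_nonneg _
    have hle : ∀ ε : ℝ, 0 < ε → |∫ x, g x * Real.exp (-‖x‖ ^ 2) * g x| ≤ ε * M := by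
      intro ε hε
      -- One factor `g` is replaced by a polynomial in `e^{-|x|²}`, against which `g` integrates
      -- to zero.
      obtain ⟨P, hP⟩ := exists_polynomial_near_of_continuousOn 0 1 φ hφc ε hε
      have hPi : ∀ x : Rn n, |g x - P.eval (Real.exp (-‖x‖ ^ 2))| ≤ ε := fun x => by
        have := hP _ (hexp x)
        rw [hφx, abs_sub_comm] at this
        exact this.le
      have hi1 : Integrable fun x => g x * Real.exp (-‖x‖ ^ 2) *
          (g x - P.eval (Real.exp (-‖x‖ ^ 2))) :=
        hge.mul_bdd (c := ε) (Continuous.aestronglyMeasurable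
          (hg.sub (P.continuous.comp (by fun_prop)))) (Eventually.of_forall hPi)
      have hi2 : Integrable fun x => g x * Real.exp (-‖x‖ ^ 2) *
          P.eval (Real.exp (-‖x‖ ^ 2)) := by
        refine (hgg.sub hi1).congr (Eventually.of_forall fun x => ?_)
        simp only [Pi.sub_apply]; ring
      have e : ∫ x, g x * Real.exp (-‖x‖ ^ 2) * g x =
          ∫ x, g x * Real.exp (-‖x‖ ^ 2) * (g x - P.eval (Real.exp (-‖x‖ ^ 2))) := by
        have := integral_mul_polynomial_exp_eq_zero hgi h P
        rw [← sub_zero (∫ x, g x * Real.exp (-‖x‖ ^ 2) * g x), ← this, ← integral_sub hgg hi2]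
        congr 1; ext x; ring
      rw [e]
      refine abs_integral_le_integral_abs.trans ?_
      rw [hM, ← integral_const_mul]
      refine integral_mono hi1.abs (hge.abs.const_mul ε) fun x => ?_
      rw [abs_mul, mul_comm]
      gcongr
      exact hPi x
    have hlim : Tendsto (fun ε : ℝ => ε * M) (𝓝[>] 0) (𝓝 0) := by
      have : Tendsto (fun ε : ℝ => ε * M) (𝓝 0) (𝓝 (0 * M)) := tendsto_id.mul_const M
      rw [zero_mul] at this
      exact this.mono_left nhdsWithin_le_nhds
    have := ge_of_tendsto hlim (by
      filter_upwards [self_mem_nhdsWithin] with ε hε using hle ε hε)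
    exact abs_nonpos_iff.1 this
  have hnn : ∀ x, 0 ≤ g x * Real.exp (-‖x‖ ^ 2) * g x := fun x => by
    have e : g x * Real.exp (-‖x‖ ^ 2) * g x = g x ^ 2 * Real.exp (-‖x‖ ^ 2) := by ring
    rw [e]; positivity
  rw [integral_eq_zero_iff_of_nonneg hnn hgg] at hzero
  have hcont : Continuous fun x => g x * Real.exp (-‖x‖ ^ 2) * g x := by fun_prop
  have hall : g x * Real.exp (-‖x‖ ^ 2) * g x = 0 :=
    congrFun ((hcont.ae_eq_iff_eq volume continuous_const).1 hzero) x
  rw [mul_eq_zero, mul_eq_zero] at hall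
  rcases hall with (h1 | h1) | h1
  · exact h1
  · exact absurd h1 (Real.exp_pos _).ne'
  · exact h1

/-- The fractional Laplacian of the test function is, up to a constant, the kernel `T`. -/
lemma exists_dilationKernel_eq {n : ℕ} [NeZero n] {s : ℝ} (hs0 : 0 < s) (hs1 : s < 1) :
    ∃ c : ℝ, ∀ x : Rn n, dilationKernel s x = c * symTrunc s 0 (bump s) x := by
  obtain ⟨c₁, hc₁, h₁⟩ := integral_symTrunc_bump_mul_exp (n := n) hs0 hs1
  obtain ⟨c₂, -, h₂⟩ := integral_dilationKernel_mul_exp (n := n) hs0 hs1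
  have hf := isTestFunction_bump (n := n) hs0 hs1
  obtain ⟨K₁, hK₁, hb₁⟩ := hf.abs_symTrunc_le hs0 hs1
  obtain ⟨K₂, hK₂, hb₂⟩ := abs_dilationKernel_le (n := n) hs0 hs1
  have hcs := hf.continuous_symTrunc hs0 hs1 0
  have hcd := continuous_dilationKernel (n := n) hs0 hs1
  refine ⟨c₂ / c₁, fun x => ?_⟩
  rw [← sub_eq_zero]
  refine eq_zero_of_forall_integral_mul_exp_eq_zero hs0
    (g := fun x => dilationKernel s x - c₂ / c₁ * symTrunc s 0 (bump s) x)
    (K := K₂ + |c₂ / c₁| * K₁) (by fun_prop) (fun x y hxy => ?_) (fun x => ?_) (fun t ht => ?_) x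
  · rw [symTrunc_bump_eq_of_norm_eq s hxy, dilationKernel, dilationKernel, psi_eq_of_norm_eq s hxy,
      meanKernel, meanKernel, hxy]
  · refine (abs_sub _ _).trans ?_
    rw [abs_mul, add_div, mul_div_assoc]
    gcongr
    · exact hb₂ x
    · exact hb₁ 0 x
  · have hexp : ∀ x : Rn n, ‖Real.exp (-(t * ‖x‖ ^ 2))‖ ≤ 1 := fun x => by
      rw [Real.norm_of_nonneg (by positivity)]
      exact Real.exp_le_one_iff.2 (by have : 0 ≤ t * ‖x‖ ^ 2 := by positivity
                                      linarith)
    have hi1 : Integrable fun x : Rn n => dilationKernel s x * Real.exp (-(t * ‖x‖ ^ 2)) :=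
      (integrable_dilationKernel hs0 hs1).mul_bdd (c := 1)
        (Continuous.aestronglyMeasurable (by fun_prop)) (Eventually.of_forall hexp)
    have hi2 : Integrable fun x : Rn n => symTrunc s 0 (bump s) x * Real.exp (-(t * ‖x‖ ^ 2)) :=
      (integrable_of_le_weight hs0 hcs.aestronglyMeasurable (hb₁ 0)).mul_bdd (c := 1)
        (Continuous.aestronglyMeasurable (by fun_prop)) (Eventually.of_forall hexp)
    simp_rw [sub_mul, mul_assoc]
    rw [integral_sub hi1 (hi2.const_mul _), integral_const_mul, h₁ t ht, h₂ t ht]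
    field_simp
    ring

/-! ### Second differences of Hölder functions -/

/-- The mean value inequality for `τ ↦ u(x + τ z) + u(x - τ z)` on `[0, 1]`. -/
lemma abs_secondDiff_le_of_fderiv {n : ℕ} {u : Rn n → ℝ} {S : Set (Rn n)} {M γ : ℝ} (hγ : 0 ≤ γ)
    (hd : ∀ x ∈ S, DifferentiableAt ℝ u x)
    (hM : ∀ x ∈ S, ∀ y ∈ S, ‖fderiv ℝ u x - fderiv ℝ u y‖ ≤ M * ‖x - y‖ ^ γ) (hM0 : 0 ≤ M)
    {x z : Rn n} (hS : ∀ τ ∈ Set.Icc (0:ℝ) 1, x + τ • z ∈ S ∧ x - τ • z ∈ S) :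
    |secondDiff u x z| ≤ M * 2 ^ γ * ‖z‖ ^ (1 + γ) := by
  set k : ℝ → ℝ := fun τ => u (x + τ • z) + u (x - τ • z) with hk
  have hder : ∀ τ ∈ Set.Icc (0:ℝ) 1,
      HasDerivAt k ((fderiv ℝ u (x + τ • z) - fderiv ℝ u (x - τ • z)) z) τ := by
    intro τ hτ
    have hz : HasDerivAt (fun τ : ℝ => τ • z) z τ := by
      simpa using (hasDerivAt_id τ).smul_const z
    have h1 := (hd _ (hS τ hτ).1).hasFDerivAt.comp_hasDerivAt τ (hz.const_add x)
    have h2 := (hd _ (hS τ hτ).2).hasFDerivAt.comp_hasDerivAt τ (hz.const_sub x)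
    refine (h1.add h2).congr_deriv ?_
    simp [sub_eq_add_neg]
  have := Convex.norm_image_sub_le_of_norm_hasDerivWithin_le (s := Set.Icc (0:ℝ) 1) (f := k)
    (C := M * (2 * ‖z‖) ^ γ * ‖z‖) (fun τ hτ => (hder τ hτ).hasDerivWithinAt) (fun τ hτ => ?_)
    (convex_Icc 0 1) (Set.left_mem_Icc.2 zero_le_one) (Set.right_mem_Icc.2 zero_le_one)
  · have e1 : k 1 - k 0 = -secondDiff u x z := by simp [hk, secondDiff]; ring
    rw [e1, norm_neg, sub_zero, norm_one, mul_one, Real.norm_eq_abs,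
      Real.mul_rpow (by norm_num) (norm_nonneg z)] at this
    have e2 : ‖z‖ ^ (1 + γ) = ‖z‖ ^ γ * ‖z‖ := by
      rw [add_comm, Real.rpow_add' (norm_nonneg z) (by positivity), Real.rpow_one]
    rw [e2]
    linarith
  · refine ((fderiv ℝ u (x + τ • z) - fderiv ℝ u (x - τ • z)).le_opNorm z).trans ?_
    gcongr
    refine (hM _ (hS τ hτ).1 _ (hS τ hτ).2).trans ?_
    gcongr
    have e : x + τ • z - (x - τ • z) = (2 * τ) • z := by
      rw [mul_smul, two_smul]; abel
    rw [e, norm_smul, Real.norm_of_nonneg (by linarith [hτ.1])]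
    have := norm_nonneg z
    nlinarith [hτ.2]

/-- Functions of class `C^β` on the unit ball, with `β > 2s` and `s < 1`, have second differences
of order `|z|^{β'}` for some `β' > 2s`, uniformly on smaller balls. -/
lemma HolderSpace.exists_abs_secondDiff_le {n : ℕ} {s β : ℝ} (hs0 : 0 < s) (hs1 : s < 1)
    (hβ : 2 * s < β) {u : Rn n → ℝ} (hu : HolderSpace β (Metric.ball 0 1) u) {r : ℝ}
    (hr : r < 1) : ∃ β' M δ : ℝ, 2 * s < β' ∧ 0 ≤ M ∧ 0 < δ ∧ δ ≤ 1 ∧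
      ∀ x z : Rn n, ‖x‖ ≤ r → ‖z‖ ≤ δ → |secondDiff u x z| ≤ M * ‖z‖ ^ β' := by
  obtain ⟨hcd, hhol⟩ := hu
  set δ := min ((1 - r) / 2) 1 with hδ
  have hδ0 : 0 < δ := lt_min (by linarith) one_pos
  have hδ1 : δ ≤ 1 := min_le_right _ _
  have hδr : r + δ < 1 := by
    have : δ ≤ (1 - r) / 2 := min_le_left _ _
    linarith
  set K' : Set (Rn n) := Metric.closedBall 0 (r + δ) with hK'
  have hK'sub : K' ⊆ Metric.ball 0 1 := Metric.closedBall_subset_ball hδr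
  have hK'c : IsCompact K' := isCompact_closedBall _ _
  have hmem : ∀ x z : Rn n, ‖x‖ ≤ r → ‖z‖ ≤ δ → ∀ τ ∈ Set.Icc (0:ℝ) 1,
      x + τ • z ∈ K' ∧ x - τ • z ∈ K' := by
    intro x z hx hz τ hτ
    have h1 : ‖τ • z‖ ≤ δ := by
      rw [norm_smul, Real.norm_of_nonneg hτ.1]
      have := norm_nonneg z
      nlinarith [hτ.1, hτ.2]
    constructor
    · rw [hK', mem_closedBall_zero_iff]
      exact (norm_add_le _ _).trans (by linarith)
    · rw [hK', mem_closedBall_zero_iff]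
      exact (norm_sub_le _ _).trans (by linarith)
  obtain ⟨M, hM⟩ := hhol K' hK'sub hK'c
  have hfl : (⌊β⌋₊ : ℤ) = ⌊β⌋ := Int.natCast_floor_eq_floor (by linarith)
  have hfract : Int.fract β = β - (⌊β⌋₊ : ℝ) := by
    rw [Int.fract, ← hfl]; simp
  rcases Nat.lt_or_ge ⌊β⌋₊ 1 with hk | hk
  · have hk0 : ⌊β⌋₊ = 0 := by omega
    rw [hk0] at hM hfract
    rw [hfract] at hM
    refine ⟨β, 2 * |M|, δ, hβ, by positivity, hδ0, hδ1, fun x z hx hz => ?_⟩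
    have hdist : ∀ y ∈ K', ∀ w ∈ K', |u y - u w| ≤ |M| * ‖y - w‖ ^ β := by
      intro y hy w hw
      have := hM y hy w hw
      rw [Nat.cast_zero, sub_zero, iteratedFDeriv_zero_eq_comp] at this
      simp only [Function.comp] at this
      rw [← map_sub, LinearIsometryEquiv.norm_map, Real.norm_eq_abs] at this
      exact this.trans (by gcongr; exact le_abs_self M)
    have hx' := (hmem x z hx hz 0 ⟨le_rfl, zero_le_one⟩).1
    obtain ⟨h1, h2⟩ := hmem x z hx hz 1 ⟨zero_le_one, le_rfl⟩
    rw [zero_smul, add_zero] at hx'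
    rw [one_smul] at h1 h2
    have d1 := hdist x hx' _ h1
    have d2 := hdist x hx' _ h2
    rw [sub_add_cancel_left, norm_neg] at d1
    rw [sub_sub_cancel] at d2
    have e : secondDiff u x z = (u x - u (x + z)) + (u x - u (x - z)) := by
      rw [secondDiff]; ring
    rw [e]
    refine (abs_add_le _ _).trans ?_
    linarith
  have hcd1 : ContDiffOn ℝ 1 u (Metric.ball 0 1) := hcd.of_le (by exact_mod_cast hk)
  have hdiff : ∀ x ∈ K', DifferentiableAt ℝ u x := fun x hx =>
    (hcd1.differentiableOn one_ne_zero).differentiableAt (Metric.isOpen_ball.mem_nhds (hK'sub hx))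
  -- If `1 ≤ β < 2`, the Hölder bound for the gradient gives `β' = β`; if `β ≥ 2`, the gradient is
  -- Lipschitz, which gives `β' = 2 > 2s`.
  rcases Nat.lt_or_ge ⌊β⌋₊ 2 with hk2 | hk2
  · have hk1 : ⌊β⌋₊ = 1 := by omega
    rw [hk1] at hM hfract
    have hγ : 0 ≤ Int.fract β := Int.fract_nonneg β
    have hM' : ∀ x ∈ K', ∀ y ∈ K', ‖fderiv ℝ u x - fderiv ℝ u y‖ ≤ |M| * ‖x - y‖ ^ Int.fract β := by
      intro x hx y hy
      have h1 := (hM x hx y hy).trans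
        (mul_le_mul_of_nonneg_right (le_abs_self M) (by positivity))
      refine ContinuousLinearMap.opNorm_le_bound _ (by positivity) fun v => ?_
      have h2 := (iteratedFDeriv ℝ 1 u x - iteratedFDeriv ℝ 1 u y).le_opNorm fun _ => v
      simp only [sub_apply, iteratedFDeriv_one_apply,
        Finset.univ_unique, Finset.prod_singleton] at h2
      rw [sub_apply]
      exact h2.trans (by gcongr)
    refine ⟨1 + Int.fract β, |M| * 2 ^ Int.fract β, δ, ?_, by positivity, hδ0, hδ1,
      fun x z hx hz => ?_⟩
    · rw [hfract]; push_cast; linarith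
    · exact abs_secondDiff_le_of_fderiv hγ hdiff hM' (abs_nonneg M) (hmem x z hx hz)
  · have hcd2 : ContDiffOn ℝ 2 u (Metric.ball 0 1) := hcd.of_le (by exact_mod_cast hk2)
    have hf1 : ContDiffOn ℝ 1 (fderiv ℝ u) (Metric.ball 0 1) :=
      hcd2.fderiv_of_isOpen Metric.isOpen_ball (by norm_num)
    have hf2 : ContinuousOn (fun x => ‖fderiv ℝ (fderiv ℝ u) x‖) (Metric.ball 0 1) :=
      (contDiffOn_zero.1 (hf1.fderiv_of_isOpen Metric.isOpen_ball (by norm_num))).norm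
    obtain ⟨M₂, hM₂'⟩ := hK'c.bddAbove_image (f := fun x => ‖fderiv ℝ (fderiv ℝ u) x‖)
      (hf2.mono hK'sub)
    have hM₂ : ∀ x ∈ K', ‖fderiv ℝ (fderiv ℝ u) x‖ ≤ M₂ := fun x hx => hM₂' ⟨x, hx, rfl⟩
    have hM' : ∀ x ∈ K', ∀ y ∈ K', ‖fderiv ℝ u x - fderiv ℝ u y‖ ≤ |M₂| * ‖x - y‖ ^ (1:ℝ) := by
      intro x hx y hy
      rw [Real.rpow_one]
      refine (Convex.norm_image_sub_le_of_norm_fderiv_le (f := fderiv ℝ u) (fun w hw => ?_) hM₂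
        (convex_closedBall _ _) hy hx).trans (by gcongr; exact le_abs_self _)
      exact (hf1.differentiableOn one_ne_zero).differentiableAt
        (Metric.isOpen_ball.mem_nhds (hK'sub hw))
    refine ⟨1 + 1, |M₂| * 2 ^ (1:ℝ), δ, by linarith, by positivity, hδ0, hδ1, fun x z hx hz => ?_⟩
    exact abs_secondDiff_le_of_fderiv zero_le_one hdiff hM' (abs_nonneg _) (hmem x z hx hz)

lemma HolderSpace.continuousOn {n : ℕ} {β : ℝ} {Ω : Set (Rn n)} {u : Rn n → ℝ}
    (hu : HolderSpace β Ω u) : ContinuousOn u Ω := hu.1.continuousOn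

/-! ### Duality for the truncated operators -/

/-- The integral whose limit as `ε → 0` defines the fractional Laplacian. -/
noncomputable def fracTrunc {n : ℕ} (s ε : ℝ) (u : Rn n → ℝ) (x : Rn n) : ℝ :=
  ∫ y in (Metric.ball x ε)ᶜ, (u x - u y) / ‖x - y‖ ^ ((n : ℝ) + 2 * s)

/-- The kernel `|z|^{-n-2s}` outside the ball of radius `ε`, and `0` inside. -/
noncomputable def truncKernel {n : ℕ} (s ε : ℝ) (z : Rn n) : ℝ :=
  (Metric.ball (0 : Rn n) ε)ᶜ.indicator (fun z => 1 / ‖z‖ ^ ((n : ℝ) + 2 * s)) z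

lemma measurable_truncKernel {n : ℕ} (s ε : ℝ) : Measurable (truncKernel s ε : Rn n → ℝ) :=
  Measurable.indicator (by fun_prop) Metric.isOpen_ball.measurableSet.compl

lemma truncKernel_nonneg {n : ℕ} (s ε : ℝ) (z : Rn n) : 0 ≤ truncKernel s ε z :=
  Set.indicator_nonneg (fun z _ => by positivity) z

lemma truncKernel_neg {n : ℕ} (s ε : ℝ) (z : Rn n) : truncKernel s ε (-z) = truncKernel s ε z := by
  simp [truncKernel, Set.indicator]

lemma truncKernel_le {n : ℕ} [NeZero n] {s : ℝ} (hs0 : 0 < s) (M : ℝ) {ε : ℝ} (hε : 0 < ε) :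
    ∃ K : ℝ, 0 < K ∧ ∀ x y : Rn n, ‖x‖ ≤ M → truncKernel s ε (x - y) ≤ K / weight s y := by
  obtain ⟨K, hK, h⟩ := inv_rpow_dist_le (n := n) hs0 M hε
  refine ⟨K, hK, fun x y hx => ?_⟩
  by_cases hxy : x - y ∈ (Metric.ball (0 : Rn n) ε)ᶜ
  · rw [truncKernel, Set.indicator_of_mem hxy]
    exact h x y hx (by simpa using hxy)
  · rw [truncKernel, Set.indicator_of_notMem hxy]
    have := weight_pos s y
    positivity

lemma fracTrunc_eq_integral {n : ℕ} (s ε : ℝ) (u : Rn n → ℝ) (x : Rn n) :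
    fracTrunc s ε u x = ∫ y, (u x - u y) * truncKernel s ε (x - y) := by
  rw [fracTrunc, ← integral_indicator Metric.isOpen_ball.measurableSet.compl]
  congr 1; ext y
  have : y ∈ (Metric.ball x ε)ᶜ ↔ x - y ∈ (Metric.ball (0 : Rn n) ε)ᶜ := by
    simp [dist_eq_norm, norm_sub_rev]
  by_cases hy : y ∈ (Metric.ball x ε)ᶜ
  · rw [truncKernel, Set.indicator_of_mem hy, Set.indicator_of_mem (this.1 hy), mul_one_div]
  · rw [truncKernel, Set.indicator_of_notMem hy, Set.indicator_of_notMem (fun h => hy (this.2 h)),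
      mul_zero]

lemma symTrunc_eq_integral {n : ℕ} (s ε : ℝ) (φ : Rn n → ℝ) (x : Rn n) :
    symTrunc s ε φ x = ∫ z, secondDiff φ x z * truncKernel s ε z := by
  rw [symTrunc, ← integral_indicator Metric.isOpen_ball.measurableSet.compl]
  congr 1; ext z
  by_cases hz : z ∈ (Metric.ball (0 : Rn n) ε)ᶜ
  · rw [truncKernel, Set.indicator_of_mem hz, Set.indicator_of_mem hz, mul_one_div]
  · rw [truncKernel, Set.indicator_of_notMem hz, Set.indicator_of_notMem hz, mul_zero]

section
variable {n : ℕ} [NeZero n] {s ε : ℝ} {u : Rn n → ℝ}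

lemma LSpace.integrable_truncKernel_mul (hu : LSpace s u) (hs0 : 0 < s) (hε : 0 < ε) (x : Rn n) :
    Integrable fun y => truncKernel s ε (x - y) * u y := by
  obtain ⟨K, hK, h⟩ := truncKernel_le (n := n) hs0 ‖x‖ hε
  refine hu.integrable_kernel_mul (K := K)
    ((measurable_truncKernel s ε).comp (measurable_const.sub measurable_id)).aestronglyMeasurable
    fun y => ?_
  rw [abs_of_nonneg (truncKernel_nonneg s ε _)]
  exact h x y le_rfl

lemma integrable_truncKernel (hs0 : 0 < s) (hε : 0 < ε) :
    Integrable (truncKernel s ε : Rn n → ℝ) := by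
  obtain ⟨K, hK, h⟩ := truncKernel_le (n := n) hs0 0 hε
  refine integrable_of_le_weight hs0 (measurable_truncKernel s ε).aestronglyMeasurable
    (K := K) fun y => ?_
  have := h 0 y (by simp)
  rwa [zero_sub, truncKernel_neg, ← abs_of_nonneg (truncKernel_nonneg s ε y)] at this

/-- For `ε > 0` the two terms of the integrand are integrable separately. -/
lemma LSpace.fracTrunc_eq (hu : LSpace s u) (hs0 : 0 < s) (hε : 0 < ε) (x : Rn n) :
    fracTrunc s ε u x = (∫ z : Rn n, truncKernel s ε z) * u x -
      ∫ y, truncKernel s ε (x - y) * u y := by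
  rw [fracTrunc_eq_integral]
  have h1 : Integrable fun y => u x * truncKernel s ε (x - y) :=
    ((integrable_truncKernel hs0 hε).comp_sub_left x).const_mul _
  have h2 := hu.integrable_truncKernel_mul hs0 hε x
  have e : ∀ y, (u x - u y) * truncKernel s ε (x - y) =
      u x * truncKernel s ε (x - y) - truncKernel s ε (x - y) * u y := fun y => by ring
  simp_rw [e]
  rw [integral_sub h1 h2, integral_const_mul, integral_sub_left_eq_self (truncKernel s ε) volume x,
    mul_comm]

lemma LSpace.symTrunc_eq_two_mul_fracTrunc (hu : LSpace s u) (hs0 : 0 < s) (hε : 0 < ε)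
    (x : Rn n) : symTrunc s ε u x = 2 * fracTrunc s ε u x := by
  have hg : Integrable fun y => (u x - u y) * truncKernel s ε (x - y) := by
    have h1 : Integrable fun y => u x * truncKernel s ε (x - y) :=
      ((integrable_truncKernel hs0 hε).comp_sub_left x).const_mul _
    refine (h1.sub (hu.integrable_truncKernel_mul hs0 hε x)).congr
      (Eventually.of_forall fun y => ?_)
    simp only [Pi.sub_apply]; ring
  have hp : ∫ z, (u x - u (x + z)) * truncKernel s ε z = fracTrunc s ε u x := by
    rw [fracTrunc_eq_integral,
      ← integral_add_left_eq_self (fun y => (u x - u y) * truncKernel s ε (x - y)) x]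
    congr 1; ext z
    rw [sub_add_cancel_left, truncKernel_neg]
  have hm : ∫ z, (u x - u (x - z)) * truncKernel s ε z = fracTrunc s ε u x := by
    rw [fracTrunc_eq_integral,
      ← integral_sub_left_eq_self (fun y => (u x - u y) * truncKernel s ε (x - y)) volume x]
    congr 1; ext z
    rw [sub_sub_cancel]
  have hpi : Integrable fun z => (u x - u (x + z)) * truncKernel s ε z := by
    refine (hg.comp_add_left x).congr (Eventually.of_forall fun z => ?_)
    simp only
    rw [sub_add_cancel_left, truncKernel_neg]
  have hmi : Integrable fun z => (u x - u (x - z)) * truncKernel s ε z := by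
    refine (hg.comp_sub_left x).congr (Eventually.of_forall fun z => ?_)
    simp only
    rw [sub_sub_cancel]
  rw [symTrunc_eq_integral, two_mul]
  nth_rw 1 [← hp]
  rw [← hm, ← integral_add hpi hmi]
  congr 1; ext z
  rw [secondDiff]; ring

end

lemma isTestFunction_lSpace {n : ℕ} [NeZero n] {s B : ℝ} {φ : Rn n → ℝ} (hs0 : 0 < s)
    (hφ : IsTestFunction s B φ) : LSpace s φ := by
  refine ⟨hφ.continuous.locallyIntegrable, ?_⟩
  refine integrable_of_continuous_of_eq_zero (r := 1) ?_ fun x hx => by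
    rw [hφ.eq_zero x hx]; simp
  exact hφ.continuous.abs.div (continuous_weight hs0) fun x => (weight_pos s x).ne'

/-- The truncated operators are symmetric. -/
lemma IsTestFunction.integral_mul_fracTrunc {n : ℕ} [NeZero n] {s B ε : ℝ} {φ u : Rn n → ℝ}
    (hφ : IsTestFunction s B φ) (hu : LSpace s u) (hs0 : 0 < s) (hε : 0 < ε) :
    Integrable (fun x => φ x * fracTrunc s ε u x) ∧
    ∫ x, φ x * fracTrunc s ε u x = ∫ y, fracTrunc s ε φ y * u y := by
  obtain ⟨K, hK, h⟩ := truncKernel_le (n := n) hs0 1 hε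
  have hφL := isTestFunction_lSpace hs0 hφ
  have hφi : Integrable φ := integrable_of_continuous_of_eq_zero hφ.continuous hφ.eq_zero
  set m := ∫ z : Rn n, truncKernel s ε z with hm
  have hprod : Integrable (Function.uncurry fun x y : Rn n =>
      φ x * (truncKernel s ε (x - y) * u y)) (volume.prod volume) := by
    refine ((hφi.abs).mul_prod (hu.integrable.const_mul K)).mono' ?_ ?_
    · have h1 : AEStronglyMeasurable (fun p : Rn n × Rn n => φ p.1) (volume.prod volume) :=
        (hφ.continuous.comp continuous_fst).aestronglyMeasurable
      have h2 : AEStronglyMeasurable (fun p : Rn n × Rn n => truncKernel s ε (p.1 - p.2))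
          (volume.prod volume) :=
        ((measurable_truncKernel s ε).comp (measurable_fst.sub measurable_snd)).aestronglyMeasurable
      have h3 : AEStronglyMeasurable (fun p : Rn n × Rn n => u p.2) (volume.prod volume) :=
        hu.aestronglyMeasurable.comp_snd
      exact h1.mul (h2.mul h3)
    · refine Eventually.of_forall fun ⟨x, y⟩ => ?_
      simp only [Function.uncurry]
      rw [norm_mul, norm_mul, Real.norm_eq_abs, Real.norm_eq_abs, Real.norm_eq_abs]
      rcases le_or_gt 1 ‖x‖ with hx | hx
      · rw [hφ.eq_zero x hx]; simp
      · rw [abs_of_nonneg (truncKernel_nonneg s ε _)]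
        refine mul_le_mul_of_nonneg_left ?_ (abs_nonneg _)
        calc truncKernel s ε (x - y) * |u y| ≤ K / weight s y * |u y| := by
              gcongr; exact h x y hx.le
          _ = _ := by ring
  have hφu : Integrable fun x => φ x * u x := by
    have := hu.integrable_kernel_mul (k := φ) hφ.continuous.aestronglyMeasurable
      (K := sSup ((fun x => |φ x| * weight s x) '' Metric.closedBall 0 1)) ?_
    · exact this
    · intro y
      rw [le_div_iff₀ (weight_pos s y)]
      have hc : Continuous fun x => |φ x| * weight s x :=
        hφ.continuous.abs.mul (continuous_weight hs0)
      have hbdd := (isCompact_closedBall (0 : Rn n) 1).bddAbove_image hc.continuousOn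
      have h0 : 0 ≤ sSup ((fun x => |φ x| * weight s x) '' Metric.closedBall 0 1) := by
        refine Real.sSup_nonneg ?_
        rintro _ ⟨x, -, rfl⟩
        exact mul_nonneg (abs_nonneg _) (weight_pos s x).le
      rcases le_or_gt 1 ‖y‖ with hy | hy
      · rw [hφ.eq_zero y hy, abs_zero, zero_mul]; exact h0
      · exact le_csSup hbdd ⟨y, mem_closedBall_zero_iff.2 hy.le, rfl⟩
  have hl : ∀ x, φ x * fracTrunc s ε u x = m * (φ x * u x) -
      ∫ y, φ x * (truncKernel s ε (x - y) * u y) := fun x => by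
    rw [hu.fracTrunc_eq hs0 hε, integral_const_mul]; ring
  have hr : ∀ y, fracTrunc s ε φ y * u y = m * (φ y * u y) -
      ∫ x, φ x * (truncKernel s ε (x - y) * u y) := fun y => by
    have e : ∫ x, φ x * (truncKernel s ε (x - y) * u y) =
        (∫ x, truncKernel s ε (y - x) * φ x) * u y := by
      rw [← integral_mul_const]
      congr 1; ext x
      rw [← neg_sub x y, truncKernel_neg]; ring
    rw [hφL.fracTrunc_eq hs0 hε, e]; ring
  have hleft : Integrable fun x => ∫ y, φ x * (truncKernel s ε (x - y) * u y) :=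
    hprod.integral_prod_left
  have hright : Integrable fun y => ∫ x, φ x * (truncKernel s ε (x - y) * u y) :=
    hprod.integral_prod_right
  constructor
  · simp_rw [hl]
    exact (hφu.const_mul m).sub hleft
  · simp_rw [hl, hr]
    rw [integral_sub (hφu.const_mul m) hleft, integral_sub (hφu.const_mul m) hright,
      integral_integral_swap hprod]

/-- The truncated integrals of a function of class `C^β`, `β > 2s`, are bounded on smaller balls,
uniformly in the truncation. -/
lemma exists_abs_fracTrunc_le {n : ℕ} [NeZero n] {s β : ℝ} (hs0 : 0 < s) (hs1 : s < 1)
    (hβ : 2 * s < β) {u : Rn n → ℝ} (hu : HolderSpace β (Metric.ball 0 1) u) (hL : LSpace s u)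
    {r : ℝ} (hr : r < 1) :
    ∃ C : ℝ, ∀ x : Rn n, ‖x‖ ≤ r → ∀ ε, 0 < ε → |fracTrunc s ε u x| ≤ C := by
  obtain ⟨β', M, δ, hβ', hM, hδ, hδ1, hbd⟩ := hu.exists_abs_secondDiff_le hs0 hs1 hβ hr
  set p := (n : ℝ) + 2 * s with hp
  obtain ⟨U, hU⟩ := (isCompact_closedBall (0 : Rn n) r).exists_bound_of_continuousOn
    (hu.continuousOn.mono (Metric.closedBall_subset_ball hr))
  obtain ⟨K, hK, hKb⟩ := inv_rpow_dist_le (n := n) hs0 r hδ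
  set A := (M + 2 * |U|) * (1 + (δ ^ β')⁻¹) with hA
  have hβ0 : 0 < β' := by linarith
  have hA0 : 0 ≤ A := by positivity
  set w : Rn n → ℝ := fun z => min 1 (‖z‖ ^ β') / ‖z‖ ^ p with hw
  have hwi : Integrable w := integrable_min_rpow_div hs0 hβ'
  set v : Rn n → ℝ := fun y => |u y| / weight s y with hv
  have hw0 : ∀ z, 0 ≤ w z := fun z =>
    div_nonneg (le_min zero_le_one (by positivity)) (by positivity)
  have hv0 : ∀ y, 0 ≤ v y := fun y => div_nonneg (abs_nonneg _) (weight_pos s y).le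
  -- For `|z| < δ` the second difference is controlled by the regularity of `u`, for `|z| ≥ δ` each
  -- value of `u` separately.
  have hpt : ∀ x z : Rn n, ‖x‖ ≤ r → |secondDiff u x z / ‖z‖ ^ p| ≤
      A * w z + K * (v (x + z) + v (x - z)) := by
    intro x z hx
    have hzp : 0 ≤ ‖z‖ ^ p := by positivity
    have hUx : |u x| ≤ |U| := (hU x (mem_closedBall_zero_iff.2 hx)).trans (le_abs_self U)
    rw [abs_div, abs_of_nonneg hzp]
    rcases le_or_gt δ ‖z‖ with hz | hz
    · have hz0 : 0 < ‖z‖ := hδ.trans_le hz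
      have h1 : |secondDiff u x z| ≤ 2 * |u x| + |u (x + z)| + |u (x - z)| := by
        rw [secondDiff]
        refine (abs_sub _ _).trans ?_
        gcongr
        refine (abs_sub _ _).trans ?_
        rw [abs_mul, abs_two]
      have h2 : 1 / ‖z‖ ^ p ≤ (1 + (δ ^ β')⁻¹) * w z := by
        simp only [hw]
        rw [← mul_div_assoc]
        gcongr
        have h3 : δ ^ β' ≤ ‖z‖ ^ β' := by gcongr
        have h5 : 0 < δ ^ β' := by positivity
        rcases le_total 1 (‖z‖ ^ β') with h4 | h4
        · rw [min_eq_left h4]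
          have : 0 < (δ ^ β')⁻¹ := by positivity
          linarith
        · rw [min_eq_right h4]
          have : 1 ≤ (δ ^ β')⁻¹ * ‖z‖ ^ β' := by
            rw [inv_mul_eq_div, le_div_iff₀ h5]; linarith
          have h6 : 0 ≤ ‖z‖ ^ β' := by positivity
          linarith
      have h3 : |u (x + z)| * (1 / ‖z‖ ^ p) ≤ K * v (x + z) := by
        have := hKb x (x + z) hx (by rwa [sub_add_cancel_left, norm_neg])
        rw [sub_add_cancel_left, norm_neg] at this
        calc |u (x + z)| * (1 / ‖z‖ ^ p) ≤ |u (x + z)| * (K / weight s (x + z)) := by gcongr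
          _ = _ := by simp only [hv]; ring
      have h4 : |u (x - z)| * (1 / ‖z‖ ^ p) ≤ K * v (x - z) := by
        have := hKb x (x - z) hx (by rwa [sub_sub_cancel])
        rw [sub_sub_cancel] at this
        calc |u (x - z)| * (1 / ‖z‖ ^ p) ≤ |u (x - z)| * (K / weight s (x - z)) := by gcongr
          _ = _ := by simp only [hv]; ring
      have h5 : 2 * |u x| * (1 / ‖z‖ ^ p) ≤ A * w z := by
        calc 2 * |u x| * (1 / ‖z‖ ^ p) ≤ 2 * |U| * ((1 + (δ ^ β')⁻¹) * w z) := by gcongr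
          _ ≤ (M + 2 * |U|) * ((1 + (δ ^ β')⁻¹) * w z) := by
            have := hw0 z
            gcongr
            linarith
          _ = _ := by rw [hA]; ring
      rw [div_eq_mul_one_div]
      calc |secondDiff u x z| * (1 / ‖z‖ ^ p)
          ≤ (2 * |u x| + |u (x + z)| + |u (x - z)|) * (1 / ‖z‖ ^ p) := by gcongr
        _ = 2 * |u x| * (1 / ‖z‖ ^ p) + |u (x + z)| * (1 / ‖z‖ ^ p) +
            |u (x - z)| * (1 / ‖z‖ ^ p) := by ring
        _ ≤ _ := by linarith
    · have h1 := hbd x z hx hz.le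
      have hmin : min 1 (‖z‖ ^ β') = ‖z‖ ^ β' :=
        min_eq_right (Real.rpow_le_one (norm_nonneg z) (hz.le.trans hδ1) hβ0.le)
      have hMA : M ≤ A := by
        have : 0 ≤ (M + 2 * |U|) * (δ ^ β')⁻¹ := by positivity
        rw [hA, mul_add, mul_one]
        linarith [abs_nonneg U]
      have h2 : |secondDiff u x z| / ‖z‖ ^ p ≤ A * w z := by
        simp only [hw]
        rw [hmin, ← mul_div_assoc]
        gcongr
        exact h1.trans (by gcongr)
      have h4 : 0 ≤ K * (v (x + z) + v (x - z)) :=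
        mul_nonneg hK.le (add_nonneg (hv0 _) (hv0 _))
      linarith
  refine ⟨(A * (∫ z, w z) + K * ((∫ y, v y) + ∫ y, v y)) / 2, fun x hx ε hε => ?_⟩
  have hvi : Integrable v := hL.integrable
  have hi1 : Integrable fun z => v (x + z) := hvi.comp_add_left x
  have hi2 : Integrable fun z => v (x - z) := hvi.comp_sub_left x
  have hi3 : Integrable fun z => v (x + z) + v (x - z) := hi1.add hi2
  have hi : Integrable fun z => A * w z + K * (v (x + z) + v (x - z)) :=
    (hwi.const_mul A).add (hi3.const_mul K)
  have hnn : ∀ z, 0 ≤ A * w z + K * (v (x + z) + v (x - z)) := fun z =>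
    add_nonneg (mul_nonneg hA0 (hw0 z)) (mul_nonneg hK.le (add_nonneg (hv0 _) (hv0 _)))
  have hsym : |symTrunc s ε u x| ≤ A * (∫ z, w z) + K * ((∫ y, v y) + ∫ y, v y) := by
    calc |symTrunc s ε u x|
        ≤ ∫ z in (Metric.ball (0 : Rn n) ε)ᶜ, (A * w z + K * (v (x + z) + v (x - z))) :=
          by
            rw [symTrunc, ← Real.norm_eq_abs]
            exact norm_integral_le_of_norm_le hi.integrableOn
              (Eventually.of_forall fun z => hpt x z hx)
      _ ≤ ∫ z, (A * w z + K * (v (x + z) + v (x - z))) :=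
          setIntegral_le_integral hi (Eventually.of_forall hnn)
      _ = _ := by
        rw [integral_add (hwi.const_mul A) (hi3.const_mul K), integral_const_mul,
          integral_const_mul, integral_add hi1 hi2, integral_add_left_eq_self v x,
          integral_sub_left_eq_self v volume x]
  rw [hL.symTrunc_eq_two_mul_fracTrunc hs0 hε, abs_mul, abs_two] at hsym
  linarith

lemma cConst_pos (n : ℕ) [NeZero n] {s : ℝ} (hs0 : 0 < s) (hs1 : s < 1) : 0 < cConst n s := by
  have h1 := exponent_pos n hs0
  have h2 := Real.Gamma_pos_of_pos (s := ((n : ℝ) + 2 * s) / 2) (by positivity)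
  have h3 := Real.Gamma_pos_of_pos (s := 1 - s) (by linarith)
  unfold cConst
  positivity

lemma HasFracLaplacianAt.tendsto_fracTrunc {n : ℕ} [NeZero n] {s : ℝ} (hs0 : 0 < s) (hs1 : s < 1)
    {u : Rn n → ℝ} {x : Rn n} (h : HasFracLaplacianAt s u x 0) :
    Tendsto (fun ε => fracTrunc s ε u x) (𝓝[>] 0) (𝓝 0) := by
  have h1 := Tendsto.const_mul (cConst n s)⁻¹ h
  rw [mul_zero] at h1
  refine h1.congr fun ε => ?_
  rw [inv_mul_cancel_left₀ (cConst_pos n hs0 hs1).ne']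
  rfl

/-- An `s`-harmonic function is orthogonal to the fractional Laplacian of every test function
supported in a smaller ball. -/
lemma IsTestFunction.integral_symTrunc_mul_eq_zero {n : ℕ} [NeZero n] {s β B r : ℝ}
    {φ u : Rn n → ℝ} (hφ : IsTestFunction s B φ) (hr : r < 1) (hφr : ∀ x, r ≤ ‖x‖ → φ x = 0)
    (hs0 : 0 < s) (hs1 : s < 1) (hβ : 2 * s < β) (hu : HolderSpace β (Metric.ball 0 1) u)
    (hL : LSpace s u) (hharm : SHarmonicIn s (Metric.ball 0 1) u) :
    ∫ y, symTrunc s 0 φ y * u y = 0 := by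
  obtain ⟨C, hC⟩ := exists_abs_fracTrunc_le hs0 hs1 hβ hu hL hr
  have hφi : Integrable φ := integrable_of_continuous_of_eq_zero hφ.continuous hφ.eq_zero
  have hφL := isTestFunction_lSpace hs0 hφ
  have hpos : ∀ᶠ ε : ℝ in 𝓝[>] 0, 0 < ε := self_mem_nhdsWithin
  -- The truncated integrals of `u` tend to zero boundedly on the support of `φ`; on the other side
  -- of the duality the truncation is removed by the decay of the operator applied to `φ`.
  have hleft : Tendsto (fun ε => ∫ x, φ x * fracTrunc s ε u x) (𝓝[>] 0) (𝓝 0) := by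
    suffices Tendsto (fun ε => ∫ x, φ x * fracTrunc s ε u x) (𝓝[>] 0)
        (𝓝 (∫ x : Rn n, (0:ℝ))) by simpa using this
    refine tendsto_integral_filter_of_dominated_convergence (fun x => |φ x| * C) ?_ ?_
      (hφi.abs.mul_const C) (Eventually.of_forall fun x => ?_)
    · filter_upwards [hpos] with ε hε
      exact (hφ.integral_mul_fracTrunc hL hs0 hε).1.aestronglyMeasurable
    · filter_upwards [hpos] with ε hε
      refine Eventually.of_forall fun x => ?_
      rw [norm_mul, Real.norm_eq_abs, Real.norm_eq_abs]
      rcases le_or_gt r ‖x‖ with hx | hx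
      · rw [hφr x hx]; simp
      · exact mul_le_mul_of_nonneg_left (hC x hx.le ε hε) (abs_nonneg _)
    · rcases le_or_gt r ‖x‖ with hx | hx
      · simp only [hφr x hx, zero_mul]; exact tendsto_const_nhds
      · have h := (hharm x (mem_ball_zero_iff.2 (hx.trans hr))).tendsto_fracTrunc hs0 hs1
        have := h.const_mul (φ x)
        rwa [mul_zero] at this
  obtain ⟨K, hK, hKb⟩ := hφ.abs_symTrunc_le hs0 hs1
  have hright : Tendsto (fun ε => ∫ y, symTrunc s ε φ y * u y) (𝓝[>] 0)
      (𝓝 (∫ y, symTrunc s 0 φ y * u y)) := by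
    refine tendsto_integral_filter_of_dominated_convergence (fun y => K * (|u y| / weight s y))
      ?_ ?_ (hL.integrable.const_mul K) (Eventually.of_forall fun y => ?_)
    · exact Eventually.of_forall fun ε =>
        (hφ.continuous_symTrunc hs0 hs1 ε).aestronglyMeasurable.mul hL.aestronglyMeasurable
    · refine Eventually.of_forall fun ε => Eventually.of_forall fun y => ?_
      rw [norm_mul, Real.norm_eq_abs, Real.norm_eq_abs]
      calc |symTrunc s ε φ y| * |u y| ≤ K / weight s y * |u y| := by gcongr; exact hKb ε y
        _ = _ := by ring
    · exact (hφ.tendsto_symTrunc hs0 hs1 y).mul_const (u y)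
  have heq : ∀ᶠ ε : ℝ in 𝓝[>] 0, 2 * ∫ x, φ x * fracTrunc s ε u x =
      ∫ y, symTrunc s ε φ y * u y := by
    filter_upwards [hpos] with ε hε
    rw [(hφ.integral_mul_fracTrunc hL hs0 hε).2, ← integral_const_mul]
    congr 1; ext y
    rw [hφL.symTrunc_eq_two_mul_fracTrunc hs0 hε]; ring
  have h2 := (hleft.const_mul 2).congr' heq
  rw [mul_zero] at h2
  exact tendsto_nhds_unique hright h2

/-! ### The mean value formula -/

lemma secondDiff_comp_affine {n : ℕ} (φ : Rn n → ℝ) (x₀ x z : Rn n) (ρ : ℝ) :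
    secondDiff (fun y => φ (ρ • (y - x₀))) x z = secondDiff φ (ρ • (x - x₀)) (ρ • z) := by
  have h1 : ρ • (x + z - x₀) = ρ • (x - x₀) + ρ • z := by rw [← smul_add]; congr 1; abel
  have h2 : ρ • (x - z - x₀) = ρ • (x - x₀) - ρ • z := by rw [← smul_sub]; congr 1; abel
  simp only [secondDiff, h1, h2]

/-- The condition on `ρ` keeps the support inside the closed unit ball. -/
lemma IsTestFunction.comp_affine {n : ℕ} {s B ρ : ℝ} {φ : Rn n → ℝ} {x₀ : Rn n}
    (hφ : IsTestFunction s B φ) (hB : 0 ≤ B) (hs0 : 0 < s) (hρ : 0 < ρ) (h : ‖x₀‖ + ρ⁻¹ ≤ 1) :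
    IsTestFunction s (B * ρ ^ (1 + s)) fun y => φ (ρ • (y - x₀)) where
  continuous := hφ.continuous.comp (by fun_prop)
  eq_zero y hy := by
    refine hφ.eq_zero _ ?_
    have h1 := norm_sub_norm_le y x₀
    rw [norm_smul, Real.norm_of_nonneg hρ.le, ← inv_le_iff_one_le_mul₀' hρ]
    linarith
  abs_secondDiff_le x z := by
    have hρ1 : 1 ≤ ρ := by
      have h2 : ρ⁻¹ ≤ 1 := by linarith [norm_nonneg x₀]
      exact (inv_le_one₀ hρ).1 h2
    rw [secondDiff_comp_affine, mul_assoc]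
    refine (hφ.abs_secondDiff_le _ _).trans (mul_le_mul_of_nonneg_left ?_ hB)
    rw [norm_smul, Real.norm_of_nonneg hρ.le, Real.mul_rpow hρ.le (norm_nonneg z),
      mul_min_of_nonneg _ _ (by positivity), mul_one]
    exact min_le_min_right _ (Real.one_le_rpow hρ1 (by linarith))

lemma symTrunc_comp_affine {n : ℕ} {s ρ : ℝ} (φ : Rn n → ℝ) (x₀ x : Rn n) (hρ : 0 < ρ) :
    symTrunc s 0 (fun y => φ (ρ • (y - x₀))) x =
      (ρ ^ n)⁻¹ * ρ ^ ((n : ℝ) + 2 * s) * symTrunc s 0 φ (ρ • (x - x₀)) := by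
  have h := Measure.integral_comp_smul_of_nonneg (volume : Measure (Rn n))
    (fun w => secondDiff φ (ρ • (x - x₀)) w / ‖w‖ ^ ((n : ℝ) + 2 * s)) ρ (hR := hρ.le)
  rw [finrank_euclideanSpace_fin, smul_eq_mul] at h
  rw [symTrunc_zero, symTrunc_zero, mul_right_comm, ← h, ← integral_mul_const]
  congr 1; ext z
  rw [secondDiff_comp_affine, norm_smul, Real.norm_of_nonneg hρ.le,
    Real.mul_rpow hρ.le (norm_nonneg z)]
  have : ρ ^ ((n : ℝ) + 2 * s) ≠ 0 := (Real.rpow_pos_of_pos hρ _).ne'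
  rw [mul_comm (ρ ^ _), div_mul_eq_mul_div, mul_div_mul_right _ _ this]

lemma integral_dilationKernel_mul_eq_zero {n : ℕ} [NeZero n] {s β ρ : ℝ} {u : Rn n → ℝ}
    {x₀ : Rn n} (hs0 : 0 < s) (hs1 : s < 1) (hβ : 2 * s < β)
    (hu : HolderSpace β (Metric.ball 0 1) u) (hL : LSpace s u)
    (hharm : SHarmonicIn s (Metric.ball 0 1) u) (hρ : 0 < ρ) (h : ‖x₀‖ + ρ⁻¹ < 1) :
    ∫ y, dilationKernel s (ρ • (y - x₀)) * u y = 0 := by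
  obtain ⟨c, hc⟩ := exists_dilationKernel_eq (n := n) hs0 hs1
  have hφ := (isTestFunction_bump (n := n) hs0 hs1).comp_affine (by norm_num) hs0 hρ h.le
  have h0 := hφ.integral_symTrunc_mul_eq_zero h (fun x hx => ?_) hs0 hs1 hβ hu hL hharm
  · have hne : (ρ ^ n)⁻¹ * ρ ^ ((n : ℝ) + 2 * s) ≠ 0 := by positivity
    simp only [symTrunc_comp_affine _ _ _ hρ, mul_assoc, integral_const_mul] at h0
    simp only [hc, mul_assoc, integral_const_mul]
    rw [← mul_assoc] at h0
    rw [(mul_eq_zero.1 h0).resolve_left hne, mul_zero]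
  · refine bump_eq_zero hs0 ?_
    have h1 := norm_sub_norm_le x x₀
    rw [norm_smul, Real.norm_of_nonneg hρ.le, ← inv_le_iff_one_le_mul₀' hρ]
    linarith

/-- The form of `weight_le_weight_affine` used to dominate the kernels `k(ρ (y - x))`. -/
lemma weight_inv_le_of_le {n : ℕ} [NeZero n] {s : ℝ} (hs : 0 < s) (M : ℝ) {ρ₀ : ℝ} (hρ₀ : 0 < ρ₀) :
    ∃ K : ℝ, 0 < K ∧ ∀ x y : Rn n, ‖x‖ ≤ M → ∀ ρ, ρ₀ ≤ ρ →
      1 / weight s (ρ • (y - x)) ≤ K / weight s y := by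
  obtain ⟨K, hK, h⟩ := weight_le_weight_affine (n := n) hs M ρ₀⁻¹
  refine ⟨K, hK, fun x y hx ρ hρ => ?_⟩
  have hρ0 : 0 < ρ := hρ₀.trans_le hρ
  have h1 := h x y hx ρ⁻¹ (inv_pos.2 hρ0) (inv_anti₀ hρ₀ hρ)
  rw [inv_inv] at h1
  rwa [div_le_div_iff₀ (weight_pos s _) (weight_pos s y), one_mul]

lemma hasDerivAt_rho_meanKernel {n : ℕ} [NeZero n] {s : ℝ} (hs0 : 0 < s) (hs1 : s < 1)
    (w : Rn n) (ρ : ℝ) :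
    HasDerivAt (fun ρ : ℝ => ρ ^ n * meanKernel s (ρ • w))
      (ρ ^ (n - 1) * dilationKernel s (ρ • w)) ρ := by
  have hq : ∀ ρ : ℝ, ‖ρ • w‖ ^ 2 = ρ ^ 2 * ‖w‖ ^ 2 := fun ρ => by
    rw [norm_smul, mul_pow, Real.norm_eq_abs, sq_abs]
  have h1 := hasDerivAt_meanProfile hs0 hs1 (ρ • w)
  rw [hq] at h1
  have h2 := h1.comp ρ ((hasDerivAt_pow 2 ρ).mul_const (‖w‖ ^ 2))
  have h3 := (hasDerivAt_pow n ρ).mul h2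
  have e : ∀ ρ : ℝ, ρ ^ n * meanKernel s (ρ • w) =
      ρ ^ n * (psiConst n s / 4 * kernelProfile n s (ρ ^ 2 * ‖w‖ ^ 2)) := fun ρ => by
    rw [meanKernel, hq]
  refine (h3.congr_of_eventuallyEq (Eventually.of_forall e)).congr_deriv ?_
  have hn : ρ ^ n = ρ ^ (n - 1) * ρ := (pow_sub_one_mul (NeZero.ne n) ρ).symm
  simp only [Function.comp, Nat.cast_ofNat, Nat.add_one_sub_one, pow_one]
  rw [dilationKernel, meanKernel, hq, hn]
  ring

lemma LSpace.integrable_rho_meanKernel_mul {n : ℕ} [NeZero n] {s ρ : ℝ} {u : Rn n → ℝ}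
    (hL : LSpace s u) (hs0 : 0 < s) (hs1 : s < 1) (x : Rn n) (hρ : 0 < ρ) :
    Integrable fun y => ρ ^ n * meanKernel s (ρ • (y - x)) * u y := by
  obtain ⟨K₀, hK₀, h₀⟩ := weight_inv_le_of_le (n := n) hs0 ‖x‖ hρ
  obtain ⟨K₁, hK₁, h₁⟩ := meanKernel_le (n := n) hs0 hs1
  refine hL.integrable_kernel_mul (K := ρ ^ n * (K₁ * K₀)) (continuous_const.mul
    ((continuous_meanKernel hs0 hs1).comp (by fun_prop))).aestronglyMeasurable fun y => ?_
  rw [abs_of_nonneg (mul_nonneg (by positivity) (meanKernel_nonneg hs0 hs1 _)), mul_div_assoc]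
  refine mul_le_mul_of_nonneg_left ((h₁ _).trans ?_) (by positivity)
  rw [div_eq_mul_one_div, mul_div_assoc]
  exact mul_le_mul_of_nonneg_left (h₀ x y le_rfl ρ le_rfl) hK₁.le

lemma hasDerivAt_integral_rho_meanKernel {n : ℕ} [NeZero n] {s ρ : ℝ} {u : Rn n → ℝ}
    (hs0 : 0 < s) (hs1 : s < 1) (hL : LSpace s u) (x : Rn n) (hρ : 0 < ρ) :
    HasDerivAt (fun ρ : ℝ => ∫ y, ρ ^ n * meanKernel s (ρ • (y - x)) * u y)
      (∫ y, ρ ^ (n - 1) * dilationKernel s (ρ • (y - x)) * u y) ρ := by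
  obtain ⟨K₀, hK₀, h₀⟩ := weight_inv_le_of_le (n := n) hs0 ‖x‖ (half_pos hρ)
  obtain ⟨K₂, hK₂, h₂⟩ := abs_dilationKernel_le (n := n) hs0 hs1
  have hmeas : ∀ ρ : ℝ, Continuous fun y : Rn n => ρ ^ n * meanKernel s (ρ • (y - x)) := fun ρ =>
    continuous_const.mul ((continuous_meanKernel hs0 hs1).comp (by fun_prop))
  have hmeas' : Continuous fun y : Rn n => ρ ^ (n - 1) * dilationKernel s (ρ • (y - x)) :=
    continuous_const.mul ((continuous_dilationKernel hs0 hs1).comp (by fun_prop))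
  refine (hasDerivAt_integral_of_dominated_loc_of_deriv_le (s := Set.Ioo (ρ / 2) (2 * ρ))
    (bound := fun y => (2 * ρ) ^ (n - 1) * (K₂ * K₀) * (|u y| / weight s y))
    (F' := fun ρ y => ρ ^ (n - 1) * dilationKernel s (ρ • (y - x)) * u y)
    (Ioo_mem_nhds (by linarith) (by linarith))
    (Eventually.of_forall fun ρ => (hmeas ρ).aestronglyMeasurable.mul hL.aestronglyMeasurable)
    (hL.integrable_rho_meanKernel_mul hs0 hs1 x hρ)
    (hmeas'.aestronglyMeasurable.mul hL.aestronglyMeasurable)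
    (Eventually.of_forall fun y r hr => ?_) (hL.integrable.const_mul _)
    (Eventually.of_forall fun y r hr =>
      (hasDerivAt_rho_meanKernel hs0 hs1 (y - x) r).mul_const (u y))).2
  have hr0 : 0 < r := (half_pos hρ).trans hr.1
  rw [norm_mul, norm_mul, Real.norm_of_nonneg (by positivity : 0 ≤ r ^ (n - 1)),
    Real.norm_eq_abs, Real.norm_eq_abs]
  have h3 : |dilationKernel s (r • (y - x))| ≤ K₂ * (K₀ / weight s y) := by
    refine (h₂ _).trans ?_
    rw [div_eq_mul_one_div]
    exact mul_le_mul_of_nonneg_left (h₀ x y le_rfl r hr.1.le) hK₂.le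
  have h4 := weight_pos s y
  calc r ^ (n - 1) * |dilationKernel s (r • (y - x))| * |u y|
      ≤ (2 * ρ) ^ (n - 1) * (K₂ * (K₀ / weight s y)) * |u y| := by
        gcongr
        exact hr.2.le
    _ = _ := by ring

/-- The kernels `ρⁿ H(ρ ·)` form an approximate identity, also on functions that are only
integrable against the weight `1 / (1 + |y|^{n+2s})`. -/
lemma tendsto_integral_rho_meanKernel {n : ℕ} [NeZero n] {s : ℝ} {u : Rn n → ℝ}
    (hs0 : 0 < s) (hs1 : s < 1) (hL : LSpace s u) {x : Rn n} (hx : ContinuousAt u x) :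
    Tendsto (fun ρ : ℝ => ∫ y, ρ ^ n * meanKernel s (ρ • (y - x)) * u y) atTop (𝓝 (u x)) := by
  obtain ⟨K₁, hK₁, h₁⟩ := meanKernel_le (n := n) hs0 hs1
  obtain ⟨K₀, hK₀, h₀⟩ := inv_rpow_dist_le (n := n) hs0 ‖x‖ one_pos
  set p := (n : ℝ) + 2 * s with hp
  have hp0 : 0 < p := exponent_pos n hs0
  set v := (Metric.closedBall x 1).indicator u with hv
  have hball : MeasurableSet (Metric.closedBall x 1) := measurableSet_closedBall
  have hvi : Integrable v :=
    (hL.1.integrableOn_isCompact (isCompact_closedBall x 1)).integrable_indicator hball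
  have hvx : ContinuousAt v x := by
    refine hx.congr ?_
    filter_upwards [Metric.closedBall_mem_nhds x one_pos] with y hy
    rw [hv, Set.indicator_of_mem hy]
  have hle : ∀ z : Rn n, z ≠ 0 → meanKernel s z ≤ K₁ / ‖z‖ ^ p := fun z hz => by
    have hz' : 0 < ‖z‖ := norm_pos_iff.2 hz
    refine (h₁ z).trans ?_
    gcongr
    exact rpow_le_weight s z
  have hdecay : Tendsto (fun z : Rn n => ‖z‖ ^ Module.finrank ℝ (Rn n) * meanKernel s z)
      (Bornology.cobounded (Rn n)) (𝓝 0) := by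
    have hlim : Tendsto (fun z : Rn n => K₁ * ‖z‖ ^ (-(2 * s))) (Bornology.cobounded (Rn n))
        (𝓝 (K₁ * 0)) :=
      ((tendsto_rpow_neg_atTop (by positivity)).comp tendsto_norm_cobounded_atTop).const_mul K₁
    rw [mul_zero] at hlim
    refine squeeze_zero' (Eventually.of_forall fun z =>
      mul_nonneg (by positivity) (meanKernel_nonneg hs0 hs1 z)) ?_ hlim
    filter_upwards [tendsto_norm_cobounded_atTop.eventually (eventually_gt_atTop 0)] with z hz
    rw [finrank_euclideanSpace_fin]
    calc ‖z‖ ^ n * meanKernel s z ≤ ‖z‖ ^ n * (K₁ / ‖z‖ ^ p) := by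
          gcongr; exact hle z (norm_pos_iff.1 hz)
      _ = _ := by
        rw [hp, Real.rpow_add hz, Real.rpow_natCast, Real.rpow_neg hz.le]
        field_simp
  have hnear := tendsto_integral_comp_smul_smul_of_integrable' (μ := volume)
    (meanKernel_nonneg (n := n) hs0 hs1) (integral_meanKernel hs0 hs1) hdecay hvi hvx
  simp only [finrank_euclideanSpace_fin, smul_eq_mul] at hnear
  have hvx' : v x = u x := Set.indicator_of_mem (Metric.mem_closedBall_self zero_le_one) u
  rw [hvx'] at hnear
  -- Away from `x` the kernel is of order `ρ^{-2s} / weight`.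
  have hfar : Tendsto (fun ρ : ℝ => ∫ y, ρ ^ n * meanKernel s (ρ • (y - x)) * (u y - v y))
      atTop (𝓝 0) := by
    have hlim : Tendsto (fun ρ : ℝ => ρ ^ (-(2 * s)) * (K₁ * K₀ * ∫ y, |u y| / weight s y)) atTop
        (𝓝 (0 * (K₁ * K₀ * ∫ y, |u y| / weight s y))) :=
      (tendsto_rpow_neg_atTop (by positivity)).mul_const _
    rw [zero_mul] at hlim
    refine squeeze_zero_norm' ?_ hlim
    filter_upwards [eventually_gt_atTop 0] with ρ hρ
    have := norm_integral_le_of_norm_le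
      (f := fun y => ρ ^ n * meanKernel s (ρ • (y - x)) * (u y - v y))
      (hL.integrable.const_mul (ρ ^ (-(2 * s)) * (K₁ * K₀)))
      (Eventually.of_forall fun y => ?_)
    · rwa [integral_const_mul, mul_assoc] at this
    · have hw := weight_pos s y
      by_cases hy : y ∈ Metric.closedBall x 1
      · rw [hv, Set.indicator_of_mem hy, sub_self, mul_zero, norm_zero]
        positivity
      · have hxy : 1 < ‖x - y‖ := by
          rw [Metric.mem_closedBall, not_le, dist_comm, dist_eq_norm] at hy; exact hy
        have hne : ρ • (y - x) ≠ 0 := smul_ne_zero hρ.ne' fun h => by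
          rw [← norm_neg, neg_sub, h, norm_zero] at hxy; linarith
        rw [hv, Set.indicator_of_notMem hy, sub_zero, norm_mul, Real.norm_eq_abs (u y),
          Real.norm_of_nonneg (mul_nonneg (by positivity) (meanKernel_nonneg hs0 hs1 _))]
        have e1 : ρ ^ n * (K₁ / ‖ρ • (y - x)‖ ^ p) = ρ ^ (-(2 * s)) * K₁ * (1 / ‖x - y‖ ^ p) := by
          rw [norm_smul, Real.norm_of_nonneg hρ.le, norm_sub_rev,
            Real.mul_rpow hρ.le (norm_nonneg _), hp, Real.rpow_add hρ, Real.rpow_natCast,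
            Real.rpow_neg hρ.le]
          field_simp
        calc ρ ^ n * meanKernel s (ρ • (y - x)) * |u y|
            ≤ ρ ^ n * (K₁ / ‖ρ • (y - x)‖ ^ p) * |u y| := by gcongr; exact hle _ hne
          _ ≤ ρ ^ (-(2 * s)) * K₁ * (K₀ / weight s y) * |u y| := by
            rw [e1]
            exact mul_le_mul_of_nonneg_right
              (mul_le_mul_of_nonneg_left (h₀ x y le_rfl hxy.le) (by positivity)) (abs_nonneg _)
          _ = _ := by ring
  have hsum := hnear.add hfar
  rw [add_zero] at hsum
  refine hsum.congr' ?_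
  filter_upwards [eventually_gt_atTop 0] with ρ hρ
  have hi := hL.integrable_rho_meanKernel_mul hs0 hs1 x hρ
  have hiv : Integrable fun y => ρ ^ n * meanKernel s (ρ • (y - x)) * v y := by
    refine (hi.indicator hball).congr (Eventually.of_forall fun y => ?_)
    exact Set.indicator_mul_right _ _ _
  have hneg : ∀ y, meanKernel s (ρ • (x - y)) = meanKernel s (ρ • (y - x)) := fun y => by
    rw [meanKernel, meanKernel, norm_smul, norm_smul, norm_sub_rev]
  simp only [hneg, mul_sub]
  rw [integral_sub hi hiv, add_sub_cancel]

/-- The mean value formula: the average with the kernel `ρⁿ H(ρ ·)` does not depend on `ρ`, since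
its derivative in `ρ` pairs `u` with a fractional Laplacian, and it tends to `u x` as `ρ → ∞`. -/
lemma integral_rho_meanKernel_mul {n : ℕ} [NeZero n] {s β ρ : ℝ} {u : Rn n → ℝ}
    {x : Rn n} (hs0 : 0 < s) (hs1 : s < 1) (hβ : 2 * s < β)
    (hu : HolderSpace β (Metric.ball 0 1) u) (hL : LSpace s u)
    (hharm : SHarmonicIn s (Metric.ball 0 1) u) (hρ : 0 < ρ) (h : ‖x‖ + ρ⁻¹ < 1) :
    ∫ y, ρ ^ n * meanKernel s (ρ • (y - x)) * u y = u x := by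
  have hx : ‖x‖ < 1 := by linarith [inv_pos.2 hρ]
  have hcont : ContinuousAt u x :=
    hu.continuousOn.continuousAt (Metric.isOpen_ball.mem_nhds (mem_ball_zero_iff.2 hx))
  set F : ℝ → ℝ := fun ρ => ∫ y, ρ ^ n * meanKernel s (ρ • (y - x)) * u y with hF
  have hder : ∀ r ∈ Set.Ici ρ, HasDerivAt F 0 r := fun r hr => by
    have hr0 : 0 < r := hρ.trans_le hr
    have h1 := hasDerivAt_integral_rho_meanKernel hs0 hs1 hL x hr0
    have h2 := integral_dilationKernel_mul_eq_zero (x₀ := x) hs0 hs1 hβ hu hL hharm hr0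
      (lt_of_le_of_lt (by gcongr; exact hr) h)
    simp only [mul_assoc, integral_const_mul, h2, mul_zero] at h1
    simpa only [hF, mul_assoc, integral_const_mul] using h1
  have hconst : ∀ r ∈ Set.Ici ρ, F r = F ρ := fun r hr => by
    have := Convex.norm_image_sub_le_of_norm_hasDerivWithin_le (f := F) (C := 0)
      (fun r hr => (hder r hr).hasDerivWithinAt) (fun r _ => norm_zero.le) (convex_Ici ρ)
      (Set.mem_Ici.2 le_rfl) hr
    rw [zero_mul] at this
    exact sub_eq_zero.1 (norm_le_zero_iff.1 this)
  refine tendsto_nhds_unique (tendsto_const_nhds.congr' ?_)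
    (tendsto_integral_rho_meanKernel hs0 hs1 hL hcont)
  filter_upwards [eventually_ge_atTop ρ] with r hr using (hconst r hr).symm

/-! ### The derivative at the origin -/

lemma abs_apply_zero_le_norm {n : ℕ} [NeZero n] (w : Rn n) : |w 0| ≤ ‖w‖ := by
  simpa using PiLp.norm_apply_le w 0

lemma abs_mul_psi_le {n : ℕ} [NeZero n] {s : ℝ} (hs0 : 0 < s) (hs1 : s < 1) :
    ∃ K : ℝ, 0 < K ∧ ∀ w : Rn n, |w 0 * psi s w| ≤ K / weight s w := by
  obtain ⟨K, hK, h⟩ := one_add_sq_mul_psi_le (n := n) hs0 hs1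
  refine ⟨K, hK, fun w => (le_trans ?_ (h w))⟩
  have h1 := psi_nonneg hs0 hs1 w
  rw [abs_mul, abs_of_nonneg h1]
  refine mul_le_mul_of_nonneg_right ((abs_apply_zero_le_norm w).trans ?_) h1
  nlinarith [sq_nonneg (‖w‖ - 1)]

lemma norm_e1 (n : ℕ) [NeZero n] : ‖e1 n‖ = 1 := by simp [e1]

lemma norm_sub_smul_e1_sq {n : ℕ} [NeZero n] (y : Rn n) (t : ℝ) :
    ‖y - t • e1 n‖ ^ 2 = ‖y‖ ^ 2 - 2 * t * y 0 + t ^ 2 := by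
  have h : inner ℝ y (e1 n) = y 0 := by
    rw [e1, EuclideanSpace.inner_single_right]; simp
  rw [norm_sub_sq_real, inner_smul_right, h, norm_smul, norm_e1, mul_one, Real.norm_eq_abs, sq_abs]
  ring

/-- The derivative of a translate of `H(ρ ·)` in the direction `e₁`, from `∇H(y) = -ψ_s(y) y`. -/
lemma hasDerivAt_translate_meanKernel {n : ℕ} [NeZero n] {s : ℝ} (hs0 : 0 < s) (hs1 : s < 1)
    (y : Rn n) (ρ t : ℝ) :
    HasDerivAt (fun t : ℝ => meanKernel s (ρ • (y - t • e1 n)))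
      (ρ * ((ρ • (y - t • e1 n)) 0 * psi s (ρ • (y - t • e1 n)))) t := by
  have hq : ∀ t : ℝ, ‖ρ • (y - t • e1 n)‖ ^ 2 = ρ ^ 2 * (‖y‖ ^ 2 - 2 * t * y 0 + t ^ 2) :=
    fun t => by rw [norm_smul, mul_pow, Real.norm_eq_abs, sq_abs, norm_sub_smul_e1_sq]
  have h1 := hasDerivAt_meanProfile hs0 hs1 (ρ • (y - t • e1 n))
  rw [hq] at h1
  have h2 : HasDerivAt (fun t : ℝ => ρ ^ 2 * (‖y‖ ^ 2 - 2 * t * y 0 + t ^ 2))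
      (ρ ^ 2 * (-(2 * y 0) + 2 * t)) t := by
    have a1 := (((hasDerivAt_id t).const_mul 2).mul_const (y 0)).const_sub (‖y‖ ^ 2)
    have a2 := (a1.add (hasDerivAt_pow 2 t)).const_mul (ρ ^ 2)
    refine a2.congr_deriv ?_
    simp
  have e : ∀ t : ℝ, meanKernel s (ρ • (y - t • e1 n)) =
      psiConst n s / 4 * kernelProfile n s (ρ ^ 2 * (‖y‖ ^ 2 - 2 * t * y 0 + t ^ 2)) := fun t => by
    rw [meanKernel, hq]
  refine ((h1.comp t h2).congr_of_eventuallyEq (Eventually.of_forall e)).congr_deriv ?_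
  have h3 : (ρ • (y - t • e1 n)) 0 = ρ * (y 0 - t) := by simp [e1]
  rw [h3]
  ring

lemma hasDerivAt_integral_translate_meanKernel {n : ℕ} [NeZero n] {s ρ : ℝ} {u : Rn n → ℝ}
    (hs0 : 0 < s) (hs1 : s < 1) (hL : LSpace s u) (hρ : 0 < ρ) :
    HasDerivAt (fun t : ℝ => ∫ y, ρ ^ n * meanKernel s (ρ • (y - t • e1 n)) * u y)
      (∫ y, ρ ^ n * (ρ * ((ρ • y) 0 * psi s (ρ • y))) * u y) 0 := by
  obtain ⟨K₀, hK₀, h₀⟩ := weight_inv_le_of_le (n := n) hs0 1 hρ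
  obtain ⟨K₂, hK₂, h₂⟩ := abs_mul_psi_le (n := n) hs0 hs1
  have hpsi := continuous_psi (n := n) hs0 hs1
  have hmeas : ∀ t : ℝ, Continuous fun y : Rn n =>
      ρ ^ n * meanKernel s (ρ • (y - t • e1 n)) := fun t =>
    continuous_const.mul ((continuous_meanKernel hs0 hs1).comp (by fun_prop))
  have hmeas' : Continuous fun y : Rn n =>
      ρ ^ n * (ρ * ((ρ • (y - (0:ℝ) • e1 n)) 0 * psi s (ρ • (y - (0:ℝ) • e1 n)))) := by
    fun_prop
  have h := (hasDerivAt_integral_of_dominated_loc_of_deriv_le (s := Metric.ball (0:ℝ) 1)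
    (bound := fun y => ρ ^ n * (ρ * (K₂ * K₀)) * (|u y| / weight s y))
    (F := fun t y => ρ ^ n * meanKernel s (ρ • (y - t • e1 n)) * u y)
    (F' := fun t y => ρ ^ n * (ρ * ((ρ • (y - t • e1 n)) 0 * psi s (ρ • (y - t • e1 n)))) * u y)
    (Metric.ball_mem_nhds 0 one_pos)
    (Eventually.of_forall fun t => (hmeas t).aestronglyMeasurable.mul hL.aestronglyMeasurable)
    (hL.integrable_rho_meanKernel_mul hs0 hs1 _ hρ)
    (hmeas'.aestronglyMeasurable.mul hL.aestronglyMeasurable)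
    (Eventually.of_forall fun y t ht => ?_) (hL.integrable.const_mul _)
    (Eventually.of_forall fun y t ht =>
      ((hasDerivAt_translate_meanKernel hs0 hs1 y ρ t).const_mul (ρ ^ n)).mul_const (u y))).2
  · simpa only [zero_smul, sub_zero] using h
  · have hx : ‖t • e1 n‖ ≤ 1 := by
      rw [norm_smul, norm_e1, mul_one]
      exact (mem_ball_zero_iff.1 ht).le
    rw [norm_mul, norm_mul, norm_mul, Real.norm_of_nonneg hρ.le,
      Real.norm_of_nonneg (by positivity : 0 ≤ ρ ^ n), Real.norm_eq_abs, Real.norm_eq_abs]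
    have h3 : |(ρ • (y - t • e1 n)) 0 * psi s (ρ • (y - t • e1 n))| ≤
        K₂ * (K₀ / weight s y) := by
      refine (h₂ _).trans ?_
      rw [div_eq_mul_one_div]
      exact mul_le_mul_of_nonneg_left (h₀ _ y hx ρ le_rfl) hK₂.le
    calc ρ ^ n * (ρ * |(ρ • (y - t • e1 n)) 0 * psi s (ρ • (y - t • e1 n))|) * |u y|
        ≤ ρ ^ n * (ρ * (K₂ * (K₀ / weight s y))) * |u y| := by gcongr
      _ = _ := by ring

lemma LSpace.integrable_mul_psi_mul {n : ℕ} [NeZero n] {s : ℝ} {u : Rn n → ℝ}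
    (hL : LSpace s u) (hs0 : 0 < s) (hs1 : s < 1) :
    Integrable fun y : Rn n => y 0 * psi s y * u y := by
  obtain ⟨K, hK, h⟩ := abs_mul_psi_le (n := n) hs0 hs1
  have hpsi := continuous_psi (n := n) hs0 hs1
  exact hL.integrable_kernel_mul (Continuous.aestronglyMeasurable (by fun_prop)) h

/-- The mean value formula holds on all balls `B_{1/ρ}` with `ρ > 1`; the representation on the
unit ball itself is the limit `ρ → 1`. -/
lemma tendsto_integral_derivKernel {n : ℕ} [NeZero n] {s : ℝ} {u : Rn n → ℝ}
    (hs0 : 0 < s) (hs1 : s < 1) (hL : LSpace s u) :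
    Tendsto (fun ρ : ℝ => ∫ y, ρ ^ n * (ρ * ((ρ • y) 0 * psi s (ρ • y))) * u y) (𝓝[>] 1)
      (𝓝 (∫ y, y 0 * psi s y * u y)) := by
  obtain ⟨K₀, hK₀, h₀⟩ := weight_inv_le_of_le (n := n) hs0 0 one_pos
  obtain ⟨K₂, hK₂, h₂⟩ := abs_mul_psi_le (n := n) hs0 hs1
  have hpsi := continuous_psi (n := n) hs0 hs1
  refine tendsto_integral_filter_of_dominated_convergence
    (fun y => 2 ^ n * (2 * (K₂ * K₀)) * (|u y| / weight s y)) (Eventually.of_forall fun ρ => ?_) ?_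
    (hL.integrable.const_mul _) (Eventually.of_forall fun y => ?_)
  · exact (Continuous.aestronglyMeasurable (by fun_prop)).mul hL.aestronglyMeasurable
  · filter_upwards [Ioo_mem_nhdsGT (by norm_num : (1:ℝ) < 2)] with ρ hρ
    refine Eventually.of_forall fun y => ?_
    have hρ0 : 0 < ρ := one_pos.trans hρ.1
    rw [norm_mul, norm_mul, norm_mul, Real.norm_of_nonneg hρ0.le,
      Real.norm_of_nonneg (by positivity : 0 ≤ ρ ^ n), Real.norm_eq_abs, Real.norm_eq_abs]
    have h4 := h₀ 0 y (by simp) ρ hρ.1.le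
    rw [sub_zero] at h4
    have h3 : |(ρ • y) 0 * psi s (ρ • y)| ≤ K₂ * (K₀ / weight s y) := by
      refine (h₂ _).trans ?_
      rw [div_eq_mul_one_div]
      exact mul_le_mul_of_nonneg_left h4 hK₂.le
    calc ρ ^ n * (ρ * |(ρ • y) 0 * psi s (ρ • y)|) * |u y|
        ≤ 2 ^ n * (2 * (K₂ * (K₀ / weight s y))) * |u y| := by
          gcongr
          · exact hρ.2.le
          · exact hρ.2.le
      _ = _ := by ring
  · have hc : Continuous fun ρ : ℝ => ρ ^ n * (ρ * ((ρ • y) 0 * psi s (ρ • y))) * u y := by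
      fun_prop
    have := hc.tendsto 1
    simp only [one_smul, one_pow, one_mul] at this
    exact this.mono_left nhdsWithin_le_nhds

/-- The derivative formula at the origin; antisymmetry is not used. -/
lemma hasLineDerivAt_integral_mul_psi {n : ℕ} [NeZero n] {s β : ℝ} {u : Rn n → ℝ}
    (hs0 : 0 < s) (hs1 : s < 1) (hβ : 2 * s < β)
    (hu : HolderSpace β (Metric.ball 0 1) u) (hL : LSpace s u)
    (hharm : SHarmonicIn s (Metric.ball 0 1) u) :
    HasLineDerivAt ℝ u (∫ y : Rn n, y 0 * psi s y * u y) 0 (e1 n) := by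
  have hder : ∀ ρ : ℝ, 1 < ρ → HasDerivAt (fun t : ℝ => u (0 + t • e1 n))
      (∫ y, ρ ^ n * (ρ * ((ρ • y) 0 * psi s (ρ • y))) * u y) 0 := fun ρ hρ => by
    have hρ0 : 0 < ρ := one_pos.trans hρ
    refine (hasDerivAt_integral_translate_meanKernel hs0 hs1 hL hρ0).congr_of_eventuallyEq ?_
    have hpos : 0 < 1 - ρ⁻¹ := sub_pos.2 (inv_lt_one_of_one_lt₀ hρ)
    filter_upwards [Metric.ball_mem_nhds (0:ℝ) hpos] with t ht
    have ht' : ‖t • e1 n‖ < 1 - ρ⁻¹ := by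
      rw [norm_smul, norm_e1, mul_one]
      exact mem_ball_zero_iff.1 ht
    rw [zero_add]
    exact (integral_rho_meanKernel_mul hs0 hs1 hβ hu hL hharm hρ0 (by linarith)).symm
  -- By uniqueness of derivatives, the integral does not depend on `ρ > 1`.
  have hval : ∀ᶠ ρ in 𝓝[>] (1:ℝ),
      (∫ y, (2:ℝ) ^ n * (2 * (((2:ℝ) • y) 0 * psi s ((2:ℝ) • y))) * u y) =
      ∫ y, ρ ^ n * (ρ * ((ρ • y) 0 * psi s (ρ • y))) * u y := by
    filter_upwards [self_mem_nhdsWithin] with ρ hρ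
    exact (hder 2 one_lt_two).unique (hder ρ hρ)
  have := tendsto_nhds_unique (tendsto_const_nhds.congr' hval)
    (tendsto_integral_derivKernel hs0 hs1 hL)
  have h2 := hder 2 one_lt_two
  rwa [this] at h2

/-! ### Antisymmetric functions -/

lemma measurableSet_halfSpace (n : ℕ) [NeZero n] : MeasurableSet (halfSpace n) :=
  (isOpen_lt continuous_const (by fun_prop : Continuous fun x : Rn n => x 0)).measurableSet

/-- The reflection across `{x₁ = 0}` as a linear isometry. -/
noncomputable def reflectIsometry (n : ℕ) [NeZero n] : Rn n ≃ₗᵢ[ℝ] Rn n :=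
  LinearIsometryEquiv.piLpCongrRight 2 fun i =>
    if i = 0 then LinearIsometryEquiv.neg ℝ else LinearIsometryEquiv.refl ℝ ℝ

lemma reflectIsometry_apply {n : ℕ} [NeZero n] (x : Rn n) : reflectIsometry n x = reflect x := by
  ext i
  by_cases h : i = 0 <;> simp [reflectIsometry, reflect, h]

lemma norm_reflect {n : ℕ} [NeZero n] (x : Rn n) : ‖reflect x‖ = ‖x‖ := by
  rw [← reflectIsometry_apply, LinearIsometryEquiv.norm_map]

lemma reflect_apply_zero {n : ℕ} [NeZero n] (x : Rn n) : reflect x 0 = -x 0 := by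
  simp [reflect]

/-- An integral of a reflection invariant function that vanishes on `{x₁ = 0}` is twice the
integral over the half-space. -/
lemma integral_eq_two_mul_setIntegral_halfSpace {n : ℕ} [NeZero n] {g : Rn n → ℝ}
    (hg : Integrable g) (hsymm : ∀ x, g (reflect x) = g x) (h0 : ∀ x : Rn n, x 0 = 0 → g x = 0) :
    ∫ x, g x = 2 * ∫ x in halfSpace n, g x := by
  have hm := measurableSet_halfSpace n
  have hr : (reflect : Rn n → Rn n) = reflectIsometry n :=
    funext fun x => (reflectIsometry_apply x).symm
  have h1 : ∫ x, (halfSpace n).indicator g (reflect x) = ∫ x, (halfSpace n).indicator g x := by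
    rw [hr]
    exact (reflectIsometry n).measurePreserving.integral_comp
      (reflectIsometry n).toHomeomorph.measurableEmbedding _
  have hi := hg.indicator hm
  have hi' : Integrable fun x => (halfSpace n).indicator g (reflect x) := by
    rw [hr]
    exact (reflectIsometry n).measurePreserving.integrable_comp_of_integrable hi
  have h2 : ∀ x, g x = (halfSpace n).indicator g x + (halfSpace n).indicator g (reflect x) := by
    intro x
    have hmem : x ∈ halfSpace n ↔ 0 < x 0 := Iff.rfl
    have hmem' : reflect x ∈ halfSpace n ↔ x 0 < 0 := by
      change 0 < reflect x 0 ↔ x 0 < 0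
      rw [reflect_apply_zero, neg_pos]
    rcases lt_trichotomy (x 0) 0 with h | h | h
    · rw [Set.indicator_of_notMem (by rw [hmem]; exact h.not_gt),
        Set.indicator_of_mem (hmem'.2 h), hsymm, zero_add]
    · rw [Set.indicator_of_notMem (by rw [hmem, h]; exact lt_irrefl 0),
        Set.indicator_of_notMem (by rw [hmem', h]; exact lt_irrefl 0), h0 x h, zero_add]
    · rw [Set.indicator_of_mem (hmem.2 h),
        Set.indicator_of_notMem (by rw [hmem']; exact h.not_gt), add_zero]
  calc ∫ x, g x = ∫ x, ((halfSpace n).indicator g x + (halfSpace n).indicator g (reflect x)) := by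
        congr 1; ext x; exact h2 x
    _ = _ := by rw [integral_add hi hi', h1, integral_indicator hm, two_mul]

end AntisymHarmonic

theorem mainTheorem10 (n : ℕ) [NeZero n] (s : ℝ) (hs0 : 0 < s) (hs1 : s < 1) :
    Continuous (AntisymHarmonic.psi s : AntisymHarmonic.Rn n → ℝ) ∧
    (∀ y z : AntisymHarmonic.Rn n, ‖y‖ = ‖z‖ → AntisymHarmonic.psi s y = AntisymHarmonic.psi s z) ∧
    ∃ C : ℝ, 1 < C ∧
      (∀ y : AntisymHarmonic.Rn n,
        C⁻¹ / (1 + ‖y‖ ^ ((n : ℝ) + 2 * s + 2)) ≤ AntisymHarmonic.psi s y ∧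
        AntisymHarmonic.psi s y ≤ C / (1 + ‖y‖ ^ ((n : ℝ) + 2 * s + 2))) ∧
      ∀ (α : ℝ) (u : AntisymHarmonic.Rn n → ℝ),
        0 < α → (∀ m : ℤ, 2 * s + α ≠ (m : ℝ)) →
        AntisymHarmonic.HolderSpace (2 * s + α) (Metric.ball 0 1) u →
        AntisymHarmonic.LSpace s u →
        AntisymHarmonic.Antisymmetric u →
        AntisymHarmonic.SHarmonicIn s (Metric.ball 0 1) u →
        Integrable (fun y : AntisymHarmonic.Rn n => y 0 * AntisymHarmonic.psi s y * u y) ∧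
        HasLineDerivAt ℝ u
          (∫ y : AntisymHarmonic.Rn n, y 0 * AntisymHarmonic.psi s y * u y)
          0 (AntisymHarmonic.e1 n) ∧
        ((∀ x ∈ AntisymHarmonic.halfSpace n, 0 ≤ u x) →
          IntegrableOn (AntisymHarmonic.ADensity s u) (AntisymHarmonic.halfSpace n) ∧
          C⁻¹ * AntisymHarmonic.ANorm s u ≤ lineDeriv ℝ u 0 (AntisymHarmonic.e1 n) ∧
          lineDeriv ℝ u 0 (AntisymHarmonic.e1 n) ≤ C * AntisymHarmonic.ANorm s u) := by
  open AntisymHarmonic in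
  obtain ⟨K, hK, hupper⟩ := psi_upper_bound (n := n) hs0 hs1
  obtain ⟨c, hc, hlower⟩ := psi_lower_bound (n := n) hs0 hs1
  refine ⟨continuous_psi hs0 hs1, fun y z h => psi_eq_of_norm_eq s h, ?_⟩
  -- The factor `2` in the upper bound comes from the two half-spaces.
  set C : ℝ := 2 * K + c⁻¹ + 1 with hC
  have hC1 : 1 < C := by have := inv_pos.2 hc; linarith
  have hC0 : 0 < C := one_pos.trans hC1
  have hCK : 2 * K ≤ C := by have := inv_pos.2 hc; linarith
  have hCc : C⁻¹ ≤ c := by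
    rw [inv_le_comm₀ hC0 hc]; linarith
  refine ⟨C, hC1, fun y => ⟨le_trans (by gcongr) (hlower y),
    (hupper y).trans (by gcongr; linarith)⟩, fun α u hα _ hu hL hanti hharm => ?_⟩
  have hint := hL.integrable_mul_psi_mul hs0 hs1
  have hder := hasLineDerivAt_integral_mul_psi hs0 hs1 (by linarith) hu hL hharm
  refine ⟨hint, hder, fun hpos => ?_⟩
  have hm := measurableSet_halfSpace n
  have hlow : ∀ x ∈ halfSpace n, c * ADensity s u x ≤ x 0 * psi s x * u x := fun x hx => by
    have hx0 : 0 < x 0 := hx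
    have hux := hpos x hx
    rw [ADensity, abs_of_nonneg hux]
    calc c * (x 0 * u x / (1 + ‖x‖ ^ ((n : ℝ) + 2 * s + 2)))
        = x 0 * (c / (1 + ‖x‖ ^ ((n : ℝ) + 2 * s + 2))) * u x := by ring
      _ ≤ _ := by gcongr; exact hlower x
  have hup : ∀ x ∈ halfSpace n, x 0 * psi s x * u x ≤ K * ADensity s u x := fun x hx => by
    have hx0 : 0 < x 0 := hx
    have hux := hpos x hx
    rw [ADensity, abs_of_nonneg hux]
    calc x 0 * psi s x * u x ≤ x 0 * (K / (1 + ‖x‖ ^ ((n : ℝ) + 2 * s + 2))) * u x := by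
          gcongr; exact hupper x
      _ = _ := by ring
  have hnn : ∀ x ∈ halfSpace n, 0 ≤ ADensity s u x := fun x hx => by
    have hx0 : 0 < x 0 := hx
    rw [ADensity]; positivity
  have hAmeas : AEStronglyMeasurable (ADensity s u) volume := by
    have hp : 0 ≤ (n : ℝ) + 2 * s + 2 := by positivity
    have hcont : Continuous fun x : Rn n => (1 + ‖x‖ ^ ((n : ℝ) + 2 * s + 2))⁻¹ :=
      (continuous_const.add (continuous_norm.rpow_const fun _ => Or.inr hp)).inv₀
        fun x => (by positivity : (0:ℝ) < 1 + ‖x‖ ^ ((n : ℝ) + 2 * s + 2)).ne'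
    have h0 : Continuous fun x : Rn n => x 0 := by fun_prop
    exact (h0.aestronglyMeasurable.mul hL.aestronglyMeasurable.norm).mul hcont.aestronglyMeasurable
  have hAint : IntegrableOn (ADensity s u) (halfSpace n) := by
    refine Integrable.mono' (hint.integrableOn.const_mul c⁻¹) hAmeas.restrict ?_
    filter_upwards [ae_restrict_mem hm] with x hx
    rw [Real.norm_of_nonneg (hnn x hx), ← inv_mul_le_iff₀ (inv_pos.2 hc), inv_inv]
    exact hlow x hx
  have htwo := integral_eq_two_mul_setIntegral_halfSpace hint
    (fun x => by rw [reflect_apply_zero, psi_eq_of_norm_eq s (norm_reflect x), hanti x]; ring)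
    (fun x hx => by rw [hx]; ring)
  have hA0 : 0 ≤ ANorm s u := setIntegral_nonneg hm hnn
  have h1 : c * ANorm s u ≤ ∫ x in halfSpace n, x 0 * psi s x * u x := by
    rw [ANorm, ← integral_const_mul]
    exact setIntegral_mono_on (hAint.const_mul c) hint.integrableOn hm hlow
  have h2 : ∫ x in halfSpace n, x 0 * psi s x * u x ≤ K * ANorm s u := by
    rw [ANorm, ← integral_const_mul]
    exact setIntegral_mono_on hint.integrableOn (hAint.const_mul K) hm hup
  rw [hder.lineDeriv, htwo]
  refine ⟨hAint, ?_, ?_⟩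
  · have h3 : C⁻¹ * ANorm s u ≤ c * ANorm s u := by gcongr
    have h4 : 0 ≤ c * ANorm s u := by positivity
    linarith
  · have h3 : 2 * K * ANorm s u ≤ C * ANorm s u := by gcongr
    linarith
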